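/- Let $G$ be a locally compact Hausdorff groupoid with unit space $G^0$, range and source maps $r,s$, and a left invariant Haar system $\alpha=(\alpha^x)_{x\in G^0}$; let $\tilde\alpha_x$ be the image of $\alpha^x$ under inversion. Let $\mathcal A=(\mathcal A_g)_{g\in G}$ be a Fell bundle over $G$ (an upper semicontinuous field of Banach spaces with the usual continuous multiplications $\mathcal A_g\times\mathcal A_h\to\mathcal A_{gh}$ and involutions $\mathcal A_g\to\mathcal A_{g^{-1}}$; it need not be saturated or separable). Let $C_c(G,\mathcal A)$ be the $^*$-algebra of compactly supported continuous sections with $(f_1*f_2)(g)=\int f_1(h)f_2(h^{-1}g)\,d\alpha^{r(g)}(h)$ and $f^*(g)=f(g^{-1})^*$. Put $\|f\|_I=\max\{\sup_x\int\|f(g)\|\,d\alpha^x(g),\ \sup_x\int\|f(g)\|\,d\tilde\alpha_x(g)\}$. The inductive limit topology on $C_c(G,\mathcal A)$ is the locally convex inductive limit, over compact $K\subseteq G$, of the spaces of continuous sections supported in $K$ with the supremum norm. The full section algebra $C^*(G,\mathcal A)$ is the (Hausdorff) completion of $C_c(G,\mathcal A)$ in the largest $C^*$-seminorm that is dominated by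 $\|\cdot\|_I$. Let $D$ be a $C^*$-algebra and $\mathcal F$ a Hilbert $D$-module, with adjointable operators $\mathbb B(\mathcal F)$. A representation of $C_c(G,\mathcal A)$ on $\mathcal F$ is a $^*$-homomorphism $C_c(G,\mathcal A)\to\mathbb B(\mathcal F)$. A pre-representation of $C_c(G,\mathcal A)$ on $\mathcal F$ consists of a complex vector space $\mathcal F_0$, a linear map $\iota\colon\mathcal F_0\to\mathcal F$ with dense image, and a bilinear map $L\colon C_c(G,\mathcal A)\times\mathcal F_0\to\mathcal F$, $(f,\xi)\mapsto L(f)\xi$, such that (1) for all $\xi,\eta\in\mathcal F_0$ and every compact $K\subseteq G$, the map $f\mapsto\langle\iota(\xi),L(f)\eta\rangle_D$ is bounded for the supremum norm on the continuous sections supported in $K$; (2) $\langle L(f_1)\xi,L(f_2)\eta\rangle_D=\langle\iota(\xi),L(f_1^**f_2)\eta\rangle_D$ for all $\xi,\eta\in\mathcal F_0$, $f_1,f_2\in C_c(G,\mathcal A)$; (3) the linear span of the vectors $L(f)\xi$ is dense in $\mathcal F$. Then: (a) For every pre-representation $(L,\iota,\mathcal F_0)$ of $C_c(G,\mathcal A)$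 on $\mathcal F$ there is a nondegenerate representation $L'\colon C_c(G,\mathcal A)\to\mathbb B(\mathcal F)$ that is bounded with respect to the $I$-norm and satisfies $L'(f)(\iota(\xi))=L(f)\xi$ and $L'(f)(L(f_2)\xi)=L(f*f_2)\xi$ for all $f,f_2\in C_c(G,\mathcal A)$, $\xi\in\mathcal F_0$. (b) A representation of $C_c(G,\mathcal A)$ on $\mathcal F$ is bounded in the $I$-norm if and only if it is continuous from the inductive limit topology to the operator norm. (c) A $^*$-homomorphism $\varphi\colon C_c(G,\mathcal A)\to D$ is continuous in the inductive limit topology if and only if it is bounded in the $I$-norm. In that case it extends uniquely to a $^*$-homomorphism $C^*(G,\mathcal A)\to D$. -/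

import Mathlib

open Filter Topology MeasureTheory Set
open scoped ENNReal

universe u₀ u w v v' v''

noncomputable section

set_option linter.unusedSectionVars false

/-! ## Topological groupoids and Haar systems -/

/-- A topological groupoid with object space `G₀` and arrow space `G`. The product `comp g h` is
defined for the composable pairs, those with `s g = r h`. -/
structure TopGroupoid (G₀ : Type u₀) (G : Type u) [TopologicalSpace G₀] [TopologicalSpace G] where
  /-- range -/
  r : G → G₀
  /-- source -/
  s : G → G₀
  /-- unit arrows -/
  unit : G₀ → G
  /-- inversion -/
  inv : G → G
  /-- product of composable arrows -/
  comp : ∀ g h : G, s g = r h → G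
  r_unit : ∀ x, r (unit x) = x
  s_unit : ∀ x, s (unit x) = x
  r_inv : ∀ g, r (inv g) = s g
  s_inv : ∀ g, s (inv g) = r g
  r_comp : ∀ g h e, r (comp g h e) = r g
  s_comp : ∀ g h e, s (comp g h e) = s h
  assoc : ∀ (g h k : G) (e : s g = r h) (e' : s h = r k),
    comp (comp g h e) k ((s_comp g h e).trans e') =
      comp g (comp h k e') (e.trans (r_comp h k e').symm)
  unit_comp : ∀ g, comp (unit (r g)) g (s_unit (r g)) = g
  comp_unit : ∀ g, comp g (unit (s g)) (r_unit (s g)).symm = g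
  inv_comp : ∀ g, comp (inv g) g (s_inv g) = unit (s g)
  comp_inv : ∀ g, comp g (inv g) (r_inv g).symm = unit (r g)
  continuous_r : Continuous r
  continuous_s : Continuous s
  continuous_unit : Continuous unit
  continuous_inv : Continuous inv
  continuous_comp : Continuous fun p : {p : G × G // s p.1 = r p.2} => comp p.1.1 p.1.2 p.2

namespace TopGroupoid

variable {G₀ : Type u₀} {G : Type u} [TopologicalSpace G₀] [TopologicalSpace G]
  (𝒢 : TopGroupoid G₀ G)

theorem composable_inv {h g : G} (e : 𝒢.r h = 𝒢.r g) : 𝒢.s (𝒢.inv h) = 𝒢.r g :=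
  (𝒢.s_inv h).trans e

theorem composable_inv_comp {h g : G} (e : 𝒢.r h = 𝒢.r g) :
    𝒢.s h = 𝒢.r (𝒢.comp (𝒢.inv h) g (𝒢.composable_inv e)) := by
  rw [𝒢.r_comp, 𝒢.r_inv]

theorem comp_congr {a a' b b' : G} (ha : a = a') (hb : b = b') (e : 𝒢.s a = 𝒢.r b)
    (e' : 𝒢.s a' = 𝒢.r b') : 𝒢.comp a b e = 𝒢.comp a' b' e' := by
  subst ha; subst hb; rfl

/-- `h (h⁻¹ g) = g`. -/
theorem comp_inv_comp {h g : G} (e : 𝒢.r h = 𝒢.r g) :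
    𝒢.comp h (𝒢.comp (𝒢.inv h) g (𝒢.composable_inv e)) (𝒢.composable_inv_comp e) = g := by
  rw [← 𝒢.assoc h (𝒢.inv h) g (𝒢.r_inv h).symm (𝒢.composable_inv e)]
  rw [𝒢.comp_congr (𝒢.comp_inv h) rfl _ ((𝒢.s_unit _).trans e)]
  rw [𝒢.comp_congr (congrArg 𝒢.unit e) rfl _ (𝒢.s_unit _)]
  exact 𝒢.unit_comp g

/-- `(g⁻¹)⁻¹ = g`. -/
theorem inv_inv (g : G) : 𝒢.inv (𝒢.inv g) = g := by
  have e1 : 𝒢.s (𝒢.inv (𝒢.inv g)) = 𝒢.r (𝒢.inv g) := 𝒢.s_inv _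
  have e2 : 𝒢.s (𝒢.inv g) = 𝒢.r g := 𝒢.s_inv _
  have h1 := 𝒢.assoc _ _ _ e1 e2
  rw [𝒢.comp_congr (𝒢.inv_comp (𝒢.inv g)) rfl _ ((𝒢.s_unit _).trans e2),
    𝒢.comp_congr (congrArg 𝒢.unit e2) rfl _ (𝒢.s_unit _), 𝒢.unit_comp] at h1
  have e3 : 𝒢.s g = 𝒢.s (𝒢.inv (𝒢.inv g)) := by rw [𝒢.s_inv, 𝒢.r_inv]
  rw [𝒢.comp_congr rfl (𝒢.inv_comp g) _ (by rw [𝒢.r_unit, e3]),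
    𝒢.comp_congr rfl (congrArg 𝒢.unit e3) _ (𝒢.r_unit _).symm, 𝒢.comp_unit] at h1
  exact h1.symm

end TopGroupoid

/-- A (left invariant) Haar system on a groupoid with locally compact Hausdorff arrow space: a
family of Radon measures `meas x`, where the support of `meas x` is the whole range fibre
`{g | r g = x}`, which is continuous and invariant under left multiplication. -/
structure HaarSystem {G₀ : Type u₀} {G : Type u} [TopologicalSpace G₀] [TopologicalSpace G]
    [MeasurableSpace G] (𝒢 : TopGroupoid G₀ G) where
  meas : G₀ → Measure G
  regular : ∀ x, (meas x).Regular
  meas_compl : ∀ x, meas x {g | 𝒢.r g ≠ x} = 0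
  meas_pos : ∀ x (U : Set G), IsOpen U → (∃ g ∈ U, 𝒢.r g = x) → 0 < meas x U
  continuous_integral : ∀ f : G → ℝ, Continuous f → HasCompactSupport f →
    Continuous fun x => ∫ g, f g ∂(meas x)
  left_invariant : ∀ f : G → ℝ, Continuous f → HasCompactSupport f → ∀ g : G,
    (open Classical in
      ∫ h, (if e : 𝒢.s g = 𝒢.r h then f (𝒢.comp g h e) else 0) ∂(meas (𝒢.s g))) =
      ∫ h, f h ∂(meas (𝒢.r g))

/-! ## Upper semicontinuous fields of Banach spaces -/

/-- The total space `⨆ x, A x` of a family `A` indexed by `X` (a copy of the sigma type that does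
not carry the disjoint union topology). -/
@[ext]
structure TotalSp {X : Type u} (A : X → Type w) where
  pt : X
  val : A pt

/-- The identification of equal fibres. -/
def transport {X : Type u} (A : X → Type w) {x y : X} (e : x = y) (a : A x) : A y := e ▸ a

theorem TotalSp.mk_transport {X : Type u} {A : X → Type w} {x y : X} (e : x = y) (a : A x) :
    (⟨y, transport A e a⟩ : TotalSp A) = ⟨x, a⟩ := by subst e; rfl

/-- The topology on the total space turns the family of Banach spaces `A` into an upper
semicontinuous field (bundle) of Banach spaces over `X`. -/
structure IsUSCField {X : Type u} [TopologicalSpace X] (A : X → Type w)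
    [∀ x, NormedAddCommGroup (A x)] [∀ x, NormedSpace ℂ (A x)]
    [TopologicalSpace (TotalSp A)] : Prop where
  continuous_pt : Continuous (TotalSp.pt : TotalSp A → X)
  isOpenMap_pt : IsOpenMap (TotalSp.pt : TotalSp A → X)
  usc_norm : UpperSemicontinuous fun a : TotalSp A => ‖a.val‖
  continuous_add : Continuous fun p : {p : TotalSp A × TotalSp A // p.2.pt = p.1.pt} =>
    (⟨p.1.1.pt, p.1.1.val + transport A p.2 p.1.2.val⟩ : TotalSp A)
  continuous_smul : Continuous fun p : ℂ × TotalSp A => (⟨p.2.pt, p.1 • p.2.val⟩ : TotalSp A)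
  nhds_zero : ∀ x : X, comap TotalSp.pt (𝓝 x) ⊓ comap (fun a : TotalSp A => ‖a.val‖) (𝓝 0) ≤
    𝓝 (⟨x, 0⟩ : TotalSp A)

/-- The section `f` of the family `A` as a map to the total space. -/
def sectionMap {X : Type u} {A : X → Type w} (f : ∀ x, A x) (x : X) : TotalSp A := ⟨x, f x⟩

namespace IsUSCField

variable {X : Type u} [TopologicalSpace X] {A : X → Type w}
    [∀ x, NormedAddCommGroup (A x)] [∀ x, NormedSpace ℂ (A x)]
    [TopologicalSpace (TotalSp A)]

theorem tendsto_add (hA : IsUSCField A) {ι : Type*} {l : Filter ι} {p : ι → X}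
    {a b : ∀ i, A (p i)} {x : X} {a₀ b₀ : A x}
    (ha : Tendsto (fun i => (⟨p i, a i⟩ : TotalSp A)) l (𝓝 ⟨x, a₀⟩))
    (hb : Tendsto (fun i => (⟨p i, b i⟩ : TotalSp A)) l (𝓝 ⟨x, b₀⟩)) :
    Tendsto (fun i => (⟨p i, a i + b i⟩ : TotalSp A)) l (𝓝 ⟨x, a₀ + b₀⟩) := by
  have h1 := hA.continuous_add.tendsto ⟨(⟨x, a₀⟩, ⟨x, b₀⟩), rfl⟩
  have h2 : Tendsto (fun i => (⟨(⟨p i, a i⟩, ⟨p i, b i⟩), rfl⟩ :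
      {p : TotalSp A × TotalSp A // p.2.pt = p.1.pt})) l (𝓝 ⟨(⟨x, a₀⟩, ⟨x, b₀⟩), rfl⟩) := by
    rw [tendsto_subtype_rng]
    exact ha.prodMk_nhds hb
  exact h1.comp h2

theorem tendsto_smul (hA : IsUSCField A) {ι : Type*} {l : Filter ι} {p : ι → X}
    {c : ι → ℂ} {a : ∀ i, A (p i)} {x : X} {c₀ : ℂ} {a₀ : A x} (hc : Tendsto c l (𝓝 c₀))
    (ha : Tendsto (fun i => (⟨p i, a i⟩ : TotalSp A)) l (𝓝 ⟨x, a₀⟩)) :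
    Tendsto (fun i => (⟨p i, c i • a i⟩ : TotalSp A)) l (𝓝 ⟨x, c₀ • a₀⟩) :=
  (hA.continuous_smul.tendsto (c₀, ⟨x, a₀⟩)).comp (hc.prodMk_nhds ha)

theorem tendsto_zero (hA : IsUSCField A) {ι : Type*} {l : Filter ι} {p : ι → X}
    {a : ∀ i, A (p i)} {x : X} (hp : Tendsto p l (𝓝 x)) (ha : Tendsto (fun i => ‖a i‖) l (𝓝 0)) :
    Tendsto (fun i => (⟨p i, a i⟩ : TotalSp A)) l (𝓝 ⟨x, 0⟩) := by
  refine Tendsto.mono_right ?_ (hA.nhds_zero x)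
  rw [tendsto_inf, tendsto_comap_iff, tendsto_comap_iff]
  exact ⟨hp, ha⟩

/-- The space of continuous sections with compact support. -/
def cc (hA : IsUSCField A) : Submodule ℂ (∀ x, A x) where
  carrier := {f | Continuous (sectionMap f) ∧ ∃ K : Set X, IsCompact K ∧ ∀ x ∉ K, f x = 0}
  zero_mem' := by
    refine ⟨continuous_iff_continuousAt.2 fun x => ?_, ∅, isCompact_empty, fun x _ => rfl⟩
    exact hA.tendsto_zero (p := fun x => x) tendsto_id (by simp)
  add_mem' := by
    rintro f g ⟨hf, K, hK, hfK⟩ ⟨hg, L, hL, hgL⟩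
    refine ⟨continuous_iff_continuousAt.2 fun x => ?_, K ∪ L, hK.union hL, fun x hx => ?_⟩
    · exact hA.tendsto_add (hf.tendsto x) (hg.tendsto x)
    · simp only [mem_union, not_or] at hx
      simp [hfK x hx.1, hgL x hx.2]
  smul_mem' := by
    rintro c f ⟨hf, K, hK, hfK⟩
    refine ⟨continuous_iff_continuousAt.2 fun x => ?_, K, hK, fun x hx => ?_⟩
    · exact hA.tendsto_smul tendsto_const_nhds (hf.tendsto x)
    · simp [hfK x hx]

end IsUSCField

section aux

variable {X : Type u} [TopologicalSpace X] {A : X → Type w}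
    [∀ x, NormedAddCommGroup (A x)] [∀ x, NormedSpace ℂ (A x)]
    [TopologicalSpace (TotalSp A)]

theorem IsUSCField.tendsto_pt (hA : IsUSCField A) {ι : Type*} {l : Filter ι} {p : ι → X}
    {a : ∀ i, A (p i)} {x : X} {a₀ : A x}
    (ha : Tendsto (fun i => (⟨p i, a i⟩ : TotalSp A)) l (𝓝 ⟨x, a₀⟩)) : Tendsto p l (𝓝 x) :=
  (hA.continuous_pt.tendsto _).comp ha

theorem IsUSCField.tendsto_sub (hA : IsUSCField A) {ι : Type*} {l : Filter ι} {p : ι → X}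
    {a b : ∀ i, A (p i)} {x : X} {a₀ b₀ : A x}
    (ha : Tendsto (fun i => (⟨p i, a i⟩ : TotalSp A)) l (𝓝 ⟨x, a₀⟩))
    (hb : Tendsto (fun i => (⟨p i, b i⟩ : TotalSp A)) l (𝓝 ⟨x, b₀⟩)) :
    Tendsto (fun i => (⟨p i, a i - b i⟩ : TotalSp A)) l (𝓝 ⟨x, a₀ - b₀⟩) := by
  have h := hA.tendsto_add ha (hA.tendsto_smul (tendsto_const_nhds (x := (-1 : ℂ))) hb)
  simpa only [neg_smul, one_smul, ← sub_eq_add_neg] using h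

theorem IsUSCField.eventually_norm_lt (hA : IsUSCField A) {ι : Type*} {l : Filter ι} {p : ι → X}
    {a : ∀ i, A (p i)} {x : X} {a₀ : A x}
    (ha : Tendsto (fun i => (⟨p i, a i⟩ : TotalSp A)) l (𝓝 ⟨x, a₀⟩)) {ε : ℝ} (hε : ‖a₀‖ < ε) :
    ∀ᶠ i in l, ‖a i‖ < ε :=
  ha.eventually (hA.usc_norm ⟨x, a₀⟩ ε hε)

theorem IsUSCField.tendsto_sum (hA : IsUSCField A) {ι κ : Type*} {l : Filter ι} {p : ι → X}
    {x : X} (hp : Tendsto p l (𝓝 x)) (s : Finset κ) {c : κ → ι → ℂ} {a : κ → ∀ i, A (p i)}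
    {c₀ : κ → ℂ} {a₀ : κ → A x} (hc : ∀ k, Tendsto (c k) l (𝓝 (c₀ k)))
    (ha : ∀ k, Tendsto (fun i => (⟨p i, a k i⟩ : TotalSp A)) l (𝓝 ⟨x, a₀ k⟩)) :
    Tendsto (fun i => (⟨p i, ∑ k ∈ s, c k i • a k i⟩ : TotalSp A)) l
      (𝓝 ⟨x, ∑ k ∈ s, c₀ k • a₀ k⟩) := by
  classical
  induction s using Finset.induction_on with
  | empty =>
    have h0 : Tendsto (fun i => ‖(0 : A (p i))‖) l (𝓝 0) := by
      simp only [norm_zero]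
      exact tendsto_const_nhds
    simpa only [Finset.sum_empty] using hA.tendsto_zero hp h0
  | insert k s hk ih =>
    simp only [Finset.sum_insert hk]
    exact hA.tendsto_add (hA.tendsto_smul (hc k) (ha k)) ih

theorem IsUSCField.tendsto_of_fibre (hA : IsUSCField A) {ι : Type*} {l : Filter ι} {x : X}
    {a : ι → A x} {a₀ : A x} (ha : Tendsto (fun i => (⟨x, a i⟩ : TotalSp A)) l (𝓝 ⟨x, a₀⟩)) :
    Tendsto a l (𝓝 a₀) := by
  rw [tendsto_iff_norm_sub_tendsto_zero]
  have h := hA.tendsto_sub (p := fun _ => x) ha (tendsto_const_nhds (x := (⟨x, a₀⟩ : TotalSp A)))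
  rw [Metric.tendsto_nhds]
  intro ε hε
  refine (hA.eventually_norm_lt h (ε := ε) (by simpa using hε)).mono fun i hi => ?_
  simpa using hi

theorem IsUSCField.tendsto_mk (hA : IsUSCField A) {ι : Type*} {l : Filter ι} {x : X}
    {a : ι → A x} {a₀ : A x} (ha : Tendsto a l (𝓝 a₀)) :
    Tendsto (fun i => (⟨x, a i⟩ : TotalSp A)) l (𝓝 ⟨x, a₀⟩) := by
  have h := hA.tendsto_add (p := fun _ => x) (tendsto_const_nhds (x := (⟨x, a₀⟩ : TotalSp A)) (f := l))
    (hA.tendsto_zero (p := fun _ => x) (a := fun i => a i - a₀) tendsto_const_nhds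
      (tendsto_iff_norm_sub_tendsto_zero.1 ha))
  simpa using h

/-- Small perturbations in the fibres are small in the total space. -/
theorem IsUSCField.exists_perturb (hA : IsUSCField A) {x₀ : X} {a₀ : A x₀} {W : Set (TotalSp A)}
    (hW : W ∈ 𝓝 (⟨x₀, a₀⟩ : TotalSp A)) :
    ∃ V ∈ 𝓝 (⟨x₀, a₀⟩ : TotalSp A), ∃ ε > 0, ∀ (x : X) (a b : A x),
      (⟨x, a⟩ : TotalSp A) ∈ V → ‖b - a‖ < ε → (⟨x, b⟩ : TotalSp A) ∈ W := by
  let l : Filter (Σ x, A x × A x) :=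
    comap (fun i => (⟨i.1, i.2.1⟩ : TotalSp A)) (𝓝 ⟨x₀, a₀⟩) ⊓
      comap (fun i => ‖i.2.2‖) (𝓝 0)
  have h1 : Tendsto (fun i : Σ x, A x × A x => (⟨i.1, i.2.1⟩ : TotalSp A)) l (𝓝 ⟨x₀, a₀⟩) :=
    tendsto_comap.mono_left inf_le_left
  have h2 : Tendsto (fun i : Σ x, A x × A x => (⟨i.1, i.2.2⟩ : TotalSp A)) l (𝓝 ⟨x₀, 0⟩) :=
    hA.tendsto_zero (hA.tendsto_pt h1) (tendsto_comap.mono_left inf_le_right)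
  have h3 := hA.tendsto_add h1 h2
  rw [add_zero] at h3
  obtain ⟨S, hS, T, hT, hST⟩ := mem_inf_iff_superset.1 (h3 hW)
  obtain ⟨V, hV, hVS⟩ := mem_comap.1 hS
  obtain ⟨E, hE, hET⟩ := mem_comap.1 hT
  obtain ⟨ε, hε, hεE⟩ := Metric.mem_nhds_iff.1 hE
  refine ⟨V, hV, ε, hε, fun x a b ha hb => ?_⟩
  have h := hST (a := ⟨x, (a, b - a)⟩) ⟨hVS ha, hET (hεE (by simpa using hb))⟩
  simpa using h

theorem IsUSCField.exists_thin (hA : IsUSCField A) {x₀ : X} (a₀ : A x₀) {ε : ℝ} (hε : 0 < ε) :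
    ∃ V ∈ 𝓝 (⟨x₀, a₀⟩ : TotalSp A), ∀ (x : X) (a b : A x),
      (⟨x, a⟩ : TotalSp A) ∈ V → (⟨x, b⟩ : TotalSp A) ∈ V → ‖a - b‖ < ε := by
  let l : Filter (Σ x, A x × A x) :=
    comap (fun i => (⟨i.1, i.2.1⟩ : TotalSp A)) (𝓝 ⟨x₀, a₀⟩) ⊓
      comap (fun i => (⟨i.1, i.2.2⟩ : TotalSp A)) (𝓝 ⟨x₀, a₀⟩)
  have h1 : Tendsto (fun i : Σ x, A x × A x => (⟨i.1, i.2.1⟩ : TotalSp A)) l (𝓝 ⟨x₀, a₀⟩) :=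
    tendsto_comap.mono_left inf_le_left
  have h2 : Tendsto (fun i : Σ x, A x × A x => (⟨i.1, i.2.2⟩ : TotalSp A)) l (𝓝 ⟨x₀, a₀⟩) :=
    tendsto_comap.mono_left inf_le_right
  have h3 := hA.eventually_norm_lt (hA.tendsto_sub h1 h2) (ε := ε) (by simpa using hε)
  obtain ⟨S, hS, T, hT, hST⟩ := mem_inf_iff_superset.1 h3
  obtain ⟨V, hV, hVS⟩ := mem_comap.1 hS
  obtain ⟨V', hV', hVT⟩ := mem_comap.1 hT
  refine ⟨V ∩ V', inter_mem hV hV', fun x a b ha hb => ?_⟩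
  exact hST (a := ⟨x, (a, b)⟩) ⟨hVS ha.1, hVT hb.2⟩

/-- A filter on finite families in the fibres that describes nearby approximations of the given
finite family `c` in the fibre at `x₀`. -/
def nearFilter {κ : Type*} (x₀ : X) (c : κ → A x₀) : Filter (Σ x, (κ → A x)) :=
  comap Sigma.fst (𝓝 x₀) ⊓ ⨅ k, comap (fun j => (⟨j.1, j.2 k⟩ : TotalSp A)) (𝓝 ⟨x₀, c k⟩)

theorem pure_le_nearFilter {κ : Type*} (x₀ : X) (c : κ → A x₀) :
    pure ⟨x₀, c⟩ ≤ nearFilter x₀ c := by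
  refine le_inf ?_ (le_iInf fun k => ?_)
  · rw [← tendsto_iff_comap, tendsto_pure_left]
    exact fun s hs => mem_of_mem_nhds hs
  · rw [← tendsto_iff_comap, tendsto_pure_left]
    exact fun s hs => mem_of_mem_nhds hs

theorem IsUSCField.nhds_le_nearFilter (hA : IsUSCField A) {κ : Type*} [Finite κ] (x₀ : X)
    (c : κ → A x₀) : 𝓝 x₀ ≤ map Sigma.fst (nearFilter x₀ c) := by
  intro S hS
  obtain ⟨N, hN, T, hT, hNT⟩ := mem_inf_iff_superset.1 hS
  obtain ⟨N', hN', hNN⟩ := mem_comap.1 hN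
  obtain ⟨t, ht, rfl⟩ := (mem_iInf_of_finite _).1 hT
  choose V hV hVt using fun k => mem_comap.1 (ht k)
  have h1 : ∀ᶠ x in 𝓝 x₀, ∀ k, x ∈ TotalSp.pt '' (V k) :=
    eventually_all.2 fun k => hA.isOpenMap_pt.image_mem_nhds (hV k)
  filter_upwards [h1, hN'] with x hx hxN
  choose b hb hbx using hx
  have hb' : ∀ k, ∃ a : A x, (⟨x, a⟩ : TotalSp A) ∈ V k := by
    intro k
    refine ⟨transport A (hbx k) (b k).val, ?_⟩
    rw [TotalSp.mk_transport]
    exact hb k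
  choose a ha using hb'
  exact hNT (a := ⟨x, a⟩) ⟨hNN hxN,
    mem_iInter.2 fun k => hVt k (ha k)⟩

end aux

section integral

variable {G₀ : Type u₀} {G : Type u} [TopologicalSpace G₀] [TopologicalSpace G]
  [LocallyCompactSpace G] [T2Space G] [MeasurableSpace G] [BorelSpace G]
  {𝒢 : TopGroupoid G₀ G} {A : G → Type w} [∀ g, NormedAddCommGroup (A g)]
  [∀ g, NormedSpace ℂ (A g)] [∀ g, CompleteSpace (A g)] [TopologicalSpace (TotalSp A)]

theorem TopGroupoid.t2_units (𝒢 : TopGroupoid G₀ G) : T2Space G₀ :=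
  T2Space.of_injective_continuous (f := 𝒢.unit)
    (fun x y h => by rw [← 𝒢.r_unit x, h, 𝒢.r_unit]) 𝒢.continuous_unit

theorem HaarSystem.integrable_smul_section (H : HaarSystem 𝒢) (hA : IsUSCField A)
    {Φ : ∀ g, G → A g} {K : Set G} (hK : IsCompact K) (hΦK : ∀ g, ∀ h ∉ K, Φ g h = 0)
    (hΦ : Continuous fun z : {z : G × G // 𝒢.r z.2 = 𝒢.r z.1} =>
      (⟨z.1.1, Φ z.1.1 z.1.2⟩ : TotalSp A)) (g : G) (c : C(G, ℝ)) :
    Integrable (fun h => c h • Φ g h) (H.meas (𝒢.r g)) := by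
  have := 𝒢.t2_units
  have := H.regular (𝒢.r g)
  have hcl : IsClosed {h | 𝒢.r h = 𝒢.r g} := isClosed_eq 𝒢.continuous_r continuous_const
  have hKg : IsCompact (K ∩ {h | 𝒢.r h = 𝒢.r g}) := hK.inter_right hcl
  have hcont : ContinuousOn (Φ g) {h | 𝒢.r h = 𝒢.r g} := by
    rw [continuousOn_iff_continuous_domRestrict, continuous_iff_continuousAt]
    intro h
    have h1 : Continuous fun h : {h | 𝒢.r h = 𝒢.r g} =>
        (⟨(g, h.1), h.2⟩ : {z : G × G // 𝒢.r z.2 = 𝒢.r z.1}) := by fun_prop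
    exact hA.tendsto_of_fibre ((hΦ.comp h1).tendsto h)
  have hcont2 : ContinuousOn (fun h => c h • Φ g h) (K ∩ {h | 𝒢.r h = 𝒢.r g}) :=
    c.continuous.continuousOn.smul (hcont.mono inter_subset_right)
  refine (hcont2.integrableOn_compact hKg).integrable_of_ae_notMem_eq_zero ?_
  have h0 : ∀ᵐ h ∂(H.meas (𝒢.r g)), 𝒢.r h = 𝒢.r g := H.meas_compl (𝒢.r g)
  filter_upwards [h0] with h hr hh
  rw [hΦK g h fun hk => hh ⟨hk, hr⟩, smul_zero]

/-- Integrating a compactly supported continuous family of vectors against a Haar system gives a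
continuous section. -/
theorem HaarSystem.continuous_integral_section (H : HaarSystem 𝒢) (hA : IsUSCField A)
    {Φ : ∀ g, G → A g} {K : Set G} (hK : IsCompact K) (hΦK : ∀ g, ∀ h ∉ K, Φ g h = 0)
    (hΦ : Continuous fun z : {z : G × G // 𝒢.r z.2 = 𝒢.r z.1} =>
      (⟨z.1.1, Φ z.1.1 z.1.2⟩ : TotalSp A)) :
    Continuous (sectionMap fun g => ∫ h, Φ g h ∂(H.meas (𝒢.r g))) := by
  classical
  have := 𝒢.t2_units
  rw [continuous_iff_continuousAt]
  intro g₀ W hW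
  obtain ⟨W₁, hW₁, ε₁, hε₁, hWW⟩ := hA.exists_perturb hW
  obtain ⟨ε₂, hε₂, hW₂⟩ : ∃ ε > 0, ∀ a : A g₀,
      ‖a - ∫ h, Φ g₀ h ∂(H.meas (𝒢.r g₀))‖ < ε → W₁ ∈ 𝓝 (⟨g₀, a⟩ : TotalSp A) := by
    have h1 := hA.tendsto_mk (x := g₀) (a := fun a => a) (l := 𝓝 (∫ h, Φ g₀ h ∂(H.meas (𝒢.r g₀))))
      tendsto_id
    have h2 := h1.eventually (eventually_mem_nhds_iff.2 hW₁)
    obtain ⟨ε, hε, h3⟩ := Metric.eventually_nhds_iff.1 h2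
    exact ⟨ε, hε, fun a ha => h3 (by rwa [dist_eq_norm])⟩
  -- a cutoff function
  obtain ⟨ψ, hψ1, hψ0, hψc⟩ : ∃ ψ : C(G, ℝ), (∀ h ∈ K, ψ h = 1) ∧ (∀ h, 0 ≤ ψ h) ∧
      HasCompactSupport ψ := by
    obtain ⟨f, -, h1, h2, h3⟩ := exists_continuous_sum_one_of_isOpen_isCompact (n := 1)
      (s := fun _ => (univ : Set G)) (fun _ => isOpen_univ) hK
      (fun h _ => mem_iUnion.2 ⟨0, mem_univ h⟩)
    refine ⟨f 0, fun h hh => ?_, fun h => (h2 0 h).1, h3 0⟩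
    simpa using h1 hh
  have hψint := H.continuous_integral ψ ψ.continuous hψc
  have hψnn : 0 ≤ ∫ h, ψ h ∂(H.meas (𝒢.r g₀)) := integral_nonneg hψ0
  set M : ℝ := ∫ h, ψ h ∂(H.meas (𝒢.r g₀)) + 1 with hM
  have hMpos : 0 < M := by linarith
  set ε : ℝ := min ε₁ ε₂ / M with hεdef
  have hε : 0 < ε := by positivity
  have hεM : ε * M = min ε₁ ε₂ := div_mul_cancel₀ _ hMpos.ne'
  -- a cover of the support of the cutoff function
  have hcover : ∀ k : G, ∃ U : Set G, IsOpen U ∧ k ∈ U ∧ ((𝒢.r k ≠ 𝒢.r g₀ ∧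
        U ⊆ {h | 𝒢.r h ≠ 𝒢.r g₀}) ∨ ∃ T ∈ 𝓝 (⟨g₀, Φ g₀ k⟩ : TotalSp A), ∃ N ∈ 𝓝 g₀,
          (∀ (x : G) (a b : A x), (⟨x, a⟩ : TotalSp A) ∈ T → (⟨x, b⟩ : TotalSp A) ∈ T →
            ‖a - b‖ < ε) ∧
          ∀ g ∈ N, ∀ h ∈ U, 𝒢.r h = 𝒢.r g → (⟨g, Φ g h⟩ : TotalSp A) ∈ T) := by
    intro k
    by_cases hk : 𝒢.r k = 𝒢.r g₀
    · obtain ⟨T, hT, hTε⟩ := hA.exists_thin (Φ g₀ k) hε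
      have h1 := hΦ.tendsto ⟨(g₀, k), hk⟩ hT
      rw [mem_map, nhds_subtype_eq_comap, mem_comap] at h1
      obtain ⟨S, hS, hST⟩ := h1
      obtain ⟨N, hN, U, hU, hNU⟩ := mem_nhds_prod_iff.1 hS
      obtain ⟨U', hU', hUo, hkU⟩ := mem_nhds_iff.1 hU
      exact ⟨U', hUo, hkU, Or.inr ⟨T, hT, N, hN, hTε, fun g hg h hh e =>
        hST (a := ⟨(g, h), e⟩) (hNU ⟨hg, hU' hh⟩)⟩⟩
    · exact ⟨{h | 𝒢.r h ≠ 𝒢.r g₀}, isOpen_ne_fun 𝒢.continuous_r continuous_const, hk,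
        Or.inl ⟨hk, Subset.rfl⟩⟩
  choose U hUo hkU hU using hcover
  obtain ⟨t, -, ht⟩ := IsCompact.elim_nhds_subcover hψc U
    fun k _ => (hUo k).mem_nhds (hkU k)
  let k : Fin t.card → G := fun i => (t.equivFin.symm i).1
  obtain ⟨φ, hφU, hφ1, hφ01, hφc⟩ := exists_continuous_sum_one_of_isOpen_isCompact
    (s := fun i => U (k i)) (fun i => hUo _) hψc (by
      intro h hh
      obtain ⟨x, hx, hxU⟩ := mem_iUnion₂.1 (ht hh)
      exact mem_iUnion.2 ⟨t.equivFin ⟨x, hx⟩, by simpa [k] using hxU⟩)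
  have hsum : ∀ h, ψ h * ∑ i, φ i h = ψ h := by
    intro h
    by_cases hh : h ∈ tsupport ψ
    · have := hφ1 hh
      simp only [Finset.sum_apply, Pi.one_apply] at this
      rw [this, mul_one]
    · rw [image_eq_zero_of_notMem_tsupport hh, zero_mul]
  let c : Fin t.card → A g₀ := fun i => Φ g₀ (k i)
  -- local approximations
  have hP : ∀ᶠ j in nearFilter g₀ c, ∀ i h, 𝒢.r h = 𝒢.r j.1 → φ i h ≠ 0 →
      ‖Φ j.1 h - j.2 i‖ < ε := by
    refine eventually_all.2 fun i => ?_
    have hfst : Tendsto Sigma.fst (nearFilter g₀ c) (𝓝 g₀) := tendsto_comap.mono_left inf_le_left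
    rcases hU (k i) with ⟨-, hUi⟩ | ⟨T, hT, N, hN, hTε, hTU⟩
    · have hcpt : IsCompact (𝒢.r '' tsupport (φ i)) := (hφc i).image 𝒢.continuous_r
      have h1 : (𝒢.r '' tsupport (φ i))ᶜ ∈ 𝓝 (𝒢.r g₀) := by
        refine hcpt.isClosed.isOpen_compl.mem_nhds ?_
        rintro ⟨h, hh, e⟩
        exact hUi (hφU i hh) e
      filter_upwards [hfst.eventually (𝒢.continuous_r.tendsto g₀ h1)] with j hj h e hne
      exact absurd ⟨h, subset_tsupport _ hne, e⟩ hj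
    · have h2 : Tendsto (fun j : Σ x, (Fin t.card → A x) => (⟨j.1, j.2 i⟩ : TotalSp A))
          (nearFilter g₀ c) (𝓝 ⟨g₀, c i⟩) :=
        tendsto_comap.mono_left (inf_le_right.trans (iInf_le _ i))
      filter_upwards [hfst.eventually hN, h2.eventually hT] with j hj hjT h e hne
      exact hTε _ _ _ (hTU _ hj h (hφU i (subset_tsupport _ hne)) e) hjT
  -- the basic estimate
  have hest : ∀ j : Σ x, (Fin t.card → A x), (∀ i h, 𝒢.r h = 𝒢.r j.1 → φ i h ≠ 0 →
      ‖Φ j.1 h - j.2 i‖ < ε) → ‖∫ h, Φ j.1 h ∂(H.meas (𝒢.r j.1)) -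
        ∑ i, ((∫ h, ψ h * φ i h ∂(H.meas (𝒢.r j.1)) : ℝ) : ℂ) • j.2 i‖ ≤
          ε * ∫ h, ψ h ∂(H.meas (𝒢.r j.1)) := by
    rintro ⟨g, b⟩ hb
    have := H.regular (𝒢.r g)
    have hψφ : ∀ i, Integrable (fun h => ψ h * φ i h) (H.meas (𝒢.r g)) := fun i =>
      (ψ.continuous.mul (φ i).continuous).integrable_of_hasCompactSupport hψc.mul_right
    have hψi : Integrable ψ (H.meas (𝒢.r g)) := ψ.continuous.integrable_of_hasCompactSupport hψc
    have hint : ∀ i, Integrable (fun h => (ψ h * φ i h) • Φ g h) (H.meas (𝒢.r g)) := fun i =>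
      H.integrable_smul_section hA hK hΦK hΦ g (ψ * φ i)
    have h1 : ∀ h, Φ g h = ∑ i, (ψ h * φ i h) • Φ g h := by
      intro h
      by_cases hh : h ∈ K
      · rw [← Finset.sum_smul, ← Finset.mul_sum, hsum, hψ1 h hh, one_smul]
      · simp [hΦK g h hh]
    have h2 : ∫ h, Φ g h ∂(H.meas (𝒢.r g)) -
        ∑ i, ((∫ h, ψ h * φ i h ∂(H.meas (𝒢.r g)) : ℝ) : ℂ) • b i =
        ∫ h, ∑ i, (ψ h * φ i h) • (Φ g h - b i) ∂(H.meas (𝒢.r g)) := by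
      rw [integral_congr_ae (Eventually.of_forall h1), integral_finsetSum _ fun i _ => hint i,
        ← Finset.sum_sub_distrib, integral_finsetSum _ fun i _ => ?_]
      · refine Finset.sum_congr rfl fun i _ => ?_
        simp only [smul_sub]
        rw [integral_sub (hint i) ((hψφ i).smul_const _), integral_smul_const, Complex.coe_smul]
      · simp only [smul_sub]
        exact (hint i).sub ((hψφ i).smul_const _)
    simp only
    rw [h2, ← integral_const_mul]
    refine norm_integral_le_of_norm_le (hψi.const_mul ε) ?_
    have h0 : ∀ᵐ h ∂(H.meas (𝒢.r g)), 𝒢.r h = 𝒢.r g := H.meas_compl (𝒢.r g)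
    filter_upwards [h0] with h hr
    calc ‖∑ i, (ψ h * φ i h) • (Φ g h - b i)‖ ≤ ∑ i, ‖(ψ h * φ i h) • (Φ g h - b i)‖ :=
          norm_sum_le _ _
      _ ≤ ∑ i, (ψ h * φ i h) * ε := by
          refine Finset.sum_le_sum fun i _ => ?_
          have hnn : 0 ≤ ψ h * φ i h := mul_nonneg (hψ0 h) (hφ01 i h).1
          rw [norm_smul, Real.norm_of_nonneg hnn]
          by_cases hne : φ i h = 0
          · simp [hne]
          · exact mul_le_mul_of_nonneg_left (hb i h hr hne).le hnn
      _ = ε * ψ h := by rw [← Finset.sum_mul, ← Finset.mul_sum, hsum, mul_comm]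
  -- conclusion
  suffices h : ∀ᶠ j in nearFilter g₀ c, sectionMap (fun g => ∫ h, Φ g h ∂(H.meas (𝒢.r g))) j.1 ∈ W
    from hA.nhds_le_nearFilter g₀ c h
  have hfst : Tendsto Sigma.fst (nearFilter g₀ c) (𝓝 g₀) := tendsto_comap.mono_left inf_le_left
  have hsumlim : Tendsto (fun j : Σ x, (Fin t.card → A x) => (⟨j.1,
      ∑ i, ((∫ h, ψ h * φ i h ∂(H.meas (𝒢.r j.1)) : ℝ) : ℂ) • j.2 i⟩ : TotalSp A))
      (nearFilter g₀ c)
      (𝓝 ⟨g₀, ∑ i, ((∫ h, ψ h * φ i h ∂(H.meas (𝒢.r g₀)) : ℝ) : ℂ) • c i⟩) := by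
    refine hA.tendsto_sum (a := fun i (j : Σ x, (Fin t.card → A x)) => j.2 i) hfst _
      (fun i => ?_) fun i => tendsto_comap.mono_left (inf_le_right.trans (iInf_le _ i))
    have h1 := H.continuous_integral (fun h => ψ h * φ i h) (ψ.continuous.mul (φ i).continuous)
      hψc.mul_right
    exact ((Complex.continuous_ofReal.comp (h1.comp 𝒢.continuous_r)).tendsto g₀).comp hfst
  have hat := hest ⟨g₀, c⟩ (hP.filter_mono (pure_le_nearFilter g₀ c))
  have hW₃ := hW₂ (∑ i, ((∫ h, ψ h * φ i h ∂(H.meas (𝒢.r g₀)) : ℝ) : ℂ) • c i) (by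
    rw [norm_sub_rev]
    refine hat.trans_lt ?_
    have h3 : ε * (∫ h, ψ h ∂(H.meas (𝒢.r g₀))) < ε * M :=
      mul_lt_mul_of_pos_left (by linarith) hε
    exact h3.trans_le (hεM.le.trans (min_le_right _ _)))
  have hMev : ∀ᶠ j in nearFilter g₀ c, ∫ h, ψ h ∂(H.meas (𝒢.r j.1)) < M :=
    hfst.eventually (((hψint.comp 𝒢.continuous_r).tendsto g₀).eventually_lt_const
      (by simp only [Function.comp]; linarith))
  filter_upwards [hP, hsumlim.eventually hW₃, hMev] with j hj hjW hjM
  refine hWW _ _ _ hjW ((hest j hj).trans_lt ?_)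
  exact (mul_lt_mul_of_pos_left hjM hε).trans_le (hεM.le.trans (min_le_left _ _))

end integral

/-! ## Fell bundles -/

/-- A Fell bundle over the groupoid `𝒢` with fibres `A g`. -/
structure FellBundle {G₀ : Type u₀} {G : Type u} [TopologicalSpace G₀] [TopologicalSpace G]
    (𝒢 : TopGroupoid G₀ G) (A : G → Type w) [∀ g, NormedAddCommGroup (A g)]
    [∀ g, NormedSpace ℂ (A g)] [∀ g, CompleteSpace (A g)] [TopologicalSpace (TotalSp A)] where
  isField : IsUSCField A
  mulMap : ∀ (g h : G) (e : 𝒢.s g = 𝒢.r h), A g →ₗ[ℂ] A h →ₗ[ℂ] A (𝒢.comp g h e)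
  starMap : ∀ g : G, A g →ₗ⋆[ℂ] A (𝒢.inv g)
  mul_assoc : ∀ (g h k : G) (e : 𝒢.s g = 𝒢.r h) (e' : 𝒢.s h = 𝒢.r k) (a : A g) (b : A h) (c : A k),
    (⟨_, mulMap _ k ((𝒢.s_comp g h e).trans e') (mulMap g h e a b) c⟩ : TotalSp A) =
      ⟨_, mulMap g _ (e.trans (𝒢.r_comp h k e').symm) a (mulMap h k e' b c)⟩
  star_mul : ∀ (g h : G) (e : 𝒢.s g = 𝒢.r h) (a : A g) (b : A h),
    (⟨_, starMap _ (mulMap g h e a b)⟩ : TotalSp A) =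
      ⟨_, mulMap (𝒢.inv h) (𝒢.inv g) ((𝒢.s_inv h).trans (e.symm.trans (𝒢.r_inv g).symm))
        (starMap h b) (starMap g a)⟩
  star_star : ∀ (g : G) (a : A g), (⟨_, starMap _ (starMap g a)⟩ : TotalSp A) = ⟨g, a⟩
  norm_mul_le : ∀ (g h : G) (e : 𝒢.s g = 𝒢.r h) (a : A g) (b : A h),
    ‖mulMap g h e a b‖ ≤ ‖a‖ * ‖b‖
  norm_star_mul_self : ∀ (g : G) (a : A g), ‖mulMap (𝒢.inv g) g (𝒢.s_inv g) (starMap g a) a‖ = ‖a‖ ^ 2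
  star_mul_self_pos : ∀ (g : G) (a : A g), ∃ b : A (𝒢.unit (𝒢.s g)),
    (⟨_, mulMap _ _ (𝒢.s_inv _) (starMap _ b) b⟩ : TotalSp A) = ⟨_, mulMap _ _ (𝒢.s_inv g) (starMap g a) a⟩
  continuous_mul : Continuous fun p : {p : TotalSp A × TotalSp A // 𝒢.s p.1.pt = 𝒢.r p.2.pt} =>
    (⟨_, mulMap p.1.1.pt p.1.2.pt p.2 p.1.1.val p.1.2.val⟩ : TotalSp A)
  continuous_star : Continuous fun a : TotalSp A => (⟨_, starMap a.pt a.val⟩ : TotalSp A)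

namespace FellBundle

variable {G₀ : Type u₀} {G : Type u} [TopologicalSpace G₀] [TopologicalSpace G]
  {𝒢 : TopGroupoid G₀ G} {A : G → Type w} [∀ g, NormedAddCommGroup (A g)]
  [∀ g, NormedSpace ℂ (A g)] [∀ g, CompleteSpace (A g)] [TopologicalSpace (TotalSp A)]
  (𝓐 : FellBundle 𝒢 A)

/-- The space of compactly supported continuous sections of a Fell bundle. -/
abbrev Cc : Submodule ℂ (∀ g, A g) := 𝓐.isField.cc

/-- The involution on compactly supported sections, `f^*(g) = f(g⁻¹)^*`. -/
def involution (f : 𝓐.Cc) : 𝓐.Cc :=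
  ⟨fun g => transport A (𝒢.inv_inv g) (𝓐.starMap (𝒢.inv g) (f.1 (𝒢.inv g))), by
    obtain ⟨hf, K, hK, hfK⟩ := f.2
    refine ⟨?_, 𝒢.inv '' K, hK.image 𝒢.continuous_inv, fun g hg => ?_⟩
    · have : sectionMap (A := A)
          (fun g => transport A (𝒢.inv_inv g) (𝓐.starMap (𝒢.inv g) (f.1 (𝒢.inv g)))) =
          fun g => ⟨_, 𝓐.starMap (𝒢.inv g) (f.1 (𝒢.inv g))⟩ := by
        funext g
        exact TotalSp.mk_transport _ _
      rw [this]
      exact 𝓐.continuous_star.comp (hf.comp 𝒢.continuous_inv)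
    · have h0 : f.1 (𝒢.inv g) = 0 := hfK _ fun h => hg ⟨_, h, 𝒢.inv_inv g⟩
      have ht : ∀ {x y : G} (e : x = y), transport A e (0 : A x) = 0 := by
        intro x y e; subst e; rfl
      simp only [h0, map_zero, ht]⟩

open Classical in
/-- The integrand of the convolution at `g`: for `r h = r g` this is `f₁(h) f₂(h⁻¹ g)`, an element
of the fibre at `h (h⁻¹ g) = g`. -/
def convIntegrand (f₁ f₂ : ∀ g, A g) (g h : G) : A g :=
  if e : 𝒢.r h = 𝒢.r g then
    transport A (𝒢.comp_inv_comp e)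
      (𝓐.mulMap h (𝒢.comp (𝒢.inv h) g (𝒢.composable_inv e)) (𝒢.composable_inv_comp e)
        (f₁ h) (f₂ (𝒢.comp (𝒢.inv h) g (𝒢.composable_inv e))))
  else 0

variable [LocallyCompactSpace G] [T2Space G] [MeasurableSpace G] [BorelSpace G]
  (H : HaarSystem 𝒢)

theorem continuous_convIntegrand {f₁ f₂ : ∀ g, A g} (h₁ : Continuous (sectionMap f₁))
    (h₂ : Continuous (sectionMap f₂)) :
    Continuous fun z : {z : G × G // 𝒢.r z.2 = 𝒢.r z.1} =>
      (⟨z.1.1, 𝓐.convIntegrand f₁ f₂ z.1.1 z.1.2⟩ : TotalSp A) := by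
  have h0 : ∀ z : {z : G × G // 𝒢.r z.2 = 𝒢.r z.1},
      (⟨z.1.1, 𝓐.convIntegrand f₁ f₂ z.1.1 z.1.2⟩ : TotalSp A) =
      ⟨_, 𝓐.mulMap z.1.2 (𝒢.comp (𝒢.inv z.1.2) z.1.1 (𝒢.composable_inv z.2))
        (𝒢.composable_inv_comp z.2) (f₁ z.1.2)
        (f₂ (𝒢.comp (𝒢.inv z.1.2) z.1.1 (𝒢.composable_inv z.2)))⟩ := by
    intro z
    rw [convIntegrand, dif_pos z.2, TotalSp.mk_transport]
  simp only [h0]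
  have h3 : Continuous fun z : {z : G × G // 𝒢.r z.2 = 𝒢.r z.1} =>
      𝒢.comp (𝒢.inv z.1.2) z.1.1 (𝒢.composable_inv z.2) := by
    have h4 : Continuous fun z : {z : G × G // 𝒢.r z.2 = 𝒢.r z.1} =>
        (⟨(𝒢.inv z.1.2, z.1.1), 𝒢.composable_inv z.2⟩ :
          {p : G × G // 𝒢.s p.1 = 𝒢.r p.2}) := by
      have := 𝒢.continuous_inv
      fun_prop
    exact 𝒢.continuous_comp.comp h4
  have h5 : Continuous fun z : {z : G × G // 𝒢.r z.2 = 𝒢.r z.1} =>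
      (⟨(sectionMap f₁ z.1.2, sectionMap f₂ (𝒢.comp (𝒢.inv z.1.2) z.1.1 (𝒢.composable_inv z.2))),
        𝒢.composable_inv_comp z.2⟩ :
        {p : TotalSp A × TotalSp A // 𝒢.s p.1.pt = 𝒢.r p.2.pt}) := by
    refine Continuous.subtype_mk ?_ _
    exact (h₁.comp (by fun_prop)).prodMk (h₂.comp h3)
  exact 𝓐.continuous_mul.comp h5

theorem transport_zero {x y : G} (e : x = y) : transport A e (0 : A x) = 0 := by
  subst e; rfl

/-- The convolution `(f₁ * f₂)(g) = ∫ f₁(h) f₂(h⁻¹ g) dα^{r(g)}(h)`. -/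
def conv (f₁ f₂ : 𝓐.Cc) : 𝓐.Cc :=
  ⟨fun g => ∫ h, 𝓐.convIntegrand f₁.1 f₂.1 g h ∂(H.meas (𝒢.r g)), by
    obtain ⟨h₁, K, hK, hK₁⟩ := f₁.2
    obtain ⟨h₂, L, hL, hL₂⟩ := f₂.2
    have := 𝒢.t2_units
    refine ⟨H.continuous_integral_section 𝓐.isField hK (fun g h hh => ?_)
      (𝓐.continuous_convIntegrand h₁ h₂),
      (fun p : {p : G × G // 𝒢.s p.1 = 𝒢.r p.2} => 𝒢.comp p.1.1 p.1.2 p.2) ''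
        (Subtype.val ⁻¹' (K ×ˢ L)), ?_, fun g hg => ?_⟩
    · rw [convIntegrand]
      split_ifs with e
      · rw [hK₁ h hh, map_zero, LinearMap.zero_apply, transport_zero]
      · rfl
    · refine IsCompact.image ?_ 𝒢.continuous_comp
      refine (Topology.IsClosedEmbedding.isCompact_preimage ?_ (hK.prod hL))
      exact (isClosed_eq (𝒢.continuous_s.comp continuous_fst)
        (𝒢.continuous_r.comp continuous_snd)).isClosedEmbedding_subtypeVal
    · refine integral_eq_zero_of_ae (Eventually.of_forall fun h => ?_)
      simp only [convIntegrand, Pi.zero_apply]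
      split_ifs with e
      · by_cases hh : h ∈ K
        · have : 𝒢.comp (𝒢.inv h) g (𝒢.composable_inv e) ∉ L := fun hl =>
            hg ⟨⟨(h, _), 𝒢.composable_inv_comp e⟩, ⟨hh, hl⟩, 𝒢.comp_inv_comp e⟩
          rw [hL₂ _ this, map_zero, transport_zero]
        · rw [hK₁ h hh, map_zero, LinearMap.zero_apply, transport_zero]
      · rfl⟩

/-! ### The `I`-norm, the inductive limit topology, and *-homomorphisms -/

/-- The supremum norm of a section. -/
def supNorm (f : 𝓐.Cc) : ℝ := ⨆ g, ‖f.1 g‖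

/-- The `I`-norm, the maximum of `sup_x ∫ ‖f(g)‖ dα^x(g)` and `sup_x ∫ ‖f(g⁻¹)‖ dα^x(g)`. -/
def iNorm (f : 𝓐.Cc) : ℝ :=
  max (⨆ x, ∫ g, ‖f.1 g‖ ∂(H.meas x)) (⨆ x, ∫ g, ‖f.1 g‖ ∂((H.meas x).map 𝒢.inv))

/-- The section `f` is supported in `K`. -/
def SupportedIn (K : Set G) (f : 𝓐.Cc) : Prop := ∀ g ∉ K, f.1 g = 0

/-- The inductive limit topology: the finest locally convex vector space topology for which, for
each compact `K ⊆ G`, the inclusion of the space of sections supported in `K` with the supremum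
norm is continuous (equivalently, continuous at zero). -/
@[reducible] def indLimTopology : TopologicalSpace 𝓐.Cc :=
  sInf {t : TopologicalSpace 𝓐.Cc | @IsTopologicalAddGroup 𝓐.Cc t _ ∧
    @ContinuousSMul ℂ 𝓐.Cc _ _ t ∧ @LocallyConvexSpace ℝ 𝓐.Cc _ _ _ _ t ∧
    ∀ K : Set G, IsCompact K → ∀ U ∈ @nhds 𝓐.Cc t 0, ∃ ε > 0, ∀ f : 𝓐.Cc,
      𝓐.SupportedIn K f → 𝓐.supNorm f < ε → f ∈ U}

/-- A linear map from `C_c(G, A)` to a `C^*`-algebra is a *-homomorphism. -/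
structure IsStarHom {B : Type*} [NonUnitalCStarAlgebra B] (φ : 𝓐.Cc →ₗ[ℂ] B) : Prop where
  map_conv : ∀ f₁ f₂, φ (𝓐.conv H f₁ f₂) = φ f₁ * φ f₂
  map_involution : ∀ f, φ (𝓐.involution f) = star (φ f)

/-- A linear map from `C_c(G, A)` to a normed space is bounded in the `I`-norm. -/
def INormBounded {B : Type*} [SeminormedAddCommGroup B] [Module ℂ B] (φ : 𝓐.Cc →ₗ[ℂ] B) : Prop :=
  ∃ C : ℝ, ∀ f, ‖φ f‖ ≤ C * 𝓐.iNorm H f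

/-! ### The full section algebra -/

/-- The set of `C^*`-seminorms on `C_c(G, A)` that are dominated by the `I`-norm. Here a
`C^*`-seminorm is the seminorm `‖φ f‖` for a *-homomorphism `φ` to some `C^*`-algebra. -/
def cstarSeminorms : Set (𝓐.Cc → ℝ) :=
  {p | ∃ (B : Type (max u w)) (_ : NonUnitalCStarAlgebra B) (φ : 𝓐.Cc →ₗ[ℂ] B),
    𝓐.IsStarHom H φ ∧ (∀ f, ‖φ f‖ ≤ 𝓐.iNorm H f) ∧ ∀ f, p f = ‖φ f‖}

/-- A `C^*`-algebra that realises a `C^*`-seminorm. -/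
def SeminormAlg (p : 𝓐.cstarSeminorms H) : Type (max u w) := p.2.choose

instance (p : 𝓐.cstarSeminorms H) : NonUnitalCStarAlgebra (𝓐.SeminormAlg H p) :=
  p.2.choose_spec.choose

/-- A *-homomorphism that realises a `C^*`-seminorm. -/
def seminormHom (p : 𝓐.cstarSeminorms H) : 𝓐.Cc →ₗ[ℂ] 𝓐.SeminormAlg H p :=
  p.2.choose_spec.choose_spec.choose

theorem seminormHom_isStarHom (p : 𝓐.cstarSeminorms H) : 𝓐.IsStarHom H (𝓐.seminormHom H p) :=
  p.2.choose_spec.choose_spec.choose_spec.1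

theorem norm_seminormHom_le (p : 𝓐.cstarSeminorms H) (f : 𝓐.Cc) :
    ‖𝓐.seminormHom H p f‖ ≤ 𝓐.iNorm H f :=
  p.2.choose_spec.choose_spec.choose_spec.2.1 f

theorem norm_seminormHom (p : 𝓐.cstarSeminorms H) (f : 𝓐.Cc) :
    ‖𝓐.seminormHom H p f‖ = p.1 f :=
  (p.2.choose_spec.choose_spec.choose_spec.2.2 f).symm

/-- The joint *-homomorphism from `C_c(G, A)` to the `C^*`-algebra of bounded families. -/
def universalHom : 𝓐.Cc →ₗ[ℂ] lp (fun p : 𝓐.cstarSeminorms H => 𝓐.SeminormAlg H p) ∞ where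
  toFun f := ⟨fun p => 𝓐.seminormHom H p f, memℓp_infty ⟨𝓐.iNorm H f, by
    rintro _ ⟨p, rfl⟩
    exact 𝓐.norm_seminormHom_le H p f⟩⟩
  map_add' f₁ f₂ := by
    ext p
    exact map_add _ _ _
  map_smul' c f := by
    ext p
    exact map_smul _ _ _

theorem universalHom_isStarHom : 𝓐.IsStarHom H (𝓐.universalHom H) where
  map_conv f₁ f₂ := by
    ext p
    exact (𝓐.seminormHom_isStarHom H p).map_conv f₁ f₂
  map_involution f := by
    ext p
    exact (𝓐.seminormHom_isStarHom H p).map_involution f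

/-- The image of `C_c(G, A)` under the joint *-homomorphism. -/
def universalRange : NonUnitalStarSubalgebra ℂ
    (lp (fun p : 𝓐.cstarSeminorms H => 𝓐.SeminormAlg H p) ∞) where
  carrier := Set.range (𝓐.universalHom H)
  add_mem' := by
    rintro _ _ ⟨f, rfl⟩ ⟨g, rfl⟩
    exact ⟨f + g, map_add _ _ _⟩
  zero_mem' := ⟨0, map_zero _⟩
  mul_mem' := by
    rintro _ _ ⟨f, rfl⟩ ⟨g, rfl⟩
    exact ⟨𝓐.conv H f g, (𝓐.universalHom_isStarHom H).map_conv f g⟩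
  smul_mem' := by
    rintro c _ ⟨f, rfl⟩
    exact ⟨c • f, map_smul _ _ _⟩
  star_mem' := by
    rintro _ ⟨f, rfl⟩
    exact ⟨𝓐.involution f, (𝓐.universalHom_isStarHom H).map_involution f⟩

/-- The full section `C^*`-algebra `C^*(G, A)`: the Hausdorff completion of `C_c(G, A)` in the
maximal `C^*`-seminorm that is dominated by the `I`-norm. It is realised as the closure of the image
of `C_c(G, A)` in the `C^*`-algebra of bounded families, indexed by all such `C^*`-seminorms; the
norm of the image of `f` is the supremum over all these seminorms. -/
abbrev FullCStar : Type (max u w) := (𝓐.universalRange H).topologicalClosure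

/-- `C^*(G, A)` is a `C^*`-algebra. -/
instance : NonUnitalCStarAlgebra (𝓐.FullCStar H) :=
  have : IsClosed ((𝓐.universalRange H).topologicalClosure :
      Set (lp (fun p : 𝓐.cstarSeminorms H => 𝓐.SeminormAlg H p) ∞)) := isClosed_closure
  NonUnitalStarSubalgebra.nonUnitalCStarAlgebra (𝓐.universalRange H).topologicalClosure

/-- The norm on the full section algebra restricts to the maximal `C^*`-seminorm. -/
theorem norm_universalHom (f : 𝓐.Cc) :
    ‖𝓐.universalHom H f‖ = ⨆ p : 𝓐.cstarSeminorms H, p.1 f := by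
  rw [lp.norm_eq_ciSup]
  exact iSup_congr fun p => 𝓐.norm_seminormHom H p f

/-- The canonical map from `C_c(G, A)` to `C^*(G, A)`. -/
def toFull : 𝓐.Cc →ₗ[ℂ] 𝓐.FullCStar H where
  toFun f := ⟨𝓐.universalHom H f, subset_closure ⟨f, rfl⟩⟩
  map_add' f₁ f₂ := Subtype.ext (map_add (𝓐.universalHom H) f₁ f₂)
  map_smul' c f := Subtype.ext (map_smul (𝓐.universalHom H) c f)

end FellBundle

/-! ## Hilbert modules and (pre-)representations -/

/-- A (right) Hilbert `D`-module: a complex Banach space `F` with a right action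
`act x d = x · d` of the `C^*`-algebra `D` and a `D`-valued inner product that is conjugate-linear
in the first and `D`-linear in the second variable and induces the norm of `F`. -/
class HilbertModule (D : Type v) (F : Type v') [NonUnitalCStarAlgebra D] [NormedAddCommGroup F]
    [NormedSpace ℂ F] [CompleteSpace F] where
  act : F →ₗ[ℂ] D →ₗ[ℂ] F
  inner : F →ₗ⋆[ℂ] F →ₗ[ℂ] D
  act_mul : ∀ x d e, act (act x d) e = act x (d * e)
  inner_act : ∀ x y d, inner x (act y d) = inner x y * d
  star_inner : ∀ x y, star (inner x y) = inner y x
  inner_self_nonneg : ∀ x, ∃ d : D, inner x x = star d * d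
  norm_sq : ∀ x, ‖x‖ ^ 2 = ‖inner x x‖

namespace FellBundle

variable {G₀ : Type u₀} {G : Type u} [TopologicalSpace G₀] [TopologicalSpace G]
  [LocallyCompactSpace G] [T2Space G] [MeasurableSpace G] [BorelSpace G]
  {𝒢 : TopGroupoid G₀ G} {A : G → Type w} [∀ g, NormedAddCommGroup (A g)]
  [∀ g, NormedSpace ℂ (A g)] [∀ g, CompleteSpace (A g)] [TopologicalSpace (TotalSp A)]
  (𝓐 : FellBundle 𝒢 A) (H : HaarSystem 𝒢)
  (D : Type v) {F : Type v'} [NonUnitalCStarAlgebra D] [NormedAddCommGroup F]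
  [NormedSpace ℂ F] [CompleteSpace F] [HilbertModule D F]

/-- A representation of `C_c(G, A)` on a Hilbert `D`-module `F`, that is, a *-homomorphism from
`C_c(G, A)` to the adjointable operators on `F`: the operator `L f` is adjointable, its adjoint
is `L (f^*)`, and `L` is multiplicative. -/
structure IsRepresentation (L : 𝓐.Cc →ₗ[ℂ] (F →L[ℂ] F)) : Prop where
  adjoint : ∀ f x y, HilbertModule.inner (D := D) (L f x) y =
    HilbertModule.inner x (L (𝓐.involution f) y)
  map_conv : ∀ f₁ f₂, L (𝓐.conv H f₁ f₂) = L f₁ ∘L L f₂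

/-- Nondegeneracy of a representation. -/
def IsNondegenerate (L : 𝓐.Cc →ₗ[ℂ] (F →L[ℂ] F)) : Prop :=
  Dense (Submodule.span ℂ {y : F | ∃ f x, L f x = y} : Set F)

variable (F) in
/-- A pre-representation of `C_c(G, A)` on a Hilbert `D`-module `F`, with domain `F₀`. -/
structure PreRepresentation (F₀ : Type*) [AddCommGroup F₀] [Module ℂ F₀] where
  ι : F₀ →ₗ[ℂ] F
  L : 𝓐.Cc →ₗ[ℂ] F₀ →ₗ[ℂ] F
  denseRange_ι : DenseRange ι
  bounded : ∀ (ξ η : F₀) (K : Set G), IsCompact K → ∃ C : ℝ, ∀ f, 𝓐.SupportedIn K f →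
    ‖HilbertModule.inner (D := D) (ι ξ) (L f η)‖ ≤ C * 𝓐.supNorm f
  inner_L : ∀ (ξ η : F₀) (f₁ f₂ : 𝓐.Cc), HilbertModule.inner (D := D) (L f₁ ξ) (L f₂ η) =
    HilbertModule.inner (ι ξ) (L (𝓐.conv H (𝓐.involution f₁) f₂) η)
  dense_span : Dense (Submodule.span ℂ {y : F | ∃ f ξ, L f ξ = y} : Set F)

end FellBundle

end

/-! Write Λ : C_c(G,A) ⊗ F₀ → F for the linear map f ⊗ ξ ↦ L(f)ξ. Condition (2) says that an
operator T on C_c(G,A) with adjoint T' for the pairing (f₁,f₂) ↦ f₁^* * f₂ satisfies ⟨Λ(Tx), Λ(y)⟩ =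
⟨Λ(x), Λ(T'y)⟩ (`IsPreRep.inner_rTensor`). Since Λ has dense range, (a) reduces to the estimate ‖Λ(u
* x)‖ ≤ ‖u‖_I ‖Λ(x)‖. It is proved directly, without disintegrating the representation, and so needs
no separability.

The estimate has two ingredients. First, let T be symmetric with ‖(Tf)(g)‖ ≤ c‖f(g)‖ for all f and
g. The numbers q_n = ‖Λ(Tⁿx)‖ are log-convex by Cauchy–Schwarz, and q_n² = ‖⟨Λ(x), Λ(T²ⁿx)⟩‖ is
O(c²ⁿ) by condition (1), because T²ⁿ keeps supports. Hence q_1 ≤ c q_0 (`IsPreRep.norm_rTensor_le`).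

Second, convolution with u is approximately ∑ P_i Q_i with control on ∑ P_i² and ∑ Q_i^* Q_i, much
as in the Schur test (`hasFactorisations_convL`). A continuous b ≥ ‖u‖ is chosen whose integrals
against all α^x and α̃_x are at most M = ‖u‖_I + ε, although ‖u‖ is only upper semicontinuous. With
a = √b, u = a v and ‖v‖ ≤ a. For a fine partition of unity χ_i on the support of v, the functions
φ_i = χ_i / √(∫χ_i + δ) behave like an orthonormal system on each range fibre: ∑ φ_i(g) ∫ φ_i Z ≈
Z(g). Let α_i(x) = ∫ a φ_i dα^x, let P_i be multiplication by α_i ∘ r and let Q_i be convolution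
with φ_i v. Then ∑ P_i Q_i approximates convolution with a v = u. The operator ∑ P_i² multiplies by
∑ α_i² ≤ ∫ a² ≤ M, a Bessel inequality. And ∑ Q_i^* Q_i approximates left multiplication by ∫
v(h⁻¹)^* v(h⁻¹) dα(h), which has norm at most M. The errors are uniformly small with support in a
fixed compact set, so they disappear in matrix coefficients by condition (1). Cauchy–Schwarz in F
gives the bound M (`IsPreRep.norm_le_of_hasFactorisations`).

For (b), a representation that is continuous in the inductive limit topology has the algebraic
properties of a pre-representation with ι = id. The estimate and ‖L(u)x‖² = ‖⟨x, L(u^*)L(u)x⟩‖ show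
that it is even contractive for the I-norm; the converse holds because sections supported in a fixed
compact set have I-norm at most a multiple of the supremum norm. For (c), D acts on itself by left
multiplication. Contractivity makes ‖φ(·)‖ one of the seminorms that define C^*(G,A), which gives
the extension. -/

noncomputable section

set_option linter.unusedSectionVars false

/-! ## The product as a total operation -/

namespace TopGroupoid

variable {G₀ : Type u₀} {G : Type u} [TopologicalSpace G₀] [TopologicalSpace G]
  (𝒢 : TopGroupoid G₀ G)

open Classical in
/-- The product `g h`, with value `g` if `g` and `h` are not composable. -/
def mul (g h : G) : G := if e : 𝒢.s g = 𝒢.r h then 𝒢.comp g h e else g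

variable {𝒢}

theorem mul_eq_comp {g h : G} (e : 𝒢.s g = 𝒢.r h) : 𝒢.mul g h = 𝒢.comp g h e := dif_pos e

@[simp]
theorem r_mul (g h : G) : 𝒢.r (𝒢.mul g h) = 𝒢.r g := by
  unfold mul
  split_ifs with e
  · exact 𝒢.r_comp g h e
  · rfl

theorem s_mul {g h : G} (e : 𝒢.s g = 𝒢.r h) : 𝒢.s (𝒢.mul g h) = 𝒢.s h := by
  rw [mul_eq_comp e, 𝒢.s_comp]

theorem mul_mul {g h k : G} (e : 𝒢.s g = 𝒢.r h) (e' : 𝒢.s h = 𝒢.r k) :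
    𝒢.mul (𝒢.mul g h) k = 𝒢.mul g (𝒢.mul h k) := by
  rw [mul_eq_comp (g := 𝒢.mul g h) ((s_mul e).trans e'),
    mul_eq_comp (h := 𝒢.mul h k) (e.trans (r_mul h k).symm),
    𝒢.comp_congr (mul_eq_comp e) rfl _ ((𝒢.s_comp g h e).trans e'), 𝒢.assoc g h k e e']
  exact 𝒢.comp_congr rfl (mul_eq_comp e').symm _ _

theorem unit_mul {x : G₀} {g : G} (e : 𝒢.r g = x) : 𝒢.mul (𝒢.unit x) g = g := by
  subst e
  rw [mul_eq_comp (𝒢.s_unit _), 𝒢.unit_comp]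

theorem mul_unit {x : G₀} {g : G} (e : 𝒢.s g = x) : 𝒢.mul g (𝒢.unit x) = g := by
  subst e
  rw [mul_eq_comp (𝒢.r_unit _).symm, 𝒢.comp_unit]

theorem inv_mul (g : G) : 𝒢.mul (𝒢.inv g) g = 𝒢.unit (𝒢.s g) := by
  rw [mul_eq_comp (𝒢.s_inv g), 𝒢.inv_comp]

theorem mul_inv (g : G) : 𝒢.mul g (𝒢.inv g) = 𝒢.unit (𝒢.r g) := by
  rw [mul_eq_comp (𝒢.r_inv g).symm, 𝒢.comp_inv]

theorem mul_inv_mul {g h : G} (e : 𝒢.r g = 𝒢.r h) : 𝒢.mul g (𝒢.mul (𝒢.inv g) h) = h := by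
  rw [← mul_mul (𝒢.r_inv g).symm (by rw [𝒢.s_inv, e]), mul_inv, unit_mul e.symm]

theorem inv_mul_mul {g h : G} (e : 𝒢.s g = 𝒢.r h) : 𝒢.mul (𝒢.inv g) (𝒢.mul g h) = h := by
  rw [← mul_mul (𝒢.s_inv g) e, inv_mul, unit_mul e.symm]

theorem inv_mul_rev {g h : G} (e : 𝒢.s g = 𝒢.r h) :
    𝒢.inv (𝒢.mul g h) = 𝒢.mul (𝒢.inv h) (𝒢.inv g) := by
  have e₁ : 𝒢.s (𝒢.inv h) = 𝒢.r (𝒢.inv g) := by rw [𝒢.s_inv, 𝒢.r_inv, e]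
  have h₁ : 𝒢.mul (𝒢.mul g h) (𝒢.mul (𝒢.inv h) (𝒢.inv g)) = 𝒢.unit (𝒢.r g) := by
    rw [mul_mul e (by rw [r_mul, 𝒢.r_inv]),
      ← mul_mul (𝒢.r_inv h).symm e₁, mul_inv, unit_mul (by rw [𝒢.r_inv, e]), mul_inv]
  rw [← inv_mul_mul (𝒢 := 𝒢) (g := 𝒢.mul g h) (h := 𝒢.mul (𝒢.inv h) (𝒢.inv g))
    (by rw [s_mul e, r_mul, 𝒢.r_inv]), h₁, mul_unit (by rw [𝒢.s_inv, r_mul])]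

theorem continuous_mul {Z : Type*} [TopologicalSpace Z] {a b : Z → G} (ha : Continuous a)
    (hb : Continuous b) (e : ∀ z, 𝒢.s (a z) = 𝒢.r (b z)) :
    Continuous fun z => 𝒢.mul (a z) (b z) := by
  have h : (fun z => 𝒢.mul (a z) (b z)) = (fun p : {p : G × G // 𝒢.s p.1 = 𝒢.r p.2} =>
      𝒢.comp p.1.1 p.1.2 p.2) ∘ fun z => ⟨(a z, b z), e z⟩ := by
    funext z
    exact mul_eq_comp (e z)
  rw [h]
  exact 𝒢.continuous_comp.comp ((ha.prodMk hb).subtype_mk _)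

/-- The set of products of composable arrows in `K` and `L`. -/
def mulSet (𝒢 : TopGroupoid G₀ G) (K L : Set G) : Set G :=
  {g | ∃ h ∈ K, ∃ k ∈ L, 𝒢.s h = 𝒢.r k ∧ 𝒢.mul h k = g}

/-- The composable pairs are closed in G × G because the unit space is Hausdorff, so those in K × L
form a compact set, on which the product is continuous. -/
theorem isCompact_mulSet [LocallyCompactSpace G] [T2Space G] [MeasurableSpace G] [BorelSpace G]
    {K L : Set G} (hK : IsCompact K) (hL : IsCompact L) :
    IsCompact (𝒢.mulSet K L) := by
  have := 𝒢.t2_units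
  have h : 𝒢.mulSet K L = (fun p : {p : G × G // 𝒢.s p.1 = 𝒢.r p.2} => 𝒢.mul p.1.1 p.1.2) ''
      (Subtype.val ⁻¹' (K ×ˢ L)) := by
    ext g
    constructor
    · rintro ⟨h, hh, k, hk, e, rfl⟩
      exact ⟨⟨(h, k), e⟩, ⟨hh, hk⟩, rfl⟩
    · rintro ⟨⟨⟨h, k⟩, e⟩, ⟨hh, hk⟩, rfl⟩
      exact ⟨h, hh, k, hk, e, rfl⟩
  rw [h]
  refine IsCompact.image ?_ (continuous_mul (by fun_prop) (by fun_prop) fun z => z.2)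
  exact (isClosed_eq (𝒢.continuous_s.comp continuous_fst)
    (𝒢.continuous_r.comp continuous_snd)).isClosedEmbedding_subtypeVal.isCompact_preimage
      (hK.prod hL)

theorem isCompact_inv {K : Set G} (hK : IsCompact K) : IsCompact (𝒢.inv ⁻¹' K) := by
  have h : 𝒢.inv ⁻¹' K = 𝒢.inv '' K := by
    ext g
    exact ⟨fun h => ⟨_, h, 𝒢.inv_inv g⟩, by rintro ⟨k, hk, rfl⟩; simpa [𝒢.inv_inv] using hk⟩
  rw [h]
  exact hK.image 𝒢.continuous_inv

/-- Inversion as a homeomorphism. -/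
def invHomeomorph (𝒢 : TopGroupoid G₀ G) : G ≃ₜ G where
  toFun := 𝒢.inv
  invFun := 𝒢.inv
  left_inv := 𝒢.inv_inv
  right_inv := 𝒢.inv_inv
  continuous_toFun := 𝒢.continuous_inv
  continuous_invFun := 𝒢.continuous_inv

end TopGroupoid

theorem TotalSp.mk_injective {X : Type u} {A : X → Type w} {x : X} {a b : A x}
    (h : (⟨x, a⟩ : TotalSp A) = ⟨x, b⟩) : a = b := by
  cases h
  rfl

/-! ### Fibre operations of a Fell bundle with a freely chosen target fibre. -/

namespace FellBundle

open TopGroupoid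

variable {G₀ : Type u₀} {G : Type u} [TopologicalSpace G₀] [TopologicalSpace G]
  {𝒢 : TopGroupoid G₀ G} {A : G → Type w} [∀ g, NormedAddCommGroup (A g)]
  [∀ g, NormedSpace ℂ (A g)] [∀ g, CompleteSpace (A g)] [TopologicalSpace (TotalSp A)]
  (𝓐 : FellBundle 𝒢 A)

open Classical in
/-- The multiplication `A g × A h → A k`, which vanishes unless `g h = k`. -/
def mulTo (g h k : G) : A g →L[ℂ] A h →L[ℂ] A k :=
  if e : ∃ e : 𝒢.s g = 𝒢.r h, 𝒢.comp g h e = k then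
    e.choose_spec ▸ LinearMap.mkContinuous₂ (𝓐.mulMap g h e.choose) 1 fun a b => by
      simpa using 𝓐.norm_mul_le g h e.choose a b
  else 0

open Classical in
/-- The involution `A g → A k`, which vanishes unless `k = g⁻¹`. -/
def starTo (g k : G) : A g →ₗ⋆[ℂ] A k :=
  if e : 𝒢.inv g = k then e ▸ 𝓐.starMap g else 0

variable {𝓐}

/-- Equality in `TotalSp` does not depend on how the base point is written. Identities between
elements of equal but differently named fibres are therefore verified there and brought back by
`TotalSp.mk_injective`. -/
theorem mk_mulTo {g h k : G} (e : 𝒢.s g = 𝒢.r h) (e' : 𝒢.mul g h = k) (a : A g) (b : A h) :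
    (⟨k, 𝓐.mulTo g h k a b⟩ : TotalSp A) = ⟨_, 𝓐.mulMap g h e a b⟩ := by
  rw [mul_eq_comp e] at e'
  subst e'
  rw [mulTo, dif_pos ⟨e, rfl⟩]
  rfl

theorem mk_starTo {g k : G} (e : 𝒢.inv g = k) (a : A g) :
    (⟨k, 𝓐.starTo g k a⟩ : TotalSp A) = ⟨_, 𝓐.starMap g a⟩ := by
  subst e
  rw [starTo, dif_pos rfl]

theorem mulTo_comp {g h : G} (e : 𝒢.s g = 𝒢.r h) (a : A g) (b : A h) :
    𝓐.mulTo g h (𝒢.comp g h e) a b = 𝓐.mulMap g h e a b :=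
  TotalSp.mk_injective (mk_mulTo e (mul_eq_comp e) a b)

theorem starTo_inv (g : G) (a : A g) : 𝓐.starTo g (𝒢.inv g) a = 𝓐.starMap g a :=
  TotalSp.mk_injective (mk_starTo rfl a)

theorem norm_mulTo_le (g h k : G) (a : A g) (b : A h) : ‖𝓐.mulTo g h k a b‖ ≤ ‖a‖ * ‖b‖ := by
  by_cases e : ∃ e : 𝒢.s g = 𝒢.r h, 𝒢.comp g h e = k
  · obtain ⟨e, rfl⟩ := e
    rw [mulTo_comp]
    exact 𝓐.norm_mul_le g h e a b
  · rw [mulTo, dif_neg e]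
    simpa using mul_nonneg (norm_nonneg a) (norm_nonneg b)

/-- Divide ‖a‖² = ‖a^* a‖ ≤ ‖a^*‖ ‖a‖ by ‖a‖. Isometry of the involution is not an axiom; it follows
from this inequality for a and for a^*. -/
theorem norm_starMap_le (g : G) (a : A g) : ‖a‖ ≤ ‖𝓐.starMap g a‖ := by
  have h := 𝓐.norm_mul_le _ _ (𝒢.s_inv g) (𝓐.starMap g a) a
  rw [𝓐.norm_star_mul_self, sq] at h
  rcases (norm_nonneg a).eq_or_lt with h0 | h0
  · rw [← h0]; exact norm_nonneg _
  · exact le_of_mul_le_mul_right h h0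

theorem norm_starTo {g k : G} (e : 𝒢.inv g = k) (a : A g) : ‖𝓐.starTo g k a‖ = ‖a‖ := by
  subst e
  rw [starTo_inv]
  refine le_antisymm ?_ (norm_starMap_le g a)
  have h := norm_starMap_le (𝓐 := 𝓐) _ (𝓐.starMap g a)
  have h2 : ‖𝓐.starMap _ (𝓐.starMap g a)‖ = ‖a‖ :=
    congrArg (fun t : TotalSp A => ‖t.val‖) (𝓐.star_star g a)
  exact h.trans h2.le

theorem mulTo_mulTo {g h l x y k : G} (e : 𝒢.s g = 𝒢.r h) (e' : 𝒢.s h = 𝒢.r l)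
    (hx : 𝒢.mul g h = x) (hy : 𝒢.mul h l = y) (hk : 𝒢.mul x l = k) (a : A g) (b : A h) (c : A l) :
    𝓐.mulTo x l k (𝓐.mulTo g h x a b) c = 𝓐.mulTo g y k a (𝓐.mulTo h l y b c) := by
  have hk' : 𝒢.mul g y = k := by rw [← hk, ← hx, ← hy, mul_mul e e']
  rw [mul_eq_comp e] at hx
  rw [mul_eq_comp e'] at hy
  subst hx hy
  apply TotalSp.mk_injective
  rw [mk_mulTo ((𝒢.s_comp g h e).trans e') hk, mk_mulTo (e.trans (𝒢.r_comp h l e').symm) hk',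
    mulTo_comp, mulTo_comp]
  exact 𝓐.mul_assoc g h l e e' a b c

theorem starTo_mulTo {g h x k g' h' : G} (e : 𝒢.s g = 𝒢.r h) (hx : 𝒢.mul g h = x)
    (hk : 𝒢.inv x = k) (hg : 𝒢.inv g = g') (hh : 𝒢.inv h = h') (a : A g) (b : A h) :
    𝓐.starTo x k (𝓐.mulTo g h x a b) =
      𝓐.mulTo h' g' k (𝓐.starTo h h' b) (𝓐.starTo g g' a) := by
  have hk' : 𝒢.mul h' g' = k := by rw [← hk, ← hx, ← hh, ← hg, inv_mul_rev e]
  rw [mul_eq_comp e] at hx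
  subst hx hg hh
  apply TotalSp.mk_injective
  rw [mk_starTo hk, mk_mulTo ((𝒢.s_inv h).trans (e.symm.trans (𝒢.r_inv g).symm)) hk',
    mulTo_comp, starTo_inv, starTo_inv]
  exact 𝓐.star_mul g h e a b

theorem starTo_starTo {g k : G} (e : 𝒢.inv g = k) (a : A g) :
    𝓐.starTo k g (𝓐.starTo g k a) = a := by
  subst e
  apply TotalSp.mk_injective
  rw [mk_starTo (𝒢.inv_inv g), starTo_inv]
  exact 𝓐.star_star g a

theorem continuous_mulTo {Z : Type*} [TopologicalSpace Z] {g h k : Z → G} {a : ∀ z, A (g z)}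
    {b : ∀ z, A (h z)} (ha : Continuous fun z => (⟨g z, a z⟩ : TotalSp A))
    (hb : Continuous fun z => (⟨h z, b z⟩ : TotalSp A)) (e : ∀ z, 𝒢.s (g z) = 𝒢.r (h z))
    (hk : ∀ z, 𝒢.mul (g z) (h z) = k z) :
    Continuous fun z => (⟨k z, 𝓐.mulTo (g z) (h z) (k z) (a z) (b z)⟩ : TotalSp A) := by
  simp only [fun z => mk_mulTo (𝓐 := 𝓐) (e z) (hk z) (a z) (b z)]
  exact 𝓐.continuous_mul.comp (f := fun z => (⟨(⟨g z, a z⟩, ⟨h z, b z⟩), e z⟩ :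
    {p : TotalSp A × TotalSp A // 𝒢.s p.1.pt = 𝒢.r p.2.pt})) ((ha.prodMk hb).subtype_mk _)

theorem involution_apply (f : 𝓐.Cc) (g : G) :
    (𝓐.involution f).1 g = 𝓐.starTo (𝒢.inv g) g (f.1 (𝒢.inv g)) := by
  apply TotalSp.mk_injective
  rw [mk_starTo (𝒢.inv_inv g)]
  exact TotalSp.mk_transport _ _

theorem convIntegrand_eq (f₁ f₂ : ∀ g, A g) {g h : G} (e : 𝒢.r h = 𝒢.r g) :
    𝓐.convIntegrand f₁ f₂ g h =
      𝓐.mulTo h (𝒢.mul (𝒢.inv h) g) g (f₁ h) (f₂ (𝒢.mul (𝒢.inv h) g)) := by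
  have e' : 𝒢.s (𝒢.inv h) = 𝒢.r g := by rw [𝒢.s_inv, e]
  apply TotalSp.mk_injective
  rw [convIntegrand, dif_pos e, TotalSp.mk_transport, mul_eq_comp e',
    mk_mulTo (𝒢.composable_inv_comp e)]
  rw [← mul_eq_comp e']
  exact mul_inv_mul e

theorem convIntegrand_of_ne (f₁ f₂ : ∀ g, A g) {g h : G} (e : 𝒢.r h ≠ 𝒢.r g) :
    𝓐.convIntegrand f₁ f₂ g h = 0 := dif_neg e

theorem norm_convIntegrand_le (f₁ f₂ : ∀ g, A g) (g h : G) :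
    ‖𝓐.convIntegrand f₁ f₂ g h‖ ≤ ‖f₁ h‖ * ‖f₂ (𝒢.mul (𝒢.inv h) g)‖ := by
  by_cases e : 𝒢.r h = 𝒢.r g
  · rw [convIntegrand_eq _ _ e]
    exact norm_mulTo_le _ _ _ _ _
  · rw [convIntegrand_of_ne _ _ e, norm_zero]
    positivity

end FellBundle

/-! ## Integration on the range fibres -/

/-- Adding the complement of the closed range to an open subset of the range makes it open in the
ambient space and adds no mass; this gives outer regularity. -/
theorem MeasureTheory.Measure.Regular.map_isClosedEmbedding {X Y : Type*} [TopologicalSpace X]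
    [TopologicalSpace Y] [MeasurableSpace X] [BorelSpace X] [MeasurableSpace Y] [BorelSpace Y]
    [T2Space Y] {f : X → Y} (hf : IsClosedEmbedding f) (μ : Measure X) [μ.Regular] :
    (μ.map f).Regular := by
  have hm := hf.measurableEmbedding
  refine @Measure.Regular.mk _ _ _ _ ⟨fun K hK => ?_⟩ ⟨fun B hB r hr => ?_⟩ fun V hV r hr => ?_
  · rw [hm.map_apply]
    exact (hf.isCompact_preimage hK).measure_lt_top
  · rw [hm.map_apply] at hr
    obtain ⟨U, hBU, hU, hUr⟩ := Set.exists_isOpen_lt_of_lt _ r hr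
    obtain ⟨V, hV, rfl⟩ := hf.isInducing.isOpen_iff.1 hU
    refine ⟨V ∪ (range f)ᶜ, fun y hy => ?_, hV.union hf.isClosed_range.isOpen_compl, ?_⟩
    · by_cases h : y ∈ range f
      · obtain ⟨x, rfl⟩ := h
        exact Or.inl (hBU hy)
      · exact Or.inr h
    · rw [hm.map_apply]
      simpa using hUr
  · rw [hm.map_apply] at hr
    obtain ⟨K, hKV, hK, hKr⟩ := (hV.preimage hf.continuous).exists_lt_isCompact hr
    refine ⟨f '' K, image_subset_iff.2 hKV, hK.image hf.continuous, ?_⟩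
    rw [hm.map_apply]
    exact hKr.trans_le (measure_mono (subset_preimage_image f K))

namespace HaarSystem

open TopGroupoid

variable {G₀ : Type u₀} {G : Type u} [TopologicalSpace G₀] [TopologicalSpace G]
  [LocallyCompactSpace G] [T2Space G] [MeasurableSpace G] [BorelSpace G]
  {𝒢 : TopGroupoid G₀ G} (H : HaarSystem 𝒢)

theorem ae_r (x : G₀) : ∀ᵐ h ∂(H.meas x), 𝒢.r h = x := H.meas_compl x

instance (x : G₀) : (H.meas x).Regular := H.regular x

theorem isClosed_fibre (𝒢 : TopGroupoid G₀ G) (x : G₀) : IsClosed {h | 𝒢.r h = x} := by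
  have := 𝒢.t2_units
  exact isClosed_eq 𝒢.continuous_r continuous_const

/-- The Haar measure on a range fibre. -/
def fibreMeas (x : G₀) : Measure {h | 𝒢.r h = x} := (H.meas x).comap Subtype.val

theorem restrict_fibre (x : G₀) : (H.meas x).restrict {h | 𝒢.r h = x} = H.meas x :=
  Measure.restrict_eq_self_of_ae_mem (H.ae_r x)

theorem map_fibreMeas (x : G₀) : (H.fibreMeas x).map Subtype.val = H.meas x := by
  rw [fibreMeas, map_comap_subtype_coe (isClosed_fibre 𝒢 x).measurableSet, restrict_fibre]

theorem integral_fibreMeas {E : Type*} [NormedAddCommGroup E] [NormedSpace ℝ E] (x : G₀)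
    (F : G → E) : ∫ h : {h | 𝒢.r h = x}, F h ∂(H.fibreMeas x) = ∫ h, F h ∂(H.meas x) := by
  rw [fibreMeas, integral_subtype_comap (isClosed_fibre 𝒢 x).measurableSet, restrict_fibre]

instance (x : G₀) : (H.fibreMeas x).Regular := by
  have hc := (isClosed_fibre 𝒢 x).isClosedEmbedding_subtypeVal
  have hm := hc.measurableEmbedding
  have := Measure.OuterRegular.comap' (H.meas x) hc.continuous hm
  have := IsFiniteMeasureOnCompacts.comap' (H.meas x) hc.continuous hm
  have h0 : ∀ U : Set G, H.fibreMeas x (Subtype.val ⁻¹' U) = H.meas x U := fun U => by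
    rw [← hm.map_apply, map_fibreMeas]
  refine @Measure.Regular.mk _ _ _ _ (by assumption) (by assumption) fun U hU r hr => ?_
  obtain ⟨V, hV, rfl⟩ := hc.isInducing.isOpen_iff.1 hU
  change r < H.fibreMeas x _ at hr
  rw [h0] at hr
  obtain ⟨K, hKV, hK, hKr⟩ := hV.exists_lt_isCompact hr
  exact ⟨Subtype.val ⁻¹' K, preimage_mono hKV, hc.isCompact_preimage hK, hKr.trans_eq (h0 K).symm⟩

/-- Left multiplication with `g` as a homeomorphism of range fibres. -/
def mulLeft (𝒢 : TopGroupoid G₀ G) (g : G) : {h | 𝒢.r h = 𝒢.s g} ≃ₜ {h | 𝒢.r h = 𝒢.r g} where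
  toFun h := ⟨𝒢.mul g h, r_mul g _⟩
  invFun h := ⟨𝒢.mul (𝒢.inv g) h, (r_mul _ _).trans (𝒢.r_inv g)⟩
  left_inv h := Subtype.ext (inv_mul_mul h.2.symm)
  right_inv h := Subtype.ext (mul_inv_mul h.2.symm)
  continuous_toFun := (TopGroupoid.continuous_mul continuous_const continuous_subtype_val
    fun h => h.2.symm).subtype_mk _
  continuous_invFun := (TopGroupoid.continuous_mul continuous_const continuous_subtype_val
    fun h => (𝒢.s_inv g).trans h.2.symm).subtype_mk _

/-- Left invariance of a Haar system is stated for real test functions only. Regular measures that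
agree on test functions are equal, so invariance passes to the measures and hence to Bochner
integrals with values in the fibres. -/
theorem map_mulLeft (g : G) :
    (H.fibreMeas (𝒢.s g)).map (mulLeft 𝒢 g) = H.fibreMeas (𝒢.r g) := by
  have hc := (isClosed_fibre 𝒢 (𝒢.r g)).isClosedEmbedding_subtypeVal
  have hm := hc.measurableEmbedding
  have := Measure.Regular.map (μ := H.fibreMeas (𝒢.s g)) (mulLeft 𝒢 g)
  have := Measure.Regular.map_isClosedEmbedding hc ((H.fibreMeas (𝒢.s g)).map (mulLeft 𝒢 g))
  suffices h : ((H.fibreMeas (𝒢.s g)).map (mulLeft 𝒢 g)).map Subtype.val = H.meas (𝒢.r g) by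
    rw [← hm.comap_map ((H.fibreMeas (𝒢.s g)).map (mulLeft 𝒢 g)), h, fibreMeas]
  refine Measure.ext_of_integral_eq_on_compactlySupported fun f => ?_
  rw [hm.integral_map, (mulLeft 𝒢 g).measurableEmbedding.integral_map,
    ← H.left_invariant f f.continuous f.hasCompactSupport g]
  refine (H.integral_fibreMeas (𝒢.s g) fun h => f (𝒢.mul g h)).trans (integral_congr_ae ?_)
  filter_upwards [H.ae_r (𝒢.s g)] with h hh
  rw [dif_pos hh.symm, mul_eq_comp hh.symm]

theorem integral_mul_left {E : Type*} [NormedAddCommGroup E] [NormedSpace ℝ E] (g : G)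
    (F : G → E) : ∫ h, F (𝒢.mul g h) ∂(H.meas (𝒢.s g)) = ∫ h, F h ∂(H.meas (𝒢.r g)) := by
  rw [← H.integral_fibreMeas, ← H.integral_fibreMeas, ← H.map_mulLeft,
    (mulLeft 𝒢 g).measurableEmbedding.integral_map]
  rfl

theorem integrable_of_continuousOn {E : Type*} [NormedAddCommGroup E] {x : G₀} {F : G → E}
    (hF : ContinuousOn F {h | 𝒢.r h = x}) {K : Set G} (hK : IsCompact K)
    (hFK : ∀ h ∉ K, 𝒢.r h = x → F h = 0) : Integrable F (H.meas x) := by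
  refine ((hF.mono inter_subset_right).integrableOn_compact
    (hK.inter_right (isClosed_fibre 𝒢 x))).integrable_of_ae_notMem_eq_zero ?_
  filter_upwards [H.ae_r x] with h hr hh
  exact hFK h (fun hk => hh ⟨hk, hr⟩) hr

/-- The measures need not be σ-finite, so the version of Fubini's theorem for compactly supported
continuous functions is used. The integrals move to the range fibres because F is only assumed
continuous there. -/
theorem integral_integral_swap {E : Type*} [NormedAddCommGroup E] [NormedSpace ℝ E] {x y : G₀}
    {F : G → G → E} (hF : Continuous fun z : {h | 𝒢.r h = x} × {h | 𝒢.r h = y} => F z.1 z.2)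
    {K L : Set G} (hK : IsCompact K) (hL : IsCompact L)
    (hFK : ∀ h k, 𝒢.r h = x → 𝒢.r k = y → F h k ≠ 0 → h ∈ K ∧ k ∈ L) :
    ∫ h, ∫ k, F h k ∂(H.meas y) ∂(H.meas x) = ∫ k, ∫ h, F h k ∂(H.meas x) ∂(H.meas y) := by
  simp only [← H.integral_fibreMeas]
  refine integral_integral_swap_of_hasCompactSupport
    (f := fun (h : {h | 𝒢.r h = x}) (k : {h | 𝒢.r h = y}) => F h k) hF ?_
  refine HasCompactSupport.intro
    (((isClosed_fibre 𝒢 x).isClosedEmbedding_subtypeVal.isCompact_preimage hK).prod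
    ((isClosed_fibre 𝒢 y).isClosedEmbedding_subtypeVal.isCompact_preimage hL)) fun z hz => ?_
  by_contra h
  exact hz (hFK _ _ z.1.2 z.2.2 h)

theorem integrable_of_hasCompactSupport (x : G₀) {f : G → ℝ} (hf : Continuous f)
    (hc : HasCompactSupport f) : Integrable f (H.meas x) :=
  hf.integrable_of_hasCompactSupport hc

/-- The integrals of a compactly supported function are uniformly bounded. -/
theorem exists_integral_le {f : G → ℝ} (hf : Continuous f) (hc : HasCompactSupport f) :
    ∃ C, 0 ≤ C ∧ ∀ x, ∫ g, f g ∂(H.meas x) ≤ C := by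
  have hK : IsCompact (𝒢.r '' tsupport f) := hc.image 𝒢.continuous_r
  obtain ⟨C, hC⟩ := hK.bddAbove_image (H.continuous_integral f hf hc).continuousOn
  refine ⟨max C 0, le_max_right _ _, fun x => ?_⟩
  by_cases hx : x ∈ 𝒢.r '' tsupport f
  · exact (hC ⟨x, hx, rfl⟩).trans (le_max_left _ _)
  · refine le_trans (le_of_eq ?_) (le_max_right _ _)
    refine integral_eq_zero_of_ae ?_
    filter_upwards [H.ae_r x] with h hh
    exact image_eq_zero_of_notMem_tsupport fun h' => hx ⟨h, h', hh⟩

end HaarSystem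

/-- A cutoff function for a compact set. -/
theorem exists_cutoff {X : Type*} [TopologicalSpace X] [T2Space X] [LocallyCompactSpace X]
    {K : Set X} (hK : IsCompact K) : ∃ ψ : C(X, ℝ), (∀ h ∈ K, ψ h = 1) ∧ (∀ h, 0 ≤ ψ h) ∧
      (∀ h, ψ h ≤ 1) ∧ HasCompactSupport ψ := by
  obtain ⟨f, h1, -, h3, h2⟩ := exists_continuous_one_zero_of_isCompact hK isClosed_empty
    (disjoint_empty K)
  exact ⟨f, h1, fun h => (h2 h).1, fun h => (h2 h).2, h3⟩

namespace HaarSystem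

variable {G₀ : Type u₀} {G : Type u} [TopologicalSpace G₀] [TopologicalSpace G]
  [LocallyCompactSpace G] [T2Space G] [MeasurableSpace G] [BorelSpace G]
  {𝒢 : TopGroupoid G₀ G} (H : HaarSystem 𝒢)

/-- Integrals of functions supported in a fixed compact set are controlled by the supremum
norm. -/
theorem exists_norm_integral_le {K : Set G} (hK : IsCompact K) : ∃ C, 0 ≤ C ∧
    ∀ (E : Type w) [NormedAddCommGroup E] [NormedSpace ℝ E] (x : G₀) (F : G → E) (c : ℝ),
      (∀ h ∉ K, 𝒢.r h = x → F h = 0) → (∀ h ∈ K, 𝒢.r h = x → ‖F h‖ ≤ c) → 0 ≤ c →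
        ‖∫ h, F h ∂(H.meas x)‖ ≤ C * c := by
  obtain ⟨ψ, h1, h0, -, hc⟩ := exists_cutoff hK
  obtain ⟨C, hC0, hC⟩ := H.exists_integral_le ψ.continuous hc
  refine ⟨C, hC0, fun E _ _ x F c hFK hFc hc0 => ?_⟩
  calc ‖∫ h, F h ∂(H.meas x)‖ ≤ ∫ h, ψ h * c ∂(H.meas x) := by
        refine norm_integral_le_of_norm_le
          ((H.integrable_of_hasCompactSupport x ψ.continuous hc).mul_const c) ?_
        filter_upwards [H.ae_r x] with h hr
        by_cases hh : h ∈ K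
        · simpa [h1 h hh] using hFc h hh hr
        · simpa [hFK h hh hr] using mul_nonneg (h0 h) hc0
    _ ≤ C * c := by
        rw [integral_mul_const]
        exact mul_le_mul_of_nonneg_right (hC x) hc0

end HaarSystem

/-! ## The convolution algebra -/

theorem IsUSCField.continuous_of_mk {X : Type u} [TopologicalSpace X] {A : X → Type w}
    [∀ x, NormedAddCommGroup (A x)] [∀ x, NormedSpace ℂ (A x)] [TopologicalSpace (TotalSp A)]
    (hA : IsUSCField A) {Z : Type*} [TopologicalSpace Z] {x : X} {F : Z → A x}
    (hF : Continuous fun z => (⟨x, F z⟩ : TotalSp A)) : Continuous F :=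
  continuous_iff_continuousAt.2 fun z => hA.tendsto_of_fibre (hF.tendsto z)

namespace FellBundle

open TopGroupoid

variable {G₀ : Type u₀} {G : Type u} [TopologicalSpace G₀] [TopologicalSpace G]
  {𝒢 : TopGroupoid G₀ G} {A : G → Type w} [∀ g, NormedAddCommGroup (A g)]
  [∀ g, NormedSpace ℂ (A g)] [∀ g, CompleteSpace (A g)] [TopologicalSpace (TotalSp A)]
  {𝓐 : FellBundle 𝒢 A}

/-- The involution between fibres as a real linear map. -/
def starToReal (𝓐 : FellBundle 𝒢 A) {g k : G} (e : 𝒢.inv g = k) : A g →L[ℝ] A k :=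
  LinearMap.mkContinuous
    { toFun := 𝓐.starTo g k
      map_add' := map_add _
      map_smul' := fun c a => by
        rw [← Complex.coe_smul, (𝓐.starTo g k).map_smulₛₗ]
        simp } 1 fun a => by
      simpa using (norm_starTo (𝓐 := 𝓐) e a).le

theorem continuous_section (f : 𝓐.Cc) {Z : Type*} [TopologicalSpace Z] {g : Z → G}
    (hg : Continuous g) : Continuous fun z => (⟨g z, f.1 (g z)⟩ : TotalSp A) :=
  f.2.1.comp hg

theorem exists_supportedIn (f : 𝓐.Cc) : ∃ K, IsCompact K ∧ 𝓐.SupportedIn K f := f.2.2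

theorem involution_supportedIn {K : Set G} {f : 𝓐.Cc} (hf : 𝓐.SupportedIn K f) :
    𝓐.SupportedIn (𝒢.inv ⁻¹' K) (𝓐.involution f) := fun g hg => by
  rw [involution_apply, hf _ hg, map_zero]

theorem involution_involution (f : 𝓐.Cc) : 𝓐.involution (𝓐.involution f) = f := by
  ext g
  rw [involution_apply, involution_apply, 𝒢.inv_inv, starTo_starTo rfl]

theorem involution_add (f₁ f₂ : 𝓐.Cc) :
    𝓐.involution (f₁ + f₂) = 𝓐.involution f₁ + 𝓐.involution f₂ := by
  ext g
  change _ = (𝓐.involution f₁).1 g + (𝓐.involution f₂).1 g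
  simp only [involution_apply]
  exact map_add _ _ _

theorem involution_smul (c : ℂ) (f : 𝓐.Cc) :
    𝓐.involution (c • f) = (starRingEnd ℂ c) • 𝓐.involution f := by
  ext g
  change _ = (starRingEnd ℂ c) • (𝓐.involution f).1 g
  simp only [involution_apply]
  exact LinearMap.map_smulₛₗ _ _ _

theorem convIntegrand_add_right (f : ∀ g, A g) (f₁ f₂ : ∀ g, A g) (g h : G) :
    𝓐.convIntegrand f (f₁ + f₂) g h = 𝓐.convIntegrand f f₁ g h + 𝓐.convIntegrand f f₂ g h := by
  by_cases e : 𝒢.r h = 𝒢.r g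
  · simp [convIntegrand_eq _ _ e]
  · simp [convIntegrand_of_ne _ _ e]

theorem convIntegrand_add_left (f : ∀ g, A g) (f₁ f₂ : ∀ g, A g) (g h : G) :
    𝓐.convIntegrand (f₁ + f₂) f g h = 𝓐.convIntegrand f₁ f g h + 𝓐.convIntegrand f₂ f g h := by
  by_cases e : 𝒢.r h = 𝒢.r g
  · simp [convIntegrand_eq _ _ e]
  · simp [convIntegrand_of_ne _ _ e]

theorem convIntegrand_smul_right (c : ℂ) (f : ∀ g, A g) (f₁ : ∀ g, A g) (g h : G) :
    𝓐.convIntegrand f (c • f₁) g h = c • 𝓐.convIntegrand f f₁ g h := by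
  by_cases e : 𝒢.r h = 𝒢.r g
  · simp [convIntegrand_eq _ _ e]
  · simp [convIntegrand_of_ne _ _ e]

theorem convIntegrand_smul_left (c : ℂ) (f : ∀ g, A g) (f₁ : ∀ g, A g) (g h : G) :
    𝓐.convIntegrand (c • f₁) f g h = c • 𝓐.convIntegrand f₁ f g h := by
  by_cases e : 𝒢.r h = 𝒢.r g
  · simp [convIntegrand_eq _ _ e]
  · simp [convIntegrand_of_ne _ _ e]

theorem convIntegrand_eq_zero {K : Set G} {f₁ : ∀ g, A g} (hf : ∀ g ∉ K, f₁ g = 0)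
    (f₂ : ∀ g, A g) (g : G) {h : G} (hh : h ∉ K) : 𝓐.convIntegrand f₁ f₂ g h = 0 := by
  by_cases e : 𝒢.r h = 𝒢.r g
  · rw [convIntegrand_eq _ _ e, hf h hh, map_zero, zero_apply]
  · rw [convIntegrand_of_ne _ _ e]

theorem convIntegrand_eq_zero_of_notMem_mulSet {K L : Set G} {f₁ f₂ : ∀ g, A g}
    (hf₁ : ∀ g ∉ K, f₁ g = 0) (hf₂ : ∀ g ∉ L, f₂ g = 0) {g : G} (hg : g ∉ 𝒢.mulSet K L) (h : G) :
    𝓐.convIntegrand f₁ f₂ g h = 0 := by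
  by_cases e : 𝒢.r h = 𝒢.r g
  · by_cases hh : h ∈ K
    · rw [convIntegrand_eq _ _ e, hf₂ _ fun hl => hg ⟨h, hh, _, hl, ?_, mul_inv_mul e⟩, map_zero]
      rw [r_mul, 𝒢.r_inv]
    · exact convIntegrand_eq_zero hf₁ _ _ hh
  · rw [convIntegrand_of_ne _ _ e]

variable [LocallyCompactSpace G] [T2Space G] [MeasurableSpace G] [BorelSpace G]
  {H : HaarSystem 𝒢}

theorem _root_.HaarSystem.integrable_section (H : HaarSystem 𝒢) (hA : IsUSCField A)
    {Φ : ∀ g, G → A g} {K : Set G} (hK : IsCompact K) (hΦK : ∀ g, ∀ h ∉ K, Φ g h = 0)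
    (hΦ : Continuous fun z : {z : G × G // 𝒢.r z.2 = 𝒢.r z.1} =>
      (⟨z.1.1, Φ z.1.1 z.1.2⟩ : TotalSp A)) (g : G) : Integrable (Φ g) (H.meas (𝒢.r g)) := by
  simpa using H.integrable_smul_section hA hK hΦK hΦ g 1

theorem integrable_convIntegrand (H : HaarSystem 𝒢) (f₁ f₂ : 𝓐.Cc) (g : G) :
    Integrable (𝓐.convIntegrand f₁.1 f₂.1 g) (H.meas (𝒢.r g)) := by
  obtain ⟨K, hK, hf⟩ := exists_supportedIn f₁
  exact H.integrable_section 𝓐.isField hK (fun g h hh => convIntegrand_eq_zero hf _ g hh)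
    (𝓐.continuous_convIntegrand f₁.2.1 f₂.2.1) g

theorem conv_apply (f₁ f₂ : 𝓐.Cc) (g : G) :
    (𝓐.conv H f₁ f₂).1 g = ∫ h, 𝓐.convIntegrand f₁.1 f₂.1 g h ∂(H.meas (𝒢.r g)) := rfl

theorem conv_apply_mulTo (f₁ f₂ : 𝓐.Cc) (g : G) :
    (𝓐.conv H f₁ f₂).1 g = ∫ h, 𝓐.mulTo h (𝒢.mul (𝒢.inv h) g) g (f₁.1 h)
      (f₂.1 (𝒢.mul (𝒢.inv h) g)) ∂(H.meas (𝒢.r g)) := by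
  refine integral_congr_ae ?_
  filter_upwards [H.ae_r (𝒢.r g)] with h hr
  exact convIntegrand_eq _ _ hr

theorem conv_supportedIn {K L : Set G} {f₁ f₂ : 𝓐.Cc} (h₁ : 𝓐.SupportedIn K f₁)
    (h₂ : 𝓐.SupportedIn L f₂) : 𝓐.SupportedIn (𝒢.mulSet K L) (𝓐.conv H f₁ f₂) := fun _ hg =>
  integral_eq_zero_of_ae (Eventually.of_forall fun h =>
    convIntegrand_eq_zero_of_notMem_mulSet h₁ h₂ hg h)

variable (𝓐 H) in
/-- Convolution as a bilinear map. -/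
def convL : 𝓐.Cc →ₗ[ℂ] 𝓐.Cc →ₗ[ℂ] 𝓐.Cc :=
  LinearMap.mk₂ ℂ (𝓐.conv H)
    (fun f₁ f₂ f => by
      ext g
      change _ = (𝓐.conv H f₁ f).1 g + (𝓐.conv H f₂ f).1 g
      simp only [conv_apply]
      rw [← integral_add (integrable_convIntegrand H _ _ g) (integrable_convIntegrand H _ _ g)]
      exact integral_congr_ae (Eventually.of_forall fun h => convIntegrand_add_left _ _ _ g h))
    (fun c f₁ f => by
      ext g
      change _ = c • (𝓐.conv H f₁ f).1 g
      simp only [conv_apply]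
      rw [← integral_smul]
      exact integral_congr_ae (Eventually.of_forall fun h => convIntegrand_smul_left _ _ _ g h))
    (fun f f₁ f₂ => by
      ext g
      change _ = (𝓐.conv H f f₁).1 g + (𝓐.conv H f f₂).1 g
      simp only [conv_apply]
      rw [← integral_add (integrable_convIntegrand H _ _ g) (integrable_convIntegrand H _ _ g)]
      exact integral_congr_ae (Eventually.of_forall fun h => convIntegrand_add_right _ _ _ g h))
    (fun c f f₁ => by
      ext g
      change _ = c • (𝓐.conv H f f₁).1 g
      simp only [conv_apply]
      rw [← integral_smul]
      exact integral_congr_ae (Eventually.of_forall fun h => convIntegrand_smul_right _ _ _ g h))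

@[simp]
theorem convL_apply (f₁ f₂ : 𝓐.Cc) : 𝓐.convL H f₁ f₂ = 𝓐.conv H f₁ f₂ := rfl

theorem _root_.TopGroupoid.inv_mul_mul_inv_mul {k h g : G} (e : 𝒢.r k = 𝒢.r h)
    (e' : 𝒢.r h = 𝒢.r g) :
    𝒢.mul (𝒢.inv (𝒢.mul (𝒢.inv k) h)) (𝒢.mul (𝒢.inv k) g) = 𝒢.mul (𝒢.inv h) g := by
  rw [inv_mul_rev (by rw [𝒢.s_inv, e]), 𝒢.inv_inv, mul_mul (by rw [𝒢.s_inv, e])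
    (by rw [r_mul, 𝒢.r_inv]), mul_inv_mul (e.trans e')]

/-- By left invariance, substituting k⁻¹h for h in the inner integral of the right-hand side, both
sides become iterated integrals of f₁(k) f₂(k⁻¹h) f₃(h⁻¹g), in different orders. -/
theorem conv_assoc (f₁ f₂ f₃ : 𝓐.Cc) :
    𝓐.conv H (𝓐.conv H f₁ f₂) f₃ = 𝓐.conv H f₁ (𝓐.conv H f₂ f₃) := by
  ext g
  obtain ⟨K₁, hK₁, hf₁⟩ := exists_supportedIn f₁
  obtain ⟨K₂, hK₂, hf₂⟩ := exists_supportedIn f₂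
  let F : G → G → A g := fun h k => 𝓐.mulTo h (𝒢.mul (𝒢.inv h) g) g
    (𝓐.mulTo k (𝒢.mul (𝒢.inv k) h) h (f₁.1 k) (f₂.1 (𝒢.mul (𝒢.inv k) h)))
    (f₃.1 (𝒢.mul (𝒢.inv h) g))
  have hl : (𝓐.conv H (𝓐.conv H f₁ f₂) f₃).1 g =
      ∫ h, ∫ k, F h k ∂(H.meas (𝒢.r g)) ∂(H.meas (𝒢.r g)) := by
    rw [conv_apply_mulTo]
    refine integral_congr_ae ?_
    filter_upwards [H.ae_r (𝒢.r g)] with h hr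
    have h1 := ((𝓐.mulTo h (𝒢.mul (𝒢.inv h) g) g).flip
      (f₃.1 (𝒢.mul (𝒢.inv h) g))).integral_comp_comm (integrable_convIntegrand H f₁ f₂ h)
    rw [ContinuousLinearMap.flip_apply] at h1
    rw [conv_apply, ← h1, hr]
    refine integral_congr_ae ?_
    filter_upwards [H.ae_r (𝒢.r g)] with k hk
    rw [convIntegrand_eq _ _ (hk.trans hr.symm)]
    rfl
  have hr : (𝓐.conv H f₁ (𝓐.conv H f₂ f₃)).1 g =
      ∫ k, ∫ h, F h k ∂(H.meas (𝒢.r g)) ∂(H.meas (𝒢.r g)) := by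
    rw [conv_apply_mulTo]
    refine integral_congr_ae ?_
    filter_upwards [H.ae_r (𝒢.r g)] with k hk
    have h1 := (𝓐.mulTo k (𝒢.mul (𝒢.inv k) g) g (f₁.1 k)).integral_comp_comm
      (integrable_convIntegrand H f₂ f₃ (𝒢.mul (𝒢.inv k) g))
    rw [conv_apply, ← h1, r_mul, ← H.integral_mul_left, 𝒢.s_inv, hk]
    refine integral_congr_ae ?_
    filter_upwards [H.ae_r (𝒢.r g)] with h hh
    have e1 : 𝒢.s k = 𝒢.r (𝒢.mul (𝒢.inv k) h) := by rw [r_mul, 𝒢.r_inv]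
    have e2 : 𝒢.s (𝒢.mul (𝒢.inv k) h) = 𝒢.r (𝒢.mul (𝒢.inv h) g) := by
      rw [s_mul (by rw [𝒢.s_inv, hk, hh]), r_mul, 𝒢.r_inv]
    rw [convIntegrand_eq _ _ (by simp), inv_mul_mul_inv_mul (hk.trans hh.symm) hh]
    refine (mulTo_mulTo e1 e2 (mul_inv_mul (hk.trans hh.symm)) ?_ (mul_inv_mul hh) _ _ _).symm
    rw [mul_mul (by rw [𝒢.s_inv, hk, hh]) (by rw [r_mul, 𝒢.r_inv]), mul_inv_mul hh]
  rw [hl, hr]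
  -- If the integrand is nonzero, then k ∈ K₁ and k⁻¹h ∈ K₂, so that h ∈ K₁K₂; the support of f₃ is
  -- not needed.
  refine H.integral_integral_swap ?_ (isCompact_mulSet (𝒢 := 𝒢) hK₁ hK₂) hK₁
    fun h k hh hk hne => ?_
  · refine 𝓐.isField.continuous_of_mk ?_
    have c1 : Continuous fun z : {h | 𝒢.r h = 𝒢.r g} × {h | 𝒢.r h = 𝒢.r g} => (z.1 : G) := by
      fun_prop
    have c2 : Continuous fun z : {h | 𝒢.r h = 𝒢.r g} × {h | 𝒢.r h = 𝒢.r g} => (z.2 : G) := by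
      fun_prop
    have c3 := TopGroupoid.continuous_mul (𝒢 := 𝒢) (𝒢.continuous_inv.comp c1)
      (continuous_const (y := g)) fun z => (𝒢.s_inv _).trans z.1.2
    have c4 := TopGroupoid.continuous_mul (𝒢 := 𝒢) (𝒢.continuous_inv.comp c2)
      c1 fun z => (𝒢.s_inv _).trans (z.2.2.trans z.1.2.symm)
    refine continuous_mulTo (continuous_mulTo (continuous_section f₁ c2)
      (continuous_section f₂ c4) (fun z => ?_) fun z => ?_) (continuous_section f₃ c3)
      (fun z => ?_) fun z => ?_
    · simp [𝒢.r_inv]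
    · exact mul_inv_mul (z.2.2.trans z.1.2.symm)
    · simp [𝒢.r_inv]
    · exact mul_inv_mul z.1.2
  · have hk1 : k ∈ K₁ := by
      by_contra h'
      exact hne (by simp [F, hf₁ _ h'])
    have hk2 : 𝒢.mul (𝒢.inv k) h ∈ K₂ := by
      by_contra h'
      exact hne (by simp [F, hf₂ _ h'])
    exact ⟨⟨k, hk1, _, hk2, by rw [r_mul, 𝒢.r_inv], mul_inv_mul (hk.trans hh.symm)⟩, hk1⟩

/-- The substitution h ↦ gh, which left invariance permits, matches the two integrands. -/
theorem involution_conv (f₁ f₂ : 𝓐.Cc) : 𝓐.involution (𝓐.conv H f₁ f₂) =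
    𝓐.conv H (𝓐.involution f₂) (𝓐.involution f₁) := by
  ext g
  have h1 := (𝓐.starToReal (𝒢.inv_inv g)).integral_comp_comm
      (integrable_convIntegrand H f₁ f₂ (𝒢.inv g))
  refine (involution_apply _ g).trans (h1.symm.trans ?_)
  rw [conv_apply, 𝒢.r_inv, ← H.integral_mul_left]
  refine integral_congr_ae ?_
  filter_upwards [H.ae_r (𝒢.s g)] with h hr
  have e1 : 𝒢.r h = 𝒢.r (𝒢.inv g) := hr.trans (𝒢.r_inv g).symm
  have e2 : 𝒢.mul (𝒢.inv (𝒢.mul g h)) g = 𝒢.inv h := by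
    rw [inv_mul_rev hr.symm, mul_mul (by rw [𝒢.s_inv, e1]) (𝒢.s_inv g), inv_mul,
      mul_unit (by rw [𝒢.s_inv, hr])]
  have e3 : 𝒢.inv (𝒢.mul (𝒢.inv h) (𝒢.inv g)) = 𝒢.mul g h := by
    rw [← inv_mul_rev hr.symm, 𝒢.inv_inv]
  rw [convIntegrand_eq _ _ e1, convIntegrand_eq _ _ (r_mul g h), e2]
  rw [involution_apply, involution_apply, 𝒢.inv_inv, inv_mul_rev hr.symm]
  exact starTo_mulTo (by rw [r_mul, 𝒢.r_inv]) (mul_inv_mul e1) (𝒢.inv_inv g) rfl e3 _ _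

end FellBundle

/-! ## Dominating upper semicontinuous functions by continuous ones -/

/-- A finite partition of unity on a compact set, subordinate to a neighbourhood assignment. -/
theorem exists_partition {X : Type*} [TopologicalSpace X] [T2Space X] [LocallyCompactSpace X]
    {K : Set X} (hK : IsCompact K) {U : X → Set X} (hU : ∀ x, IsOpen (U x))
    (hxU : ∀ x, x ∈ U x) : ∃ (t : Finset X) (χ : t → C(X, ℝ)),
      (∀ i, tsupport (χ i) ⊆ U i) ∧ (∀ i, HasCompactSupport (χ i)) ∧ (∀ i x, 0 ≤ χ i x) ∧
      (∀ x, ∑ i, χ i x ≤ 1) ∧ ∀ x ∈ K, ∑ i, χ i x = 1 := by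
  obtain ⟨t, -, ht⟩ := hK.elim_nhds_subcover U fun x _ => (hU x).mem_nhds (hxU x)
  obtain ⟨f, hf, hfc⟩ := PartitionOfUnity.exists_isSubordinate_of_locallyFinite_t2space hK
    (fun i : t => U i) (fun i => hU i) (locallyFinite_of_finite _)
    (by simpa [iUnion_subtype] using ht)
  refine ⟨t, f, hf, hfc, fun i x => f.nonneg i x, fun x => ?_, fun x hx => ?_⟩
  · simpa [finsum_eq_sum_of_fintype] using f.sum_le_one x
  · simpa [finsum_eq_sum_of_fintype] using f.sum_eq_one hx

/-- By the Vitali–Carathéodory theorem there is a lower semicontinuous g ≥ n with almost the same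
integral. Near each point x, n ≤ n(x) + η by upper semicontinuity and n(x) − η ≤ g by lower
semicontinuity. A partition of unity glues the constants n(x) + η to a continuous function between n
and g + 2η. -/
theorem exists_continuous_ge_of_upperSemicontinuous {X : Type*} [TopologicalSpace X] [T2Space X]
    [LocallyCompactSpace X] [MeasurableSpace X] [BorelSpace X] (μ : Measure X) [μ.Regular]
    {n : X → ℝ} (hn : UpperSemicontinuous n) (h0 : ∀ x, 0 ≤ n x) {K : Set X} (hK : IsCompact K)
    (hnK : ∀ x ∉ K, n x = 0) {ε : ℝ} (hε : 0 < ε) :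
    ∃ b : C(X, ℝ), HasCompactSupport b ∧ (∀ x, n x ≤ b x) ∧ ∫ x, b x ∂μ ≤ ∫ x, n x ∂μ + ε := by
  classical
  obtain ⟨ψ, hψ1, hψ0, hψle, hψc⟩ := exists_cutoff hK
  have hψi : Integrable ψ μ := ψ.continuous.integrable_of_hasCompactSupport hψc
  have hψnn : 0 ≤ ∫ x, ψ x ∂μ := integral_nonneg hψ0
  obtain ⟨c, hc⟩ := (hn.upperSemicontinuousOn K).bddAbove_of_isCompact hK
  have hni : Integrable n μ := by
    refine (hψi.const_mul (max c 0)).mono' hn.measurable.aestronglyMeasurable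
      (Eventually.of_forall fun x => ?_)
    rw [Real.norm_of_nonneg (h0 x)]
    by_cases hx : x ∈ K
    · simpa [hψ1 x hx] using Or.inl (hc ⟨x, hx, rfl⟩)
    · rw [hnK x hx]
      exact mul_nonneg (le_max_right _ _) (hψ0 x)
  -- This makes 2η∫ψ at most ε/2; the other half of ε is spent on `g`.
  set η : ℝ := ε / (4 * (∫ x, ψ x ∂μ + 1)) with hη
  have hη0 : 0 < η := by positivity
  obtain ⟨g, hng, hg, hgi⟩ := exists_le_lowerSemicontinuous_lintegral_ge μ
    (fun x => ENNReal.ofReal (n x)) hn.measurable.ennreal_ofReal (ε := ENNReal.ofReal (ε / 2))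
    (by simpa using hε)
  have hU : ∀ x, ∃ U : Set X, IsOpen U ∧ x ∈ U ∧ ∀ y ∈ U, n y ≤ n x + η ∧
      ENNReal.ofReal (n x - η) ≤ g y := by
    intro x
    have h1 : ∀ᶠ y in 𝓝 x, n y < n x + η := hn x _ (by linarith)
    have h2 : ∀ᶠ y in 𝓝 x, ENNReal.ofReal (n x - η) ≤ g y := by
      rcases (h0 x).eq_or_lt with hx | hx
      · refine Eventually.of_forall fun y => ?_
        rw [← hx, ENNReal.ofReal_of_nonpos (by linarith)]
        exact zero_le
      · refine (hg x _ (lt_of_lt_of_le ?_ (hng x))).mono fun y hy => le_of_lt hy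
        exact (ENNReal.ofReal_lt_ofReal_iff hx).2 (by linarith)
    obtain ⟨U, hU, hUo, hxU⟩ := eventually_nhds_iff.1 (h1.and h2)
    exact ⟨U, hUo, hxU, fun y hy => ⟨(hU y hy).1.le, (hU y hy).2⟩⟩
  choose U hUo hxU hU using hU
  obtain ⟨t, χ, hχU, -, hχ0, hχle, hχ1⟩ := exists_partition hK hUo hxU
  have hχU' : ∀ i x, χ i x ≠ 0 → x ∈ U i := fun i x h => hχU i (subset_tsupport _ h)
  let b : C(X, ℝ) := ψ * ∑ i : t, (n i + η) • χ i
  have hb : ∀ x, b x = ψ x * ∑ i : t, (n i + η) * χ i x := fun x => by simp [b]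
  have hbc : HasCompactSupport b := hψc.mul_right
  have hb0 : ∀ x, 0 ≤ b x := fun x => by
    rw [hb]
    refine mul_nonneg (hψ0 x) (Finset.sum_nonneg fun i _ => mul_nonneg ?_ (hχ0 i x))
    linarith [h0 i]
  refine ⟨b, hbc, fun x => ?_, ?_⟩
  · by_cases hx : x ∈ K
    · rw [hb, hψ1 x hx, one_mul]
      calc n x = ∑ i, n x * χ i x := by rw [← Finset.mul_sum, hχ1 x hx, mul_one]
        _ ≤ _ := by
          refine Finset.sum_le_sum fun i _ => ?_
          by_cases h : χ i x = 0
          · simp [h]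
          · exact mul_le_mul_of_nonneg_right (hU i x (hχU' i x h)).1 (hχ0 i x)
    · rw [hnK x hx]
      exact hb0 x
  · have hpt : ∀ x, ENNReal.ofReal (b x) ≤ g x + ENNReal.ofReal (2 * η * ψ x) := by
      intro x
      by_cases hgx : g x = ⊤
      · simp [hgx]
      rw [← ENNReal.ofReal_toReal hgx, ← ENNReal.ofReal_add ENNReal.toReal_nonneg
        (mul_nonneg (by linarith) (hψ0 x))]
      refine ENNReal.ofReal_le_ofReal ?_
      have hγ : 0 ≤ (g x).toReal := ENNReal.toReal_nonneg
      have h1 : ∑ i : t, (n i + η) * χ i x ≤ (g x).toReal + 2 * η := by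
        calc ∑ i : t, (n i + η) * χ i x ≤ ∑ i, ((g x).toReal + 2 * η) * χ i x := by
              refine Finset.sum_le_sum fun i _ => ?_
              by_cases h : χ i x = 0
              · simp [h]
              · refine mul_le_mul_of_nonneg_right ?_ (hχ0 i x)
                have := ENNReal.toReal_mono hgx (hU i x (hχU' i x h)).2
                have h3 : n i - η ≤ (ENNReal.ofReal (n i - η)).toReal := by
                  rw [ENNReal.toReal_ofReal']; exact le_max_left _ _
                linarith
          _ = ((g x).toReal + 2 * η) * ∑ i, χ i x := by rw [Finset.mul_sum]
          _ ≤ _ := mul_le_of_le_one_right (by positivity) (hχle x)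
      rw [hb]
      calc ψ x * ∑ i : t, (n i + η) * χ i x ≤ ψ x * ((g x).toReal + 2 * η) :=
            mul_le_mul_of_nonneg_left h1 (hψ0 x)
        _ = ψ x * (g x).toReal + 2 * η * ψ x := by ring
        _ ≤ _ := by
          gcongr
          exact mul_le_of_le_one_left hγ (hψle x)
    have hbi : Integrable b μ := b.continuous.integrable_of_hasCompactSupport hbc
    have hψη : Integrable (fun x => 2 * η * ψ x) μ := hψi.const_mul _
    have hψη0 : ∀ x, 0 ≤ 2 * η * ψ x := fun x => mul_nonneg (by linarith) (hψ0 x)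
    have h2 : ENNReal.ofReal (∫ x, b x ∂μ) ≤
        ENNReal.ofReal (∫ x, n x ∂μ + ε / 2 + ∫ x, 2 * η * ψ x ∂μ) := by
      rw [ofReal_integral_eq_lintegral_ofReal hbi (Eventually.of_forall hb0),
        ENNReal.ofReal_add (add_nonneg (integral_nonneg h0) (by linarith)) (integral_nonneg hψη0),
        ENNReal.ofReal_add (integral_nonneg h0) (by linarith),
        ofReal_integral_eq_lintegral_ofReal hni (Eventually.of_forall h0),
        ofReal_integral_eq_lintegral_ofReal hψη (Eventually.of_forall hψη0)]
      calc ∫⁻ x, ENNReal.ofReal (b x) ∂μ ≤ ∫⁻ x, (g x + ENNReal.ofReal (2 * η * ψ x)) ∂μ :=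
            lintegral_mono hpt
        _ = ∫⁻ x, g x ∂μ + ∫⁻ x, ENNReal.ofReal (2 * η * ψ x) ∂μ :=
            lintegral_add_left hg.measurable _
        _ ≤ _ := by gcongr
    have h3 : ∫ x, 2 * η * ψ x ∂μ ≤ ε / 2 := by
      rw [integral_const_mul]
      have h4 : η * (4 * (∫ x, ψ x ∂μ + 1)) = ε := div_mul_cancel₀ _ (by positivity)
      nlinarith
    have h4 := (ENNReal.ofReal_le_ofReal_iff (add_nonneg (add_nonneg (integral_nonneg h0)
      (by linarith)) (integral_nonneg hψη0))).1 h2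
    linarith

namespace TopGroupoid

variable {G₀ : Type u₀} {G : Type u} [TopologicalSpace G₀] [TopologicalSpace G]
  [LocallyCompactSpace G] [T2Space G] [MeasurableSpace G] [BorelSpace G]

/-- `unit` is a continuous section of r, so it embeds the unit space as a closed subset of G. -/
theorem locallyCompactSpace_units (𝒢 : TopGroupoid G₀ G) : LocallyCompactSpace G₀ :=
  (Function.LeftInverse.isClosedEmbedding (f := 𝒢.r) (g := 𝒢.unit) 𝒢.r_unit 𝒢.continuous_r
    𝒢.continuous_unit).locallyCompactSpace

end TopGroupoid

namespace HaarSystem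

variable {G₀ : Type u₀} {G : Type u} [TopologicalSpace G₀] [TopologicalSpace G]
  [LocallyCompactSpace G] [T2Space G] [MeasurableSpace G] [BorelSpace G]
  {𝒢 : TopGroupoid G₀ G} (H : HaarSystem 𝒢)

/-- A majorant that is good for α^x remains good for units near x, since its integral depends
continuously on the unit. Finitely many majorants are glued by a partition of unity on the unit
space pulled back along r. The weights are constant on range fibres, so the integrals combine
convexly. -/
theorem exists_continuous_ge {n : G → ℝ} (hn : UpperSemicontinuous n) (h0 : ∀ x, 0 ≤ n x)
    {K : Set G} (hK : IsCompact K) (hnK : ∀ x ∉ K, n x = 0) {M : ℝ} (hM : 0 ≤ M)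
    (hnM : ∀ x, ∫ g, n g ∂(H.meas x) ≤ M) {ε : ℝ} (hε : 0 < ε) :
    ∃ b : C(G, ℝ), HasCompactSupport b ∧ (∀ x, n x ≤ b x) ∧
      ∀ x, ∫ g, b g ∂(H.meas x) ≤ M + ε := by
  have := 𝒢.t2_units
  have := 𝒢.locallyCompactSpace_units
  choose b hbc hnb hbi using fun x => exists_continuous_ge_of_upperSemicontinuous (H.meas x) hn h0
    hK hnK (half_pos hε)
  obtain ⟨t, χ, hχU, -, hχ0, hχle, hχ1⟩ := exists_partition (hK.image 𝒢.continuous_r)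
    (U := fun x => {y | ∫ g, b x g ∂(H.meas y) < M + ε})
    (fun x => isOpen_lt (H.continuous_integral _ (b x).continuous (hbc x)) continuous_const)
    (fun x => by
      have := hbi x
      have := hnM x
      change _ < M + ε
      linarith)
  let b' : C(G, ℝ) := ∑ i, (χ i).comp ⟨𝒢.r, 𝒢.continuous_r⟩ * b i
  have hb' : ∀ g, b' g = ∑ i, χ i (𝒢.r g) * b i g := fun g => by simp [b']
  refine ⟨b', ?_, fun g => ?_, fun x => ?_⟩
  · refine HasCompactSupport.intro (K := ⋃ i : t, tsupport (b i))
      (isCompact_iUnion fun i => hbc i) fun g hg => ?_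
    rw [hb']
    refine Finset.sum_eq_zero fun i _ => ?_
    rw [image_eq_zero_of_notMem_tsupport fun h => hg (mem_iUnion.2 ⟨i, h⟩), mul_zero]
  · rw [hb']
    by_cases hg : g ∈ K
    · calc n g = ∑ i, χ i (𝒢.r g) * n g := by
            rw [← Finset.sum_mul, hχ1 _ ⟨g, hg, rfl⟩, one_mul]
        _ ≤ _ := Finset.sum_le_sum fun i _ =>
            mul_le_mul_of_nonneg_left (hnb i g) (hχ0 i _)
    · rw [hnK g hg]
      exact Finset.sum_nonneg fun i _ => mul_nonneg (hχ0 i _) ((h0 g).trans (hnb i g))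
  · have h1 : ∫ g, b' g ∂(H.meas x) = ∑ i, χ i x * ∫ g, b i g ∂(H.meas x) := by
      simp only [← integral_const_mul]
      rw [← integral_finsetSum Finset.univ (f := fun (i : t) g => χ i x * b i g) fun i _ =>
        (H.integrable_of_hasCompactSupport x (b i).continuous (hbc i)).const_mul _]
      refine integral_congr_ae ?_
      filter_upwards [H.ae_r x] with g hg
      rw [hb', hg]
    rw [h1]
    calc ∑ i, χ i x * ∫ g, b i g ∂(H.meas x) ≤ ∑ i, χ i x * (M + ε) := by
          refine Finset.sum_le_sum fun i _ => ?_
          by_cases h : χ i x = 0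
          · simp [h]
          · exact mul_le_mul_of_nonneg_left
              (le_of_lt (show x ∈ {y | ∫ g, b i g ∂(H.meas y) < M + ε} from
                hχU i (subset_tsupport _ h))) (hχ0 i x)
      _ = (∑ i, χ i x) * (M + ε) := by rw [Finset.sum_mul]
      _ ≤ M + ε := mul_le_of_le_one_left (by linarith) (hχle x)

end HaarSystem

/-! ## The supremum norm, the `I`-norm and the inductive limit topology -/

namespace FellBundle

open TopGroupoid

variable {G₀ : Type u₀} {G : Type u} [TopologicalSpace G₀] [TopologicalSpace G]
  {𝒢 : TopGroupoid G₀ G} {A : G → Type w} [∀ g, NormedAddCommGroup (A g)]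
  [∀ g, NormedSpace ℂ (A g)] [∀ g, CompleteSpace (A g)] [TopologicalSpace (TotalSp A)]
  {𝓐 : FellBundle 𝒢 A}

theorem upperSemicontinuous_norm (f : 𝓐.Cc) : UpperSemicontinuous fun g => ‖f.1 g‖ :=
  fun g y hy => f.2.1.tendsto g (𝓐.isField.usc_norm _ y hy)

theorem bddAbove_norm (f : 𝓐.Cc) : BddAbove (range fun g => ‖f.1 g‖) := by
  obtain ⟨K, hK, hf⟩ := exists_supportedIn f
  obtain ⟨c, hc⟩ := ((upperSemicontinuous_norm f).upperSemicontinuousOn K).bddAbove_of_isCompact hK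
  refine ⟨max c 0, ?_⟩
  rintro _ ⟨g, rfl⟩
  by_cases hg : g ∈ K
  · exact (hc ⟨g, hg, rfl⟩).trans (le_max_left _ _)
  · simp [hf g hg]

theorem norm_le_supNorm (f : 𝓐.Cc) (g : G) : ‖f.1 g‖ ≤ 𝓐.supNorm f :=
  le_ciSup (bddAbove_norm f) g

theorem supNorm_nonneg (f : 𝓐.Cc) : 0 ≤ 𝓐.supNorm f := Real.iSup_nonneg fun _ => norm_nonneg _

theorem supNorm_le {f : 𝓐.Cc} {c : ℝ} (hc : 0 ≤ c) (h : ∀ g, ‖f.1 g‖ ≤ c) : 𝓐.supNorm f ≤ c :=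
  Real.iSup_le h hc

theorem supNorm_zero : 𝓐.supNorm (0 : 𝓐.Cc) = 0 := by
  refine le_antisymm (supNorm_le le_rfl fun g => ?_) (supNorm_nonneg _)
  change ‖(0 : A g)‖ ≤ 0
  simp

theorem eq_zero_of_supNorm_le_zero {f : 𝓐.Cc} (h : 𝓐.supNorm f ≤ 0) : f = 0 := by
  ext g
  exact norm_le_zero_iff.1 ((norm_le_supNorm f g).trans h)

theorem supNorm_smul_le (c : ℂ) (f : 𝓐.Cc) : 𝓐.supNorm (c • f) ≤ ‖c‖ * 𝓐.supNorm f :=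
  supNorm_le (mul_nonneg (norm_nonneg _) (supNorm_nonneg _)) fun g => by
    change ‖c • f.1 g‖ ≤ _
    rw [norm_smul]
    exact mul_le_mul_of_nonneg_left (norm_le_supNorm f g) (norm_nonneg _)

theorem SupportedIn.mono {K L : Set G} (h : K ⊆ L) {f : 𝓐.Cc} (hf : 𝓐.SupportedIn K f) :
    𝓐.SupportedIn L f := fun g hg => hf g fun hk => hg (h hk)

theorem SupportedIn.smul {K : Set G} (c : ℂ) {f : 𝓐.Cc} (hf : 𝓐.SupportedIn K f) :
    𝓐.SupportedIn K (c • f) := fun g hg => by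
  change c • f.1 g = 0
  rw [hf g hg, smul_zero]

theorem norm_involution (f : 𝓐.Cc) (g : G) : ‖(𝓐.involution f).1 g‖ = ‖f.1 (𝒢.inv g)‖ := by
  rw [involution_apply, norm_starTo (𝒢.inv_inv g)]

/-- The topology is an infimum, so its neighbourhood filter at 0 is the infimum of those of the
competing topologies. Each of them contains the filter `l` of small sections supported in K, hence
so does the infimum. -/
theorem nhds_indLimTopology_ge (K : Set G) (hK : IsCompact K) {U : Set 𝓐.Cc}
    (hU : U ∈ @nhds 𝓐.Cc 𝓐.indLimTopology 0) :
    ∃ ε > 0, ∀ f : 𝓐.Cc, 𝓐.SupportedIn K f → 𝓐.supNorm f < ε → f ∈ U := by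
  let l : Filter 𝓐.Cc := comap 𝓐.supNorm (𝓝 0) ⊓ 𝓟 {f | 𝓐.SupportedIn K f}
  have hl : ∀ V, V ∈ l ↔
      ∃ ε > 0, ∀ f : 𝓐.Cc, 𝓐.SupportedIn K f → 𝓐.supNorm f < ε → f ∈ V := by
    intro V
    rw [((Metric.nhds_basis_ball.comap 𝓐.supNorm).inf_principal _).mem_iff]
    refine exists_congr fun ε => and_congr_right fun hε => ⟨fun h f hf hn => h ⟨?_, hf⟩,
      fun h f hf => h f hf.2 ?_⟩
    · simpa [Real.norm_of_nonneg (supNorm_nonneg f), abs_of_nonneg (supNorm_nonneg f)] using hn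
    · simpa [abs_of_nonneg (supNorm_nonneg f)] using hf.1
  have hle : l ≤ @nhds 𝓐.Cc 𝓐.indLimTopology 0 := by
    rw [indLimTopology, nhds_sInf]
    exact le_iInf₂ fun t ht V hV => (hl V).2 (ht.2.2.2 K hK V hV)
  exact (hl U).1 (hle hU)

/-- A linear map is continuous in the inductive limit topology if and only if it is bounded on the
sections supported in `K`, for each compact set `K`. -/
theorem continuous_indLim_iff {B : Type*} [NormedAddCommGroup B] [NormedSpace ℂ B]
    (φ : 𝓐.Cc →ₗ[ℂ] B) : Continuous[𝓐.indLimTopology, inferInstance] φ ↔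
      ∀ K : Set G, IsCompact K → ∃ C, ∀ f, 𝓐.SupportedIn K f → ‖φ f‖ ≤ C * 𝓐.supNorm f := by
  constructor
  · intro h K hK
    have h0 : φ ⁻¹' Metric.ball 0 1 ∈ @nhds 𝓐.Cc 𝓐.indLimTopology 0 := by
      refine (@Continuous.tendsto _ _ 𝓐.indLimTopology _ _ h 0) ?_
      rw [map_zero]
      exact Metric.ball_mem_nhds _ one_pos
    obtain ⟨ε, hε, hU⟩ := nhds_indLimTopology_ge K hK h0
    -- Rescaling f to supremum norm ε/2 puts it into the preimage of the unit ball.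
    refine ⟨2 / ε, fun f hf => ?_⟩
    rcases (supNorm_nonneg f).eq_or_lt with hs | hs
    · rw [eq_zero_of_supNorm_le_zero hs.symm.le, map_zero, norm_zero, supNorm_zero, mul_zero]
    · set c : ℝ := ε / (2 * 𝓐.supNorm f) with hc
      have hc0 : 0 < c := by positivity
      have hcs : c * 𝓐.supNorm f = ε / 2 := by rw [hc]; field_simp
      have h1 := hU ((c : ℂ) • f) (hf.smul _) ((supNorm_smul_le _ _).trans_lt (by
        rw [Complex.norm_real, Real.norm_of_nonneg hc0.le, hcs]
        linarith))
      rw [mem_preimage, map_smul, mem_ball_zero_iff, norm_smul, Complex.norm_real,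
        Real.norm_of_nonneg hc0.le] at h1
      have h2 : c * (2 / ε * 𝓐.supNorm f) = 1 := by
        rw [hc]
        field_simp
      exact le_of_mul_le_mul_left (h1.le.trans h2.symm.le) hc0
  · intro h
    rw [continuous_iff_le_induced]
    -- The topology induced by φ is itself one of the competitors in the infimum.
    refine sInf_le ⟨topologicalAddGroup_induced φ, continuousSMul_induced φ,
      LocallyConvexSpace.induced (φ.restrictScalars ℝ), fun K hK U hU => ?_⟩
    rw [nhds_induced, map_zero] at hU
    obtain ⟨V, hV, hVU⟩ := hU
    obtain ⟨ε, hε, hεV⟩ := Metric.mem_nhds_iff.1 hV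
    obtain ⟨C, hC⟩ := h K hK
    refine ⟨ε / (max C 0 + 1), by positivity, fun f hf hn => hVU (hεV ?_)⟩
    rw [mem_ball_zero_iff]
    rw [lt_div_iff₀ (by positivity)] at hn
    calc ‖φ f‖ ≤ C * 𝓐.supNorm f := hC f hf
      _ ≤ 𝓐.supNorm f * (max C 0 + 1) := by
        rw [mul_comm]
        refine mul_le_mul_of_nonneg_left ?_ (supNorm_nonneg f)
        linarith [le_max_left C 0]
      _ < ε := hn

variable [LocallyCompactSpace G] [T2Space G] [MeasurableSpace G] [BorelSpace G]
  {H : HaarSystem 𝒢}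

/-- The operator of convolution with `f` is bounded in the supremum norm. -/
theorem exists_supNorm_conv_le (H : HaarSystem 𝒢) (f : 𝓐.Cc) :
    ∃ C, 0 ≤ C ∧ ∀ f₂, 𝓐.supNorm (𝓐.conv H f f₂) ≤ C * 𝓐.supNorm f₂ := by
  obtain ⟨K, hK, hf⟩ := exists_supportedIn f
  obtain ⟨C, hC0, hC⟩ := H.exists_norm_integral_le.{u₀, u, w} hK
  refine ⟨C * 𝓐.supNorm f, mul_nonneg hC0 (supNorm_nonneg f), fun f₂ => ?_⟩
  have h0 := mul_nonneg (supNorm_nonneg f) (supNorm_nonneg f₂)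
  rw [_root_.mul_assoc]
  refine supNorm_le (mul_nonneg hC0 h0) fun g => ?_
  refine hC (A g) (𝒢.r g) _ _ (fun h hh _ => convIntegrand_eq_zero hf _ g hh) (fun h _ _ => ?_) h0
  exact (norm_convIntegrand_le _ _ _ _).trans (mul_le_mul (norm_le_supNorm _ _)
    (norm_le_supNorm _ _) (norm_nonneg _) (supNorm_nonneg _))

theorem exists_integral_norm_le (H : HaarSystem 𝒢) {K : Set G} (hK : IsCompact K) :
    ∃ C, 0 ≤ C ∧ ∀ f : 𝓐.Cc, 𝓐.SupportedIn K f → ∀ x,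
      ∫ g, ‖f.1 g‖ ∂(H.meas x) ≤ C * 𝓐.supNorm f := by
  obtain ⟨C, hC0, hC⟩ := H.exists_norm_integral_le hK
  refine ⟨C, hC0, fun f hf x => (le_abs_self _).trans (hC ℝ x _ _ (fun h hh _ => ?_)
    (fun h _ _ => ?_) (supNorm_nonneg f))⟩
  · rw [hf h hh, norm_zero]
  · simpa using norm_le_supNorm f h

theorem integral_norm_map_inv (H : HaarSystem 𝒢) (f : 𝓐.Cc) (x : G₀) :
    ∫ g, ‖f.1 g‖ ∂((H.meas x).map 𝒢.inv) = ∫ g, ‖(𝓐.involution f).1 g‖ ∂(H.meas x) := by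
  simp only [norm_involution]
  exact 𝒢.invHomeomorph.measurableEmbedding.integral_map _

theorem integral_norm_le_iNorm (H : HaarSystem 𝒢) (f : 𝓐.Cc) (x : G₀) :
    ∫ g, ‖f.1 g‖ ∂(H.meas x) ≤ 𝓐.iNorm H f := by
  obtain ⟨K, hK, hf⟩ := exists_supportedIn f
  obtain ⟨C, -, hC⟩ := exists_integral_norm_le (𝓐 := 𝓐) H hK
  refine le_trans (le_ciSup (f := fun x => ∫ g, ‖f.1 g‖ ∂(H.meas x)) ⟨C * 𝓐.supNorm f, ?_⟩ x)
    (le_max_left _ _)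
  rintro _ ⟨y, rfl⟩
  exact hC f hf y

theorem iNorm_involution (H : HaarSystem 𝒢) (f : 𝓐.Cc) :
    𝓐.iNorm H (𝓐.involution f) = 𝓐.iNorm H f := by
  simp only [iNorm, integral_norm_map_inv, involution_involution]
  exact max_comm _ _

theorem iNorm_nonneg (H : HaarSystem 𝒢) (f : 𝓐.Cc) : 0 ≤ 𝓐.iNorm H f :=
  le_max_of_le_left (Real.iSup_nonneg fun _ => integral_nonneg fun _ => norm_nonneg _)

theorem exists_iNorm_le (H : HaarSystem 𝒢) {K : Set G} (hK : IsCompact K) :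
    ∃ C, ∀ f : 𝓐.Cc, 𝓐.SupportedIn K f → 𝓐.iNorm H f ≤ C * 𝓐.supNorm f := by
  obtain ⟨C, hC0, hC⟩ := exists_integral_norm_le (𝓐 := 𝓐) H hK
  obtain ⟨C', hC0', hC'⟩ := exists_integral_norm_le (𝓐 := 𝓐) H (isCompact_inv (𝒢 := 𝒢) hK)
  refine ⟨max C C', fun f hf => max_le (Real.iSup_le (fun x => ?_) ?_)
    (Real.iSup_le (fun x => ?_) ?_)⟩
  · exact (hC f hf x).trans (mul_le_mul_of_nonneg_right (le_max_left _ _) (supNorm_nonneg f))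
  · exact mul_nonneg (le_max_of_le_left hC0) (supNorm_nonneg f)
  · rw [integral_norm_map_inv]
    refine (hC' _ (involution_supportedIn hf) x).trans (mul_le_mul (le_max_right _ _)
      (supNorm_le (supNorm_nonneg f) fun g => ?_) (supNorm_nonneg _) (le_max_of_le_left hC0))
    rw [norm_involution]
    exact norm_le_supNorm f _
  · exact mul_nonneg (le_max_of_le_left hC0) (supNorm_nonneg f)

theorem continuous_of_iNormBounded {B : Type*} [NormedAddCommGroup B] [NormedSpace ℂ B]
    {φ : 𝓐.Cc →ₗ[ℂ] B} (h : 𝓐.INormBounded H φ) :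
    Continuous[𝓐.indLimTopology, inferInstance] φ := by
  rw [continuous_indLim_iff]
  intro K hK
  obtain ⟨C, hC⟩ := h
  obtain ⟨C', hC'⟩ := exists_iNorm_le (𝓐 := 𝓐) H hK
  refine ⟨max C 0 * C', fun f hf => (hC f).trans ?_⟩
  rw [_root_.mul_assoc]
  exact mul_le_mul (le_max_left _ _) (hC' f hf) (iNorm_nonneg H f) (le_max_right _ _)

/-- The norm of a section is dominated by a continuous function with almost the same `I`-norm. -/
theorem exists_continuous_dominating (H : HaarSystem 𝒢) (u : 𝓐.Cc) {ε : ℝ} (hε : 0 < ε) :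
    ∃ b : C(G, ℝ), HasCompactSupport b ∧ (∀ g, ‖u.1 g‖ ≤ b g) ∧
      (∀ x, ∫ g, b g ∂(H.meas x) ≤ 𝓐.iNorm H u + ε) ∧
      ∀ x, ∫ g, b (𝒢.inv g) ∂(H.meas x) ≤ 𝓐.iNorm H u + ε := by
  have key : ∀ u : 𝓐.Cc, ∃ b : C(G, ℝ), HasCompactSupport b ∧ (∀ g, ‖u.1 g‖ ≤ b g) ∧
      ∀ x, ∫ g, b g ∂(H.meas x) ≤ 𝓐.iNorm H u + ε := fun u => by
    obtain ⟨K, hK, hf⟩ := exists_supportedIn u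
    exact H.exists_continuous_ge (upperSemicontinuous_norm u) (fun _ => norm_nonneg _) hK
      (fun g hg => by rw [hf g hg, norm_zero]) (iNorm_nonneg H u) (integral_norm_le_iNorm H u) hε
  obtain ⟨b, hbc, hb, hbi⟩ := key u
  obtain ⟨b', hbc', hb', hbi'⟩ := key (𝓐.involution u)
  rw [iNorm_involution] at hbi'
  have hb0 : ∀ g, 0 ≤ b g := fun g => (norm_nonneg _).trans (hb g)
  have hb0' : ∀ g, 0 ≤ b' g := fun g => (norm_nonneg _).trans (hb' g)
  -- One function controls both halves of the I-norm: b is good for α^x, and b' is good for the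
  -- involuted section. The minimum of b and b' ∘ inv still dominates ‖u‖.
  let b₀ : C(G, ℝ) := b ⊓ b'.comp ⟨𝒢.inv, 𝒢.continuous_inv⟩
  have hb₀ : ∀ g, b₀ g = min (b g) (b' (𝒢.inv g)) := fun g => rfl
  have hc : HasCompactSupport b₀ := HasCompactSupport.intro hbc fun g hg => by
    rw [hb₀, image_eq_zero_of_notMem_tsupport hg]
    exact min_eq_left (hb0' _)
  refine ⟨b₀, hc, fun g => le_min (hb g) ?_, fun x => ?_, fun x => ?_⟩
  · have := hb' (𝒢.inv g)
    rwa [norm_involution, 𝒢.inv_inv] at this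
  · refine (integral_mono (H.integrable_of_hasCompactSupport x b₀.continuous hc)
      (H.integrable_of_hasCompactSupport x b.continuous hbc) fun g => ?_).trans (hbi x)
    exact min_le_left _ _
  · refine (integral_mono (H.integrable_of_hasCompactSupport x
      (b₀.continuous.comp 𝒢.continuous_inv) (hc.comp_homeomorph 𝒢.invHomeomorph))
      (H.integrable_of_hasCompactSupport x b'.continuous hbc') fun g => ?_).trans (hbi' x)
    refine (min_le_right _ _).trans_eq ?_
    simp [𝒢.inv_inv]

end FellBundle

/-! ## Hilbert modules -/

namespace HilbertModule

variable {D : Type v} {F : Type v'} [NonUnitalCStarAlgebra D] [NormedAddCommGroup F]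
  [NormedSpace ℂ F] [CompleteSpace F] [HilbertModule D F]

theorem act_inner (x y : F) (d : D) : inner (act x d) y = star d * inner x y := by
  rw [← star_inner y, inner_act, star_mul, star_inner]

/-- The Cauchy–Schwarz inequality for finite families in a Hilbert module. -/
theorem norm_sum_inner_sq_le {κ : Type*} (s : Finset κ) (x y : κ → F) :
    ‖∑ i ∈ s, inner (D := D) (x i) (y i)‖ ^ 2 ≤
      ‖∑ i ∈ s, inner (D := D) (x i) (x i)‖ * ‖∑ i ∈ s, inner (D := D) (y i) (y i)‖ := by
  let _ := CStarAlgebra.spectralOrder D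
  have _ := CStarAlgebra.spectralOrderedRing D
  set X := ∑ i ∈ s, inner (D := D) (x i) (x i) with hX
  set Y := ∑ i ∈ s, inner (D := D) (y i) (y i) with hY
  set c := ∑ i ∈ s, inner (D := D) (x i) (y i) with hc
  have hXs : IsSelfAdjoint X := by
    rw [isSelfAdjoint_iff, hX, star_sum]
    exact Finset.sum_congr rfl fun i _ => star_inner _ _
  have hcs : star c = ∑ i ∈ s, inner (D := D) (y i) (x i) := by
    rw [hc, star_sum]
    exact Finset.sum_congr rfl fun i _ => star_inner _ _
  have key : ∀ ε > 0, ‖c‖ ^ 2 ≤ (‖X‖ + ε) * ‖Y‖ := by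
    intro ε hε
    have ht : 0 < ‖X‖ + ε := by positivity
    set t : ℝ := (‖X‖ + ε)⁻¹ with htdef
    have ht0 : 0 < t := inv_pos.2 ht
    -- Up to the regularisation ε, which covers the case X = 0, this choice makes the positive
    -- element ∑⟨x_i d − y_i, x_i d − y_i⟩ give the sharp inequality c^*c ≤ (‖X‖ + ε) Y.
    set d : D := t • c with hd
    have h1 : 0 ≤ star d * X * d - star d * c - star c * d + Y := by
      have h2 : star d * X * d - star d * c - star c * d + Y =
          ∑ i ∈ s, inner (act (x i) d - y i) (act (x i) d - y i) := by
        simp only [map_sub, LinearMap.sub_apply, act_inner, inner_act, Finset.sum_sub_distrib,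
          ← Finset.mul_sum, ← Finset.sum_mul, ← hX, ← hY, ← hc, hcs, _root_.mul_assoc]
        abel
      rw [h2]
      refine Finset.sum_nonneg fun i _ => ?_
      obtain ⟨e, he⟩ := inner_self_nonneg (D := D) (act (x i) d - y i)
      rw [he]
      exact star_mul_self_nonneg e
    -- Here c^*Xc ≤ ‖X‖ c^*c and t‖X‖ ≤ 1.
    have h3 : star d * X * d ≤ t • (star c * c) := by
      refine (CStarAlgebra.star_left_conjugate_le_norm_smul hXs).trans ?_
      have h4 : star d * d = (t * t) • (star c * c) := by
        rw [hd, star_smul, smul_mul_smul_comm]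
        simp
      rw [h4, smul_smul]
      refine smul_le_smul_of_nonneg_right ?_ (star_mul_self_nonneg c)
      have h5 : (‖X‖ + ε) * t = 1 := mul_inv_cancel₀ ht.ne'
      nlinarith [mul_pos ht0 ht0]
    have h6 : star d * c = t • (star c * c) := by
      rw [hd, star_smul, smul_mul_assoc]
      simp
    have h7 : star c * d = t • (star c * c) := by rw [hd, mul_smul_comm]
    have h8 : t • (star c * c) ≤ Y := by
      rw [h6, h7] at h1
      have h9 : (0 : D) ≤ t • (star c * c) - t • (star c * c) - t • (star c * c) + Y :=
        h1.trans (by gcongr)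
      rwa [sub_self, zero_sub, neg_add_eq_sub, sub_nonneg] at h9
    have h9 := CStarAlgebra.norm_le_norm_of_nonneg_of_le
      (smul_nonneg ht0.le (star_mul_self_nonneg c)) h8
    rw [norm_smul, CStarRing.norm_star_mul_self, Real.norm_of_nonneg ht0.le, ← sq] at h9
    rwa [htdef, inv_mul_le_iff₀ ht] at h9
  refine ge_of_tendsto (x := 𝓝[>] (0 : ℝ)) (f := fun ε => (‖X‖ + ε) * ‖Y‖) ?_
    (eventually_mem_nhdsWithin.mono key)
  have : Tendsto (fun ε => (‖X‖ + ε) * ‖Y‖) (𝓝 (0 : ℝ)) (𝓝 ((‖X‖ + 0) * ‖Y‖)) :=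
    Continuous.tendsto (by fun_prop) 0
  rw [add_zero] at this
  exact this.mono_left nhdsWithin_le_nhds

theorem norm_inner_le (x y : F) : ‖inner (D := D) x y‖ ≤ ‖x‖ * ‖y‖ := by
  have h := norm_sum_inner_sq_le (D := D) {()} (fun _ => x) (fun _ => y)
  simp only [Finset.sum_singleton, ← norm_sq, ← mul_pow] at h
  exact le_of_sq_le_sq h (by positivity)

variable (D) in
theorem continuous_inner_right (x : F) : Continuous fun y => inner (D := D) x y :=
  (LinearMap.mkContinuous (inner (D := D) x) ‖x‖ (norm_inner_le x)).continuous

variable (D) in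
theorem continuous_inner_left (y : F) : Continuous fun x => inner (D := D) x y := by
  have h : (fun x => inner (D := D) x y) = fun x => star (inner (D := D) y x) := by
    funext x
    rw [star_inner]
  rw [h]
  exact continuous_star.comp (continuous_inner_right D y)

/-- A vector that is orthogonal to a dense set vanishes. -/
theorem ext_of_dense {S : Set F} (hS : Dense S) {x y : F}
    (h : ∀ z ∈ S, inner (D := D) z x = inner (D := D) z y) : x = y := by
  have h1 : (fun z => inner (D := D) z x) = fun z => inner (D := D) z y :=
    (continuous_inner_left D x).ext_on hS (continuous_inner_left D y) h
  have h2 : inner (D := D) (x - y) (x - y) = 0 := by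
    rw [map_sub (inner (D := D) (x - y)), sub_eq_zero]
    exact congrFun h1 (x - y)
  have h3 := norm_sq (D := D) (x - y)
  rw [h2, norm_zero, sq_eq_zero_iff, norm_eq_zero, sub_eq_zero] at h3
  exact h3

/-- A `C^*`-algebra as a Hilbert module over itself. -/
@[reducible]
def self (D : Type v) [NonUnitalCStarAlgebra D] : HilbertModule D D where
  act := LinearMap.mul ℂ D
  inner := LinearMap.mk₂'ₛₗ (starRingEnd ℂ) (RingHom.id ℂ) (fun x y => star x * y)
    (fun x y z => by rw [star_add, add_mul]) (fun c x y => by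
      rw [star_smul, smul_mul_assoc]
      rfl)
    (fun x y z => by rw [mul_add]) (fun c x y => by
      rw [mul_smul_comm]
      rfl)
  act_mul x d e := by simp [_root_.mul_assoc]
  inner_act x y d := by simp [_root_.mul_assoc]
  star_inner x y := by simp
  inner_self_nonneg x := ⟨x, rfl⟩
  norm_sq x := by
    rw [sq]
    exact CStarRing.norm_star_mul_self.symm

end HilbertModule

/-- The ratios of a log-convex sequence do not decrease. If the first ratio ρ exceeded c, then q_n ≥
ρⁿ q_0 would outgrow √B cⁿ. If q_0 = 0, then log-convexity gives q_1 = 0. -/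
theorem le_mul_of_sq_le_mul {q : ℕ → ℝ} (h0 : ∀ n, 0 ≤ q n)
    (hq : ∀ n, q (n + 1) ^ 2 ≤ q n * q (n + 2)) {B c : ℝ} (hc : 0 ≤ c)
    (hB : ∀ n, q n ^ 2 ≤ B * c ^ (2 * n)) : q 1 ≤ c * q 0 := by
  by_contra! hlt
  rcases (h0 0).eq_or_lt with h | h
  · have := hq 0
    rw [← h, zero_mul] at this
    rw [← h, mul_zero] at hlt
    simp only [zero_add] at this
    nlinarith
  set ρ := q 1 / q 0 with hρ
  have hcρ : c < ρ := (lt_div_iff₀ h).2 hlt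
  have hρ0 : 0 < ρ := hc.trans_lt hcρ
  have hstep : ∀ n, 0 < q n ∧ ρ * q n ≤ q (n + 1) := by
    intro n
    induction n with
    | zero => exact ⟨h, (div_mul_cancel₀ _ h.ne').le⟩
    | succ n ih =>
      have h1 : 0 < q (n + 1) := (mul_pos hρ0 ih.1).trans_le ih.2
      refine ⟨h1, le_of_mul_le_mul_left ?_ ih.1⟩
      calc q n * (ρ * q (n + 1)) = (ρ * q n) * q (n + 1) := by ring
        _ ≤ q (n + 1) * q (n + 1) := mul_le_mul_of_nonneg_right ih.2 h1.le
        _ = q (n + 1) ^ 2 := by ring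
        _ ≤ q n * q (n + 1 + 1) := hq n
  have hpow : ∀ n, ρ ^ n * q 0 ≤ q n := by
    intro n
    induction n with
    | zero => simp
    | succ n ih =>
      calc ρ ^ (n + 1) * q 0 = ρ * (ρ ^ n * q 0) := by ring
        _ ≤ ρ * q n := mul_le_mul_of_nonneg_left ih hρ0.le
        _ ≤ q (n + 1) := (hstep n).2
  have hfin : ∀ n, q 0 ^ 2 ≤ B * ((c / ρ) ^ 2) ^ n := by
    intro n
    have h1 : (ρ ^ n * q 0) ^ 2 ≤ B * c ^ (2 * n) :=
      (pow_le_pow_left₀ (by positivity) (hpow n) 2).trans (hB n)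
    have h2 : ((c / ρ) ^ 2) ^ n = c ^ (2 * n) / ρ ^ (2 * n) := by rw [← pow_mul, div_pow]
    rw [h2, ← mul_div_assoc, le_div_iff₀ (by positivity)]
    calc q 0 ^ 2 * ρ ^ (2 * n) = (ρ ^ n * q 0) ^ 2 := by ring
      _ ≤ _ := h1
  have hr : (c / ρ) ^ 2 < 1 := by
    rw [sq_lt_one_iff₀ (by positivity)]
    exact (div_lt_one hρ0).2 hcρ
  have hlim : Tendsto (fun n => B * ((c / ρ) ^ 2) ^ n) atTop (𝓝 (B * 0)) :=
    (tendsto_pow_atTop_nhds_zero_of_lt_one (by positivity) hr).const_mul B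
  have := ge_of_tendsto' hlim hfin
  rw [mul_zero] at this
  have := sq_pos_of_pos h
  linarith

/-! ## Boundedness of operators on the range of a pre-representation -/

namespace FellBundle

open TopGroupoid TensorProduct

variable {G₀ : Type u₀} {G : Type u} [TopologicalSpace G₀] [TopologicalSpace G]
  [LocallyCompactSpace G] [T2Space G] [MeasurableSpace G] [BorelSpace G]
  {𝒢 : TopGroupoid G₀ G} {A : G → Type w} [∀ g, NormedAddCommGroup (A g)]
  [∀ g, NormedSpace ℂ (A g)] [∀ g, CompleteSpace (A g)] [TopologicalSpace (TotalSp A)]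
  (𝓐 : FellBundle 𝒢 A) (H : HaarSystem 𝒢)

/-- The operators `T` and `T'` are adjoint for the convolution product `(f₁, f₂) ↦ f₁^* * f₂`. -/
def IsAdjointPair (T T' : 𝓐.Cc →ₗ[ℂ] 𝓐.Cc) : Prop :=
  ∀ f₁ f₂, 𝓐.conv H (𝓐.involution (T f₁)) f₂ = 𝓐.conv H (𝓐.involution f₁) (T' f₂)

/-- The operator `T` does not increase norms in the fibres by a factor of more than `c`. -/
def IsFibrewiseBounded (T : 𝓐.Cc →ₗ[ℂ] 𝓐.Cc) (c : ℝ) : Prop :=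
  ∀ (f : 𝓐.Cc) g, ‖(T f).1 g‖ ≤ c * ‖f.1 g‖

variable (D : Type v) {F : Type v'} [NonUnitalCStarAlgebra D] [NormedAddCommGroup F]
  [NormedSpace ℂ F] [CompleteSpace F] [HilbertModule D F]
  {F₀ : Type v''} [AddCommGroup F₀] [Module ℂ F₀]

/-- The algebraic properties of a pre-representation, without the density conditions. -/
structure IsPreRep (ι : F₀ →ₗ[ℂ] F) (L : 𝓐.Cc →ₗ[ℂ] F₀ →ₗ[ℂ] F) : Prop where
  bounded : ∀ (ξ η : F₀) (K : Set G), IsCompact K → ∃ C : ℝ, ∀ f, 𝓐.SupportedIn K f →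
    ‖HilbertModule.inner (D := D) (ι ξ) (L f η)‖ ≤ C * 𝓐.supNorm f
  inner_L : ∀ (ξ η : F₀) (f₁ f₂ : 𝓐.Cc), HilbertModule.inner (D := D) (L f₁ ξ) (L f₂ η) =
    HilbertModule.inner (ι ξ) (L (𝓐.conv H (𝓐.involution f₁) f₂) η)

variable {𝓐 H D} {T T' : 𝓐.Cc →ₗ[ℂ] 𝓐.Cc}

theorem IsFibrewiseBounded.pow {c : ℝ} (hc : 0 ≤ c) (hT : 𝓐.IsFibrewiseBounded T c) (n : ℕ) :
    𝓐.IsFibrewiseBounded (T ^ n) (c ^ n) := by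
  induction n with
  | zero => intro f g; simp
  | succ n ih =>
    intro f g
    rw [pow_succ']
    refine (hT _ g).trans ?_
    rw [pow_succ', _root_.mul_assoc]
    exact mul_le_mul_of_nonneg_left (ih f g) hc

theorem IsFibrewiseBounded.supportedIn {c : ℝ} (hT : 𝓐.IsFibrewiseBounded T c) {K : Set G}
    {f : 𝓐.Cc} (hf : 𝓐.SupportedIn K f) : 𝓐.SupportedIn K (T f) := fun g hg => by
  have := hT f g
  rwa [hf g hg, norm_zero, mul_zero, norm_le_zero_iff] at this

theorem IsFibrewiseBounded.supNorm_le {c : ℝ} (hc : 0 ≤ c) (hT : 𝓐.IsFibrewiseBounded T c)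
    (f : 𝓐.Cc) : 𝓐.supNorm (T f) ≤ c * 𝓐.supNorm f :=
  FellBundle.supNorm_le (mul_nonneg hc (supNorm_nonneg f)) fun g =>
    (hT f g).trans (mul_le_mul_of_nonneg_left (norm_le_supNorm f g) hc)

theorem IsAdjointPair.pow (hT : 𝓐.IsAdjointPair H T T) (n : ℕ) :
    𝓐.IsAdjointPair H (T ^ n) (T ^ n) := by
  induction n with
  | zero => intro f₁ f₂; rfl
  | succ n ih =>
    intro f₁ f₂
    rw [pow_succ']
    refine (hT _ _).trans ((ih _ _).trans ?_)
    rw [← Module.End.mul_apply, ← pow_succ, ← pow_succ']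

theorem isAdjointPair_convL (u : 𝓐.Cc) :
    𝓐.IsAdjointPair H (𝓐.convL H u) (𝓐.convL H (𝓐.involution u)) := fun f₁ f₂ => by
  rw [convL_apply, convL_apply, involution_conv, conv_assoc]

variable {ι : F₀ →ₗ[ℂ] F} {L : 𝓐.Cc →ₗ[ℂ] F₀ →ₗ[ℂ] F}

/-- On elementary tensors both sides equal ⟨ι(ξ), L(k)η⟩ by condition (2), where k is the common
value of the two convolutions in the adjoint relation. Working on the tensor product avoids the
question whether T descends to the range of Λ. -/
theorem IsPreRep.inner_rTensor (hL : 𝓐.IsPreRep H D ι L) (hT : 𝓐.IsAdjointPair H T T')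
    (x y : 𝓐.Cc ⊗[ℂ] F₀) :
    HilbertModule.inner (D := D) (TensorProduct.lift L (T.rTensor F₀ x))
      (TensorProduct.lift L y) =
    HilbertModule.inner (TensorProduct.lift L x) (TensorProduct.lift L (T'.rTensor F₀ y)) := by
  induction x using TensorProduct.induction_on with
  | zero => simp
  | add x₁ x₂ h₁ h₂ => simp only [map_add, LinearMap.add_apply, h₁, h₂]
  | tmul f ξ =>
    induction y using TensorProduct.induction_on with
    | zero => simp
    | add y₁ y₂ h₁ h₂ => simp only [map_add, h₁, h₂]
    | tmul f₂ η =>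
      simp only [LinearMap.rTensor_tmul, TensorProduct.lift.tmul]
      rw [hL.inner_L, hL.inner_L, hT]

/-- Matrix coefficients are controlled by the supremum norms of finitely many sections. -/
theorem IsPreRep.exists_bound (hL : 𝓐.IsPreRep H D ι L) (x : 𝓐.Cc ⊗[ℂ] F₀) :
    ∃ S : Set 𝓐.Cc, S.Finite ∧ ∀ (y : 𝓐.Cc ⊗[ℂ] F₀) (K : Set G), IsCompact K →
      ∃ C, 0 ≤ C ∧ ∀ (T : 𝓐.Cc →ₗ[ℂ] 𝓐.Cc) (c : ℝ),
        (∀ f ∈ S, 𝓐.SupportedIn K (T f) ∧ 𝓐.supNorm (T f) ≤ c) → 0 ≤ c →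
        ‖HilbertModule.inner (D := D) (TensorProduct.lift L y)
          (TensorProduct.lift L (T.rTensor F₀ x))‖ ≤ C * c := by
  induction x using TensorProduct.induction_on with
  | zero => exact ⟨∅, finite_empty, fun y K _ => ⟨0, le_rfl, fun T c _ _ => by simp⟩⟩
  | add x₁ x₂ h₁ h₂ =>
    obtain ⟨S₁, hS₁, h₁⟩ := h₁
    obtain ⟨S₂, hS₂, h₂⟩ := h₂
    refine ⟨S₁ ∪ S₂, hS₁.union hS₂, fun y K hK => ?_⟩
    obtain ⟨C₁, hC₁, h₁⟩ := h₁ y K hK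
    obtain ⟨C₂, hC₂, h₂⟩ := h₂ y K hK
    refine ⟨C₁ + C₂, add_nonneg hC₁ hC₂, fun T c hT hc => ?_⟩
    simp only [map_add]
    rw [add_mul]
    exact (norm_add_le _ _).trans (add_le_add (h₁ T c (fun f hf => hT f (Or.inl hf)) hc)
      (h₂ T c (fun f hf => hT f (Or.inr hf)) hc))
  | tmul f ξ =>
    refine ⟨{f}, finite_singleton f, fun y K hK => ?_⟩
    induction y using TensorProduct.induction_on with
    | zero => exact ⟨0, le_rfl, fun T c _ _ => by simp⟩
    | add y₁ y₂ h₁ h₂ =>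
      obtain ⟨C₁, hC₁, h₁⟩ := h₁
      obtain ⟨C₂, hC₂, h₂⟩ := h₂
      refine ⟨C₁ + C₂, add_nonneg hC₁ hC₂, fun T c hT hc => ?_⟩
      simp only [map_add, LinearMap.add_apply]
      rw [add_mul]
      exact (norm_add_le _ _).trans (add_le_add (h₁ T c hT hc) (h₂ T c hT hc))
    | tmul f₁ η =>
      -- The coefficient is ⟨ι(η), L(f₁^* * Tf)ξ⟩, and f₁^* * Tf is supported in the fixed compact
      -- set K₁K with supremum norm controlled by that of Tf, so condition (1) applies.
      obtain ⟨K₁, hK₁, hf₁⟩ := exists_supportedIn (𝓐.involution f₁)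
      obtain ⟨C₁, hC₁⟩ := hL.bounded η ξ (𝒢.mulSet K₁ K) (isCompact_mulSet hK₁ hK)
      obtain ⟨C₂, hC₂, h₂⟩ := exists_supNorm_conv_le H (𝓐.involution f₁)
      refine ⟨max C₁ 0 * C₂, mul_nonneg (le_max_right _ _) hC₂, fun T c hT hc => ?_⟩
      obtain ⟨hTK, hTc⟩ := hT f rfl
      simp only [LinearMap.rTensor_tmul, TensorProduct.lift.tmul]
      rw [hL.inner_L]
      refine (hC₁ _ (conv_supportedIn hf₁ hTK)).trans ?_
      rw [_root_.mul_assoc]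
      refine mul_le_mul (le_max_left _ _) ((h₂ _).trans (mul_le_mul_of_nonneg_left hTc hC₂))
        (supNorm_nonneg _) (le_max_right _ _)

/-- A symmetric operator that is bounded on the fibres is bounded with the same norm. -/
theorem IsPreRep.norm_rTensor_le (hL : 𝓐.IsPreRep H D ι L) (hT : 𝓐.IsAdjointPair H T T) {c : ℝ}
    (hc : 0 ≤ c) (hTc : 𝓐.IsFibrewiseBounded T c) (x : 𝓐.Cc ⊗[ℂ] F₀) :
    ‖TensorProduct.lift L (T.rTensor F₀ x)‖ ≤ c * ‖TensorProduct.lift L x‖ := by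
  obtain ⟨S, hS, hx⟩ := hL.exists_bound x
  choose K hK hfK using fun f : 𝓐.Cc => exists_supportedIn f
  obtain ⟨C, hC, hx⟩ := hx x (⋃ f ∈ S, K f) (hS.isCompact_biUnion fun f _ => hK f)
  obtain ⟨m, hm⟩ := (hS.image 𝓐.supNorm).bddAbove
  have hpow' : ∀ k n, (T ^ k).rTensor F₀ ((T ^ n).rTensor F₀ x) = (T ^ (k + n)).rTensor F₀ x :=
    fun k n => by
      rw [pow_add, Module.End.mul_eq_comp, LinearMap.rTensor_comp, LinearMap.comp_apply]
  have hpow : ∀ n, T.rTensor F₀ ((T ^ n).rTensor F₀ x) = (T ^ (n + 1)).rTensor F₀ x := fun n => by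
    rw [add_comm, ← hpow', pow_one]
  -- Log-convexity is Cauchy–Schwarz for ‖Λ(Tⁿ⁺¹x)‖² = ‖⟨Λ(Tⁿx), Λ(Tⁿ⁺²x)⟩‖.
  have h := le_mul_of_sq_le_mul (q := fun n => ‖TensorProduct.lift L ((T ^ n).rTensor F₀ x)‖)
    (fun n => norm_nonneg _) (fun n => ?_) (B := C * max m 0) hc fun n => ?_
  · simpa [Module.End.one_eq_id] using h
  · rw [HilbertModule.norm_sq (D := D)]
    refine le_trans (le_of_eq ?_) (HilbertModule.norm_inner_le (D := D) _ _)
    rw [← hpow n, hL.inner_rTensor hT, hpow n, hpow (n + 1)]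
  -- The square is the norm of ⟨Λ(x), Λ(T²ⁿx)⟩, and T²ⁿ preserves supports and multiplies supremum
  -- norms by at most c²ⁿ.
  · rw [HilbertModule.norm_sq (D := D), hL.inner_rTensor (hT.pow n), hpow', ← two_mul]
    have hb := hTc.pow hc (2 * n)
    rw [_root_.mul_assoc, mul_comm (max m 0)]
    refine hx _ _ (fun f hf => ⟨hb.supportedIn ((hfK f).mono ?_), (hb.supNorm_le
      (pow_nonneg hc _) f).trans ?_⟩) (mul_nonneg (pow_nonneg hc _) (le_max_right _ _))
    · exact subset_biUnion_of_mem (u := fun f => K f) hf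
    · exact mul_le_mul_of_nonneg_left ((hm ⟨f, hf, rfl⟩).trans (le_max_left _ _))
        (pow_nonneg hc _)

variable (𝓐 H) in
/-- Approximate factorisations `∑ P i * Q i` of an operator `T`, such that the operators `∑ P i ^ 2`
and `∑ (Q i)^* Q i` are approximately fibrewise bounded by `M`. -/
def HasFactorisations (T : 𝓐.Cc →ₗ[ℂ] 𝓐.Cc) (M : ℝ) : Prop :=
  ∀ S : Set 𝓐.Cc, S.Finite → ∃ K : Set G, IsCompact K ∧ ∀ ε > 0,
    ∃ (κ : Type u) (s : Finset κ) (P Q Q' : κ → 𝓐.Cc →ₗ[ℂ] 𝓐.Cc) (R : 𝓐.Cc →ₗ[ℂ] 𝓐.Cc),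
      (∀ i, 𝓐.IsAdjointPair H (P i) (P i)) ∧ (∀ i, 𝓐.IsAdjointPair H (Q i) (Q' i)) ∧
      𝓐.IsAdjointPair H R R ∧
      𝓐.IsFibrewiseBounded (∑ i ∈ s, P i ∘ₗ P i) M ∧ 𝓐.IsFibrewiseBounded R M ∧
      (∀ f ∈ S, 𝓐.SupportedIn K ((T - ∑ i ∈ s, P i ∘ₗ Q i) f) ∧
        𝓐.supNorm ((T - ∑ i ∈ s, P i ∘ₗ Q i) f) ≤ ε) ∧
      (∀ f ∈ S, 𝓐.SupportedIn K ((∑ i ∈ s, Q' i ∘ₗ Q i - R) f) ∧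
        𝓐.supNorm ((∑ i ∈ s, Q' i ∘ₗ Q i - R) f) ≤ ε)

theorem rTensor_sum {κ : Type*} (s : Finset κ) (P : κ → 𝓐.Cc →ₗ[ℂ] 𝓐.Cc) (x : 𝓐.Cc ⊗[ℂ] F₀) :
    (∑ i ∈ s, P i).rTensor F₀ x = ∑ i ∈ s, (P i).rTensor F₀ x := by
  rw [← LinearMap.coe_rTensorHom, map_sum, LinearMap.sum_apply]

theorem rTensor_sub_apply (P Q : 𝓐.Cc →ₗ[ℂ] 𝓐.Cc) (x : 𝓐.Cc ⊗[ℂ] F₀) :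
    (P - Q).rTensor F₀ x = P.rTensor F₀ x - Q.rTensor F₀ x := by
  rw [LinearMap.rTensor_sub]
  rfl

theorem isAdjointPair_sum {κ : Type*} (s : Finset κ) {P P' : κ → 𝓐.Cc →ₗ[ℂ] 𝓐.Cc}
    (h : ∀ i, 𝓐.IsAdjointPair H (P i) (P' i)) :
    𝓐.IsAdjointPair H (∑ i ∈ s, P i) (∑ i ∈ s, P' i) := by
  classical
  intro f₁ f₂
  induction s using Finset.induction_on with
  | empty =>
    simp only [Finset.sum_empty, LinearMap.zero_apply, ← convL_apply]
    have : 𝓐.involution (0 : 𝓐.Cc) = 0 := by simpa using involution_smul 0 (0 : 𝓐.Cc)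
    rw [this, map_zero, map_zero, LinearMap.zero_apply]
  | insert i s hi ih =>
    simp only [Finset.sum_insert hi, LinearMap.add_apply, involution_add, ← convL_apply, map_add]
    simp only [convL_apply, ih]
    rw [h i]

theorem IsAdjointPair.comp {T₁ T₁' : 𝓐.Cc →ₗ[ℂ] 𝓐.Cc} (hT : 𝓐.IsAdjointPair H T T')
    (hT₁ : 𝓐.IsAdjointPair H T₁ T₁') : 𝓐.IsAdjointPair H (T ∘ₗ T₁) (T₁' ∘ₗ T') := fun f₁ f₂ => by
  rw [LinearMap.comp_apply, hT, hT₁, LinearMap.comp_apply]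

/-- For y = Tx, ‖Λ(y)‖² is up to O(ε) the norm of ∑⟨Λ(P_i y), Λ(Q_i x)⟩. By Cauchy–Schwarz this is
at most the geometric mean of the norms of ⟨Λ(y), Λ(∑P_i²y)⟩ and ⟨Λ(x), Λ(∑Q_i^*Q_i x)⟩. These are
at most M‖Λ(y)‖² and M‖Λ(x)‖² + O(ε) because ∑P_i² and R are symmetric and fibrewise bounded. Let ε
→ 0 and divide by ‖Λ(y)‖. -/
theorem IsPreRep.norm_le_of_hasFactorisations (hL : 𝓐.IsPreRep H D ι L) {M : ℝ} (hM : 0 ≤ M)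
    (hT : 𝓐.HasFactorisations H T M) (x : 𝓐.Cc ⊗[ℂ] F₀) :
    ‖TensorProduct.lift L (T.rTensor F₀ x)‖ ≤ M * ‖TensorProduct.lift L x‖ := by
  set Λ := TensorProduct.lift L with hΛ
  set y := T.rTensor F₀ x with hy
  -- S depends only on x, and K only on T and S. Hence C₁ and C₂ are fixed before ε is chosen.
  obtain ⟨S, hS, hx⟩ := hL.exists_bound x
  obtain ⟨K, hK, hT⟩ := hT S hS
  obtain ⟨C₁, hC₁, h₁⟩ := hx y K hK
  obtain ⟨C₂, hC₂, h₂⟩ := hx x K hK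
  set a := ‖Λ y‖
  set b := ‖Λ x‖
  have key : ∀ ε > 0, a ^ 2 ≤ Real.sqrt (M * a ^ 2) * Real.sqrt (M * b ^ 2 + C₂ * ε) + C₁ * ε := by
    intro ε hε
    obtain ⟨κ, s, P, Q, Q', R, hP, hQ, hR, hPM, hRM, hPQ, hQQ⟩ := hT ε hε
    have e1 := h₁ _ _ hPQ hε.le
    have e2 := h₂ _ _ hQQ hε.le
    rw [rTensor_sub_apply, map_sub, map_sub] at e1 e2
    rw [← hΛ, ← hy] at e1
    rw [← hΛ] at e2
    have hsum : HilbertModule.inner (D := D) (Λ y) (Λ ((∑ i ∈ s, P i ∘ₗ Q i).rTensor F₀ x)) =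
        ∑ i ∈ s, HilbertModule.inner (D := D) (Λ ((P i).rTensor F₀ y))
          (Λ ((Q i).rTensor F₀ x)) := by
      rw [rTensor_sum, map_sum, map_sum]
      refine Finset.sum_congr rfl fun i _ => ?_
      rw [hL.inner_rTensor (hP i), LinearMap.rTensor_comp, LinearMap.comp_apply]
    have hPP : ∑ i ∈ s, HilbertModule.inner (D := D) (Λ ((P i).rTensor F₀ y))
          (Λ ((P i).rTensor F₀ y)) =
        HilbertModule.inner (D := D) (Λ y) (Λ ((∑ i ∈ s, P i ∘ₗ P i).rTensor F₀ y)) := by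
      rw [rTensor_sum, map_sum, map_sum]
      refine Finset.sum_congr rfl fun i _ => ?_
      rw [hL.inner_rTensor (hP i), LinearMap.rTensor_comp, LinearMap.comp_apply]
    have hQQ' : ∑ i ∈ s, HilbertModule.inner (D := D) (Λ ((Q i).rTensor F₀ x))
          (Λ ((Q i).rTensor F₀ x)) =
        HilbertModule.inner (D := D) (Λ x) (Λ ((∑ i ∈ s, Q' i ∘ₗ Q i).rTensor F₀ x)) := by
      rw [rTensor_sum, map_sum, map_sum]
      refine Finset.sum_congr rfl fun i _ => ?_
      rw [hL.inner_rTensor (hQ i), LinearMap.rTensor_comp, LinearMap.comp_apply]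
    have hcs := HilbertModule.norm_sum_inner_sq_le (D := D) s (fun i => Λ ((P i).rTensor F₀ y))
      fun i => Λ ((Q i).rTensor F₀ x)
    rw [hPP, hQQ', ← hsum] at hcs
    have b1 : ‖HilbertModule.inner (D := D) (Λ y)
        (Λ ((∑ i ∈ s, P i ∘ₗ P i).rTensor F₀ y))‖ ≤ M * a ^ 2 := by
      refine (HilbertModule.norm_inner_le (D := D) _ _).trans ?_
      calc a * _ ≤ a * (M * a) := mul_le_mul_of_nonneg_left (hL.norm_rTensor_le
            (isAdjointPair_sum s fun i => (hP i).comp (hP i)) hM hPM y) (norm_nonneg _)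
        _ = M * a ^ 2 := by ring
    have b2 : ‖HilbertModule.inner (D := D) (Λ x)
        (Λ ((∑ i ∈ s, Q' i ∘ₗ Q i).rTensor F₀ x))‖ ≤ M * b ^ 2 + C₂ * ε := by
      have b3 : ‖HilbertModule.inner (D := D) (Λ x) (Λ (R.rTensor F₀ x))‖ ≤ M * b ^ 2 := by
        refine (HilbertModule.norm_inner_le (D := D) _ _).trans ?_
        calc b * _ ≤ b * (M * b) := mul_le_mul_of_nonneg_left (hL.norm_rTensor_le hR hM hRM x)
              (norm_nonneg _)
          _ = M * b ^ 2 := by ring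
      have := norm_le_norm_add_norm_sub' (HilbertModule.inner (D := D) (Λ x)
        (Λ ((∑ i ∈ s, Q' i ∘ₗ Q i).rTensor F₀ x)))
        (HilbertModule.inner (D := D) (Λ x) (Λ (R.rTensor F₀ x)))
      linarith
    have b4 : ‖HilbertModule.inner (D := D) (Λ y)
        (Λ ((∑ i ∈ s, P i ∘ₗ Q i).rTensor F₀ x))‖ ≤
        Real.sqrt (M * a ^ 2) * Real.sqrt (M * b ^ 2 + C₂ * ε) := by
      rw [← Real.sqrt_mul (by positivity)]
      exact Real.le_sqrt_of_sq_le (hcs.trans (mul_le_mul b1 b2 (norm_nonneg _) (by positivity)))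
    have b5 : ‖HilbertModule.inner (D := D) (Λ y) (Λ y)‖ = a ^ 2 :=
      (HilbertModule.norm_sq (D := D) _).symm
    have := norm_le_norm_add_norm_sub' (HilbertModule.inner (D := D) (Λ y) (Λ y))
      (HilbertModule.inner (D := D) (Λ y) (Λ ((∑ i ∈ s, P i ∘ₗ Q i).rTensor F₀ x)))
    linarith
  have hlim : a ^ 2 ≤ Real.sqrt (M * a ^ 2) * Real.sqrt (M * b ^ 2 + C₂ * 0) + C₁ * 0 := by
    refine ge_of_tendsto (x := 𝓝[>] (0 : ℝ)) (f := fun ε => Real.sqrt (M * a ^ 2) *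
      Real.sqrt (M * b ^ 2 + C₂ * ε) + C₁ * ε) ?_ (eventually_mem_nhdsWithin.mono key)
    exact (Continuous.tendsto (by fun_prop) 0).mono_left nhdsWithin_le_nhds
  have ha : 0 ≤ a := norm_nonneg _
  have hb : 0 ≤ b := norm_nonneg _
  rw [mul_zero, mul_zero, add_zero, add_zero, ← Real.sqrt_mul (by positivity),
    show M * a ^ 2 * (M * b ^ 2) = (a * (M * b)) ^ 2 by ring,
      Real.sqrt_sq (by positivity), sq] at hlim
  rcases ha.eq_or_lt with h | h
  · rw [← h]
    positivity
  · exact le_of_mul_le_mul_left hlim h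

end FellBundle

/-! ## Multiplication operators -/

namespace FellBundle

open TopGroupoid

variable {G₀ : Type u₀} {G : Type u} [TopologicalSpace G₀] [TopologicalSpace G]
  {𝒢 : TopGroupoid G₀ G} {A : G → Type w} [∀ g, NormedAddCommGroup (A g)]
  [∀ g, NormedSpace ℂ (A g)] [∀ g, CompleteSpace (A g)] [TopologicalSpace (TotalSp A)]
  {𝓐 : FellBundle 𝒢 A}

variable (𝓐) in
/-- Multiplication of sections with a continuous function. -/
def mulFun (c : C(G, ℝ)) : 𝓐.Cc →ₗ[ℂ] 𝓐.Cc where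
  toFun f := ⟨fun g => (c g : ℂ) • f.1 g, by
    obtain ⟨hf, K, hK, hfK⟩ := f.2
    refine ⟨continuous_iff_continuousAt.2 fun g => ?_, K, hK, fun g hg => ?_⟩
    · exact 𝓐.isField.tendsto_smul
        ((Complex.continuous_ofReal.comp c.continuous).tendsto g) (hf.tendsto g)
    · change (c g : ℂ) • f.1 g = 0
      rw [hfK g hg, smul_zero]⟩
  map_add' f₁ f₂ := by
    ext g
    exact smul_add _ _ _
  map_smul' z f := by
    ext g
    exact smul_comm _ _ _

theorem mulFun_apply (c : C(G, ℝ)) (f : 𝓐.Cc) (g : G) :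
    (𝓐.mulFun c f).1 g = (c g : ℂ) • f.1 g := rfl

theorem mulFun_supportedIn (c : C(G, ℝ)) {K : Set G} {f : 𝓐.Cc} (hf : 𝓐.SupportedIn K f) :
    𝓐.SupportedIn K (𝓐.mulFun c f) := fun g hg => by
  rw [mulFun_apply, hf g hg, smul_zero]

theorem convIntegrand_mulFun_left (c : C(G, ℝ)) (f₁ : 𝓐.Cc) (f₂ : ∀ g, A g) (g h : G) :
    𝓐.convIntegrand (𝓐.mulFun c f₁).1 f₂ g h = (c h : ℂ) • 𝓐.convIntegrand f₁.1 f₂ g h := by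
  by_cases e : 𝒢.r h = 𝒢.r g
  · rw [convIntegrand_eq _ _ e, convIntegrand_eq _ _ e, mulFun_apply, map_smul]
    rfl
  · rw [convIntegrand_of_ne _ _ e, convIntegrand_of_ne _ _ e, smul_zero]

theorem involution_mulFun (c : C(G, ℝ)) (f : 𝓐.Cc) (g : G) :
    (𝓐.involution (𝓐.mulFun c f)).1 g = (c (𝒢.inv g) : ℂ) • (𝓐.involution f).1 g := by
  rw [involution_apply, mulFun_apply, LinearMap.map_smulₛₗ, Complex.conj_ofReal, involution_apply]

variable [LocallyCompactSpace G] [T2Space G] [MeasurableSpace G] [BorelSpace G]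
  {H : HaarSystem 𝒢}

/-- The involution turns a ∘ r into a ∘ s, and s(h) = r(h⁻¹g) under the convolution integral. This
is why the multipliers have to be functions of the range. -/
theorem isAdjointPair_mulFun (a : C(G₀, ℝ)) :
    𝓐.IsAdjointPair H (𝓐.mulFun (a.comp ⟨𝒢.r, 𝒢.continuous_r⟩))
      (𝓐.mulFun (a.comp ⟨𝒢.r, 𝒢.continuous_r⟩)) := by
  intro f₁ f₂
  ext g
  rw [conv_apply, conv_apply]
  refine integral_congr_ae ?_
  filter_upwards [H.ae_r (𝒢.r g)] with h hr
  rw [convIntegrand_eq _ _ hr, convIntegrand_eq _ _ hr, involution_mulFun, mulFun_apply]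
  simp only [ContinuousMap.comp_apply, ContinuousMap.coe_mk, r_mul, map_smul]
  rfl

/-- The integrand of `fibreOp`. -/
def fibreKernel (v f : 𝓐.Cc) (m h : G) : A m :=
  𝓐.mulTo h (𝒢.mul (𝒢.inv h) m) m ((𝓐.involution v).1 h)
    (𝓐.mulTo (𝒢.inv h) m (𝒢.mul (𝒢.inv h) m) (v.1 (𝒢.inv h)) (f.1 m))

theorem fibreKernel_eq_zero {K : Set G} {v : 𝓐.Cc} (hv : 𝓐.SupportedIn K v) (f : 𝓐.Cc) (m : G) :
    ∀ h ∉ 𝒢.inv ⁻¹' K, fibreKernel v f m h = 0 := fun h hh => by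
  rw [fibreKernel, hv (𝒢.inv h) hh, map_zero, zero_apply, map_zero]

theorem norm_fibreKernel_le (v f : 𝓐.Cc) (m h : G) :
    ‖fibreKernel v f m h‖ ≤ ‖v.1 (𝒢.inv h)‖ ^ 2 * ‖f.1 m‖ := by
  refine (norm_mulTo_le _ _ _ _ _).trans ?_
  rw [norm_involution, sq, _root_.mul_assoc]
  exact mul_le_mul_of_nonneg_left (norm_mulTo_le _ _ _ _ _) (norm_nonneg _)

theorem continuous_fibreKernel (v f : 𝓐.Cc) :
    Continuous fun z : {z : G × G // 𝒢.r z.2 = 𝒢.r z.1} =>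
      (⟨z.1.1, fibreKernel v f z.1.1 z.1.2⟩ : TotalSp A) := by
  have c1 : Continuous fun z : {z : G × G // 𝒢.r z.2 = 𝒢.r z.1} => z.1.1 := by fun_prop
  have c2 : Continuous fun z : {z : G × G // 𝒢.r z.2 = 𝒢.r z.1} => z.1.2 := by fun_prop
  refine continuous_mulTo (continuous_section (𝓐.involution v) c2) (continuous_mulTo
    (continuous_section v (𝒢.continuous_inv.comp c2)) (continuous_section f c1)
    (fun z => (𝒢.s_inv _).trans z.2) fun z => rfl) (fun z => ?_) fun z => mul_inv_mul z.2
  simp [𝒢.r_inv]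

theorem integrable_fibreKernel (H : HaarSystem 𝒢) (v f : 𝓐.Cc) (m : G) :
    Integrable (fibreKernel v f m) (H.meas (𝒢.r m)) := by
  obtain ⟨K, hK, hv⟩ := exists_supportedIn v
  exact H.integrable_section 𝓐.isField (isCompact_inv hK) (fibreKernel_eq_zero hv f)
    (continuous_fibreKernel v f) m

/-- The operator `f ↦ (m ↦ ∫ v(h⁻¹)^* v(h⁻¹) f(m) dα^{r(m)}(h))`. -/
def fibreOp (H : HaarSystem 𝒢) (v : 𝓐.Cc) : 𝓐.Cc →ₗ[ℂ] 𝓐.Cc where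
  toFun f := ⟨fun m => ∫ h, fibreKernel v f m h ∂(H.meas (𝒢.r m)), by
    obtain ⟨K, hK, hv⟩ := exists_supportedIn v
    obtain ⟨L, hL, hf⟩ := exists_supportedIn f
    refine ⟨H.continuous_integral_section 𝓐.isField (isCompact_inv hK) (fibreKernel_eq_zero hv f)
      (continuous_fibreKernel v f), L, hL, fun m hm => ?_⟩
    refine integral_eq_zero_of_ae (Eventually.of_forall fun h => ?_)
    simp [fibreKernel, hf m hm]⟩
  map_add' f₁ f₂ := by
    ext m
    change _ = ∫ h, fibreKernel v f₁ m h ∂(H.meas (𝒢.r m)) +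
      ∫ h, fibreKernel v f₂ m h ∂(H.meas (𝒢.r m))
    rw [← integral_add (integrable_fibreKernel H v f₁ m) (integrable_fibreKernel H v f₂ m)]
    exact integral_congr_ae (Eventually.of_forall fun h => by simp [fibreKernel])
  map_smul' c f := by
    ext m
    change _ = c • ∫ h, fibreKernel v f m h ∂(H.meas (𝒢.r m))
    rw [← integral_smul]
    exact integral_congr_ae (Eventually.of_forall fun h => by simp [fibreKernel])

theorem fibreOp_apply (v f : 𝓐.Cc) (m : G) :
    (fibreOp H v f).1 m = ∫ h, fibreKernel v f m h ∂(H.meas (𝒢.r m)) := rfl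

theorem isFibrewiseBounded_fibreOp {v : 𝓐.Cc} {b : C(G, ℝ)} (hb : HasCompactSupport b)
    (hvb : ∀ g, ‖v.1 g‖ ^ 2 ≤ b g) {M : ℝ} (hM : ∀ x, ∫ g, b (𝒢.inv g) ∂(H.meas x) ≤ M) :
    𝓐.IsFibrewiseBounded (fibreOp H v) M := by
  intro f m
  have hi : Integrable (fun g => b (𝒢.inv g)) (H.meas (𝒢.r m)) :=
    H.integrable_of_hasCompactSupport _ (b.continuous.comp 𝒢.continuous_inv)
      (hb.comp_homeomorph 𝒢.invHomeomorph)
  rw [fibreOp_apply]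
  calc ‖∫ h, fibreKernel v f m h ∂(H.meas (𝒢.r m))‖ ≤
        ∫ h, b (𝒢.inv h) * ‖f.1 m‖ ∂(H.meas (𝒢.r m)) :=
        norm_integral_le_of_norm_le (hi.mul_const _) (Eventually.of_forall fun h =>
          (norm_fibreKernel_le v f m h).trans
            (mul_le_mul_of_nonneg_right (hvb _) (norm_nonneg _)))
    _ ≤ M * ‖f.1 m‖ := by
      rw [integral_mul_const]
      exact mul_le_mul_of_nonneg_right (hM _) (norm_nonneg _)

/-- The operator multiplies f(m) on the left by a self-adjoint average of elements v(h⁻¹)^* v(h⁻¹)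
over the unit r(m). Under the integral sign, both convolutions have the integrand f₁^*(l) v^*(h)
v(h⁻¹) f₂(l⁻¹g), bracketed differently. -/
theorem isAdjointPair_fibreOp (v : 𝓐.Cc) : 𝓐.IsAdjointPair H (fibreOp H v) (fibreOp H v) := by
  intro f₁ f₂
  ext g
  rw [conv_apply_mulTo, conv_apply_mulTo]
  refine integral_congr_ae ?_
  filter_upwards [H.ae_r (𝒢.r g)] with l hl
  set q := 𝒢.mul (𝒢.inv l) g with hq
  have hrq : 𝒢.r q = 𝒢.r (𝒢.inv l) := r_mul _ _
  have h1 := (𝓐.starToReal (𝒢.inv_inv l)).integral_comp_comm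
    (integrable_fibreKernel H v f₁ (𝒢.inv l))
  have h1' : (𝓐.involution (fibreOp H v f₁)).1 l =
      ∫ h, 𝓐.starToReal (𝒢.inv_inv l) (fibreKernel v f₁ (𝒢.inv l) h)
        ∂(H.meas (𝒢.r (𝒢.inv l))) := by
    rw [involution_apply, h1]
    rfl
  have h2 := ((𝓐.mulTo l q g).flip (f₂.1 q)).integral_comp_comm
    ((𝓐.starToReal (𝒢.inv_inv l)).integrable_comp (integrable_fibreKernel H v f₁ (𝒢.inv l)))
  rw [ContinuousLinearMap.flip_apply] at h2
  have h3 := (𝓐.mulTo l q g ((𝓐.involution f₁).1 l)).integral_comp_comm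
    (integrable_fibreKernel H v f₂ q)
  rw [h1', ← h2, fibreOp_apply, ← h3, hrq]
  refine integral_congr_ae ?_
  filter_upwards [H.ae_r (𝒢.r (𝒢.inv l))] with h hh
  have hsl : 𝒢.s l = 𝒢.r h := by rw [hh, 𝒢.r_inv]
  have e1 : 𝒢.s (𝒢.inv h) = 𝒢.r (𝒢.inv l) := by rw [𝒢.s_inv, hh]
  have e2 : 𝒢.inv (𝒢.mul (𝒢.inv h) (𝒢.inv l)) = 𝒢.mul l h := by
    rw [inv_mul_rev e1, 𝒢.inv_inv, 𝒢.inv_inv]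
  have e3 : 𝒢.mul (𝒢.mul l h) (𝒢.inv h) = l := by
    rw [mul_mul hsl (𝒢.r_inv h).symm, TopGroupoid.mul_inv, mul_unit hsl]
  have hqg : 𝒢.mul l q = g := mul_inv_mul hl
  have hlq : 𝒢.s l = 𝒢.r q := by rw [hrq, 𝒢.r_inv]
  have hhq : 𝒢.s (𝒢.inv h) = 𝒢.r q := by rw [hrq, e1]
  have hstar : 𝓐.starTo (𝒢.inv l) l (fibreKernel v f₁ (𝒢.inv l) h) =
      𝓐.mulTo (𝒢.mul l h) (𝒢.inv h) l (𝓐.mulTo l h (𝒢.mul l h) ((𝓐.involution f₁).1 l)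
        ((𝓐.involution v).1 h)) (v.1 (𝒢.inv h)) := by
    rw [fibreKernel, starTo_mulTo (by rw [r_mul, 𝒢.r_inv]) (mul_inv_mul hh) (𝒢.inv_inv l) rfl e2,
      starTo_mulTo e1 rfl e2 (𝒢.inv_inv h) (𝒢.inv_inv l), involution_apply,
      involution_apply, starTo_starTo (𝒢.inv_inv h)]
  change 𝓐.mulTo l q g (𝓐.starTo (𝒢.inv l) l (fibreKernel v f₁ (𝒢.inv l) h)) (f₂.1 q) = _
  rw [hstar, mulTo_mulTo (y := 𝒢.mul (𝒢.inv h) q) (by rw [s_mul hsl, 𝒢.r_inv]) hhq e3 rfl hqg,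
    mulTo_mulTo hsl (by rw [r_mul, 𝒢.r_inv]) rfl (mul_inv_mul (hh.trans hrq.symm)) ?_]
  · rfl
  · rw [← mul_mul (by rw [s_mul hsl, 𝒢.r_inv]) hhq, e3, hqg]

end FellBundle

/-! ## Approximate resolutions of the identity on the range fibres -/

namespace FellBundle

open TopGroupoid

variable {G₀ : Type u₀} {G : Type u} [TopologicalSpace G₀] [TopologicalSpace G]
  [LocallyCompactSpace G] [T2Space G] [MeasurableSpace G] [BorelSpace G]
  {𝒢 : TopGroupoid G₀ G} {A : G → Type w} [∀ g, NormedAddCommGroup (A g)]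
  [∀ g, NormedSpace ℂ (A g)] [∀ g, CompleteSpace (A g)] [TopologicalSpace (TotalSp A)]
  {𝓐 : FellBundle 𝒢 A}

/-- The integrand `v(p) f(p⁻¹ n)` of a convolution is uniformly continuous in `p`. -/
theorem exists_isOpen_norm_convIntegrand_sub_le (v f : 𝓐.Cc) {ε : ℝ} (hε : 0 < ε) (p₀ : G) :
    ∃ U : Set G, IsOpen U ∧ p₀ ∈ U ∧ ∀ p ∈ U, ∀ q ∈ U, ∀ n, 𝒢.r p = 𝒢.r n → 𝒢.r q = 𝒢.r n →
      ‖𝓐.convIntegrand v.1 f.1 n p - 𝓐.convIntegrand v.1 f.1 n q‖ ≤ ε := by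
  have := 𝒢.t2_units
  obtain ⟨K, hK, hf⟩ := exists_supportedIn f
  obtain ⟨P, hP, hPp⟩ := exists_compact_mem_nhds p₀
  have hloc : ∀ n₀ : G, ∃ N ∈ 𝓝 n₀, ∃ U ∈ 𝓝 p₀, ∀ p ∈ U, ∀ q ∈ U, ∀ n ∈ N, 𝒢.r p = 𝒢.r n →
      𝒢.r q = 𝒢.r n → ‖𝓐.convIntegrand v.1 f.1 n p - 𝓐.convIntegrand v.1 f.1 n q‖ ≤ ε := by
    intro n₀
    by_cases e : 𝒢.r p₀ = 𝒢.r n₀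
    · obtain ⟨T, hT, hTε⟩ := 𝓐.isField.exists_thin (𝓐.convIntegrand v.1 f.1 n₀ p₀) hε
      have h1 := (𝓐.continuous_convIntegrand v.2.1 f.2.1).tendsto ⟨(n₀, p₀), e⟩ hT
      rw [mem_map, nhds_subtype_eq_comap, mem_comap] at h1
      obtain ⟨S, hS, hST⟩ := h1
      obtain ⟨N, hN, U, hU, hNU⟩ := mem_nhds_prod_iff.1 hS
      exact ⟨N, hN, U, hU, fun p hp q hq n hn ep eq => (hTε n _ _
        (hST (a := ⟨(n, p), ep⟩) (hNU ⟨hn, hp⟩)) (hST (a := ⟨(n, q), eq⟩) (hNU ⟨hn, hq⟩))).le⟩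
    -- If r(p₀) ≠ r(n₀), then r(p) ≠ r(n) for nearby p and n, and there is nothing to prove.
    · have h1 : {z : G × G | 𝒢.r z.2 ≠ 𝒢.r z.1} ∈ 𝓝 (n₀, p₀) :=
        (isOpen_ne_fun (𝒢.continuous_r.comp continuous_snd)
          (𝒢.continuous_r.comp continuous_fst)).mem_nhds e
      obtain ⟨N, hN, U, hU, hNU⟩ := mem_nhds_prod_iff.1 h1
      exact ⟨N, hN, U, hU, fun p hp q hq n hn ep _ =>
        absurd ep (hNU (show (n, p) ∈ N ×ˢ U from ⟨hn, hp⟩))⟩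
  choose N hN U hU hNU using hloc
  -- For p near p₀ the integrand vanishes unless n lies in the compact set PK, so finitely many
  -- local estimates suffice.
  obtain ⟨t, -, ht⟩ := (isCompact_mulSet (𝒢 := 𝒢) hP hK).elim_nhds_subcover N fun n _ => hN n
  have hmem : P ∩ ⋂ n ∈ t, U n ∈ 𝓝 p₀ :=
    inter_mem hPp ((biInter_finset_mem t).2 fun n _ => hU n)
  obtain ⟨W, hW, hWo, hpW⟩ := mem_nhds_iff.1 hmem
  refine ⟨W, hWo, hpW, fun p hp q hq n ep eq => ?_⟩
  by_cases hn : n ∈ 𝒢.mulSet P K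
  · obtain ⟨n₀, hn₀, hnN⟩ := mem_iUnion₂.1 (ht hn)
    exact hNU n₀ p (mem_iInter₂.1 (hW hp).2 n₀ hn₀) q (mem_iInter₂.1 (hW hq).2 n₀ hn₀) n hnN ep eq
  · have h0 : ∀ p ∈ P, 𝒢.r p = 𝒢.r n → 𝓐.convIntegrand v.1 f.1 n p = 0 := fun p hp ep => by
      rw [convIntegrand_eq _ _ ep, hf _ fun hk => hn ⟨p, hp, _, hk, ?_, mul_inv_mul ep⟩, map_zero]
      rw [r_mul, 𝒢.r_inv]
    rw [h0 p (hW hp).1 ep, h0 q (hW hq).1 eq, sub_zero, norm_zero]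
    exact hε.le

end FellBundle

/-! ### Normalised partitions of unity and reconstruction on range fibres. -/

namespace HaarSystem

open TopGroupoid

variable {G₀ : Type u₀} {G : Type u} [TopologicalSpace G₀] [TopologicalSpace G]
  [LocallyCompactSpace G] [T2Space G] [MeasurableSpace G] [BorelSpace G]
  {𝒢 : TopGroupoid G₀ G} (H : HaarSystem 𝒢)

/-- The fibrewise integral of a compactly supported continuous function. -/
def integralMap (f : C(G, ℝ)) (hf : HasCompactSupport f) : C(G₀, ℝ) :=
  ⟨fun x => ∫ g, f g ∂(H.meas x), H.continuous_integral f f.continuous hf⟩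

theorem integral_pos {χ : C(G, ℝ)} (hχ : HasCompactSupport χ) (h0 : ∀ g, 0 ≤ χ g) {g : G}
    (hg : 0 < χ g) : 0 < ∫ h, χ h ∂(H.meas (𝒢.r g)) := by
  rw [integral_pos_iff_support_of_nonneg h0
    (H.integrable_of_hasCompactSupport _ χ.continuous hχ)]
  exact H.meas_pos _ _ χ.continuous.isOpen_support ⟨g, hg.ne', rfl⟩

/-- The regularisation δ keeps the quotient by ∫χ continuous where this integral vanishes; its cost
is bounded here. On the compact set where χ ≥ η, full support of the measures gives ∫χ ≥ m > 0, so δ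
≤ mη suffices. Elsewhere χ < η and the other factor is at most 1. -/
theorem eventually_mul_div_le {χ : C(G, ℝ)} (hχ : HasCompactSupport χ) (h0 : ∀ g, 0 ≤ χ g)
    (h1 : ∀ g, χ g ≤ 1) {η : ℝ} (hη : 0 < η) : ∀ᶠ δ in 𝓝[>] (0 : ℝ), ∀ g,
      χ g * (δ / (∫ h, χ h ∂(H.meas (𝒢.r g)) + δ)) ≤ η := by
  have hn0 : ∀ x, 0 ≤ ∫ h, χ h ∂(H.meas x) := fun x => integral_nonneg h0
  have hK : IsCompact {g | η ≤ χ g} := by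
    refine hχ.of_isClosed_subset (isClosed_le continuous_const χ.continuous) fun g hg => ?_
    exact subset_tsupport _ (hη.trans_le hg).ne'
  obtain ⟨m, hm, hmn⟩ : ∃ m > 0, ∀ g ∈ {g | η ≤ χ g}, m ≤ ∫ h, χ h ∂(H.meas (𝒢.r g)) := by
    rcases {g | η ≤ χ g}.eq_empty_or_nonempty with he | hne
    · exact ⟨1, one_pos, by simp [he]⟩
    · obtain ⟨g, hg, hmin⟩ := hK.exists_isMinOn hne
        (((H.integralMap χ hχ).continuous.comp 𝒢.continuous_r).continuousOn)
      exact ⟨_, H.integral_pos hχ h0 (hη.trans_le hg), fun g' hg' => hmin hg'⟩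
  filter_upwards [Ioc_mem_nhdsGT (mul_pos hm hη)] with δ hδ g
  have hden : 0 < ∫ h, χ h ∂(H.meas (𝒢.r g)) + δ := add_pos_of_nonneg_of_pos (hn0 _) hδ.1
  have hle1 : δ / (∫ h, χ h ∂(H.meas (𝒢.r g)) + δ) ≤ 1 := by
    rw [div_le_one hden]
    linarith [hn0 (𝒢.r g)]
  by_cases hg : η ≤ χ g
  · refine (mul_le_of_le_one_left (div_nonneg hδ.1.le hden.le) (h1 g)).trans ?_
    rw [div_le_iff₀ hden]
    have := hmn g hg
    nlinarith [hδ.1, hδ.2]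
  · exact (mul_le_of_le_one_right (h0 g) hle1).trans (not_le.1 hg).le

/-- The function `χ` divided by the square root of its fibrewise integral, regularised by `δ`. -/
def normalise (χ : C(G, ℝ)) (hχ : HasCompactSupport χ) (h0 : ∀ g, 0 ≤ χ g) {δ : ℝ} (hδ : 0 < δ) :
    C(G, ℝ) where
  toFun g := χ g / Real.sqrt (H.integralMap χ hχ (𝒢.r g) + δ)
  continuous_toFun := by
    have := 𝒢.continuous_r
    refine χ.continuous.div (by fun_prop) fun g => (Real.sqrt_pos.2 ?_).ne'
    exact add_pos_of_nonneg_of_pos (integral_nonneg h0) hδ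

variable {χ : C(G, ℝ)} (hχ : HasCompactSupport χ) (h0 : ∀ g, 0 ≤ χ g) {δ : ℝ} (hδ : 0 < δ)

/-- The denominator depends only on the range, so it is constant under the integral, and the two
square roots multiply to ∫χ + δ. -/
theorem normalise_mul_integral {E : Type*} [NormedAddCommGroup E] [NormedSpace ℝ E] (Z : G → E)
    (g : G) : H.normalise χ hχ h0 hδ g •
      ∫ q, H.normalise χ hχ h0 hδ q • Z q ∂(H.meas (𝒢.r g)) =
      (χ g / (∫ h, χ h ∂(H.meas (𝒢.r g)) + δ)) • ∫ q, χ q • Z q ∂(H.meas (𝒢.r g)) := by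
  have hpos : 0 < ∫ h, χ h ∂(H.meas (𝒢.r g)) + δ :=
    add_pos_of_nonneg_of_pos (integral_nonneg h0) hδ
  have h1 : ∫ q, H.normalise χ hχ h0 hδ q • Z q ∂(H.meas (𝒢.r g)) =
      (Real.sqrt (∫ h, χ h ∂(H.meas (𝒢.r g)) + δ))⁻¹ • ∫ q, χ q • Z q ∂(H.meas (𝒢.r g)) := by
    rw [← integral_smul]
    refine integral_congr_ae ?_
    filter_upwards [H.ae_r (𝒢.r g)] with q hq
    change (χ q / Real.sqrt (∫ h, χ h ∂(H.meas (𝒢.r q)) + δ)) • Z q = _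
    rw [hq, smul_smul, div_eq_inv_mul]
  rw [h1, smul_smul]
  congr 1
  change χ g / Real.sqrt (∫ h, χ h ∂(H.meas (𝒢.r g)) + δ) * _ = _
  rw [div_mul_eq_mul_div, ← div_eq_mul_inv, div_div, Real.mul_self_sqrt hpos.le]

/-- The Cauchy–Schwarz inequality for the normalised functions. -/
theorem sq_integral_mul_normalise_le (a : C(G, ℝ)) (x : G₀) :
    (∫ g, a g * H.normalise χ hχ h0 hδ g ∂(H.meas x)) ^ 2 ≤
      ∫ g, a g ^ 2 * χ g ∂(H.meas x) := by
  set n := ∫ h, χ h ∂(H.meas x) with hn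
  have hn0 : 0 ≤ n := integral_nonneg h0
  have hpos : 0 < n + δ := add_pos_of_nonneg_of_pos hn0 hδ
  set B := ∫ g, a g * χ g ∂(H.meas x) with hB
  have h1 : ∫ g, a g * H.normalise χ hχ h0 hδ g ∂(H.meas x) = B / Real.sqrt (n + δ) := by
    rw [hB, ← integral_div]
    refine integral_congr_ae ?_
    filter_upwards [H.ae_r x] with q hq
    change a q * (χ q / Real.sqrt (∫ h, χ h ∂(H.meas (𝒢.r q)) + δ)) = _
    rw [hq, mul_div_assoc]
  rw [h1, div_pow, Real.sq_sqrt hpos.le, div_le_iff₀ hpos]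
  set C := ∫ g, a g ^ 2 * χ g ∂(H.meas x) with hC
  have i1 : Integrable (fun g => a g ^ 2 * χ g) (H.meas x) :=
    H.integrable_of_hasCompactSupport x (by fun_prop) hχ.mul_left
  have i2 : Integrable (fun g => a g * χ g) (H.meas x) :=
    H.integrable_of_hasCompactSupport x (by fun_prop) hχ.mul_left
  have i3 : Integrable χ (H.meas x) := H.integrable_of_hasCompactSupport x χ.continuous hχ
  have key : ∀ t : ℝ, 0 ≤ C - 2 * t * B + t ^ 2 * n := by
    intro t
    have h2 : C - 2 * t * B + t ^ 2 * n = ∫ g, (a g - t) ^ 2 * χ g ∂(H.meas x) := by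
      have e : ∀ g, (a g - t) ^ 2 * χ g =
          (a g ^ 2 * χ g - 2 * t * (a g * χ g)) + t ^ 2 * χ g := fun g => by ring
      simp_rw [e]
      rw [integral_add (f := fun g => a g ^ 2 * χ g - 2 * t * (a g * χ g))
        (i1.sub (i2.const_mul _)) (i3.const_mul _), integral_sub i1 (i2.const_mul _),
        integral_const_mul, integral_const_mul]
    rw [h2]
    exact integral_nonneg fun g => mul_nonneg (sq_nonneg _) (h0 g)
  -- This is the minimiser of the quadratic polynomial in t, up to the regularisation δ.
  have h3 := key (B / (n + δ))
  have h4 : B / (n + δ) * (n + δ) = B := div_mul_cancel₀ _ hpos.ne'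
  set t := B / (n + δ)
  rw [← h4] at h3 ⊢
  have h5 : t ^ 2 * (n + δ) ≤ C := by nlinarith [mul_nonneg (sq_nonneg t) hδ.le]
  calc (t * (n + δ)) ^ 2 = t ^ 2 * (n + δ) * (n + δ) := by ring
    _ ≤ C * (n + δ) := mul_le_mul_of_nonneg_right h5 hpos.le

/-- Reconstruction of a function on a range fibre from its averages. -/
theorem norm_sub_sum_normalise_le {κ : Type*} [Fintype κ] {E : Type*} [NormedAddCommGroup E]
    [NormedSpace ℝ E] [CompleteSpace E] {χ : κ → C(G, ℝ)} (hχ : ∀ i, HasCompactSupport (χ i))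
    (h0 : ∀ i g, 0 ≤ χ i g) {δ : ℝ} (hδ : 0 < δ) {g : G} (hg : ∑ i, χ i g = 1) {η : ℝ}
    (hη : ∀ i, χ i g * (δ / (∫ h, χ i h ∂(H.meas (𝒢.r g)) + δ)) ≤ η) {Z : G → E}
    (hZ : ContinuousOn Z {h | 𝒢.r h = 𝒢.r g}) {ε : ℝ} (hε : 0 ≤ ε)
    (hZε : ∀ i, χ i g ≠ 0 → ∀ q, χ i q ≠ 0 → 𝒢.r q = 𝒢.r g → ‖Z g - Z q‖ ≤ ε) :
    ‖Z g - ∑ i, H.normalise (χ i) (hχ i) (h0 i) hδ g •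
      ∫ q, H.normalise (χ i) (hχ i) (h0 i) hδ q • Z q ∂(H.meas (𝒢.r g))‖ ≤
      ε + Fintype.card κ * η * ‖Z g‖ := by
  simp only [normalise_mul_integral]
  set x := 𝒢.r g
  have hZ1 : Z g = ∑ i, χ i g • Z g := by rw [← Finset.sum_smul, hg, one_smul]
  have hterm : ∀ i, ‖χ i g • Z g - (χ i g / (∫ h, χ i h ∂(H.meas x) + δ)) •
      ∫ q, χ i q • Z q ∂(H.meas x)‖ ≤ χ i g * ε + η * ‖Z g‖ := by
    intro i
    set n := ∫ h, χ i h ∂(H.meas x) with hn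
    have hn0 : 0 ≤ n := integral_nonneg (h0 i)
    have hpos : 0 < n + δ := add_pos_of_nonneg_of_pos hn0 hδ
    have i1 : Integrable (χ i) (H.meas x) :=
      H.integrable_of_hasCompactSupport x (χ i).continuous (hχ i)
    have i2 : Integrable (fun q => χ i q • Z q) (H.meas x) :=
      H.integrable_of_continuousOn ((χ i).continuous.continuousOn.smul hZ) (hχ i)
        fun q hq _ => by rw [image_eq_zero_of_notMem_tsupport hq, zero_smul]
    -- The first summand is the oscillation of Z on the support of χ_i; the second is the loss
    -- caused by δ.
    have h1 : χ i g • Z g - (χ i g / (n + δ)) • ∫ q, χ i q • Z q ∂(H.meas x) =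
        (χ i g / (n + δ)) • ∫ q, χ i q • (Z g - Z q) ∂(H.meas x) +
          (χ i g * (δ / (n + δ))) • Z g := by
      simp only [smul_sub]
      rw [integral_sub (i1.smul_const _) i2, integral_smul_const, ← hn, smul_sub, smul_smul]
      have h2 : χ i g = χ i g / (n + δ) * n + χ i g * (δ / (n + δ)) := by
        field_simp
      nth_rewrite 1 [h2]
      rw [add_smul]
      abel
    have h3 : ‖(χ i g / (n + δ)) • ∫ q, χ i q • (Z g - Z q) ∂(H.meas x)‖ ≤ χ i g * ε := by
      rw [norm_smul, Real.norm_of_nonneg (div_nonneg (h0 i g) hpos.le)]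
      by_cases hgi : χ i g = 0
      · simp [hgi]
      have h4 : ‖∫ q, χ i q • (Z g - Z q) ∂(H.meas x)‖ ≤ n * ε := by
        rw [hn, ← integral_mul_const]
        refine norm_integral_le_of_norm_le (i1.mul_const ε) ?_
        filter_upwards [H.ae_r x] with q hq
        rw [norm_smul, Real.norm_of_nonneg (h0 i q)]
        by_cases hqi : χ i q = 0
        · simp [hqi]
        · exact mul_le_mul_of_nonneg_left (hZε i hgi q hqi hq) (h0 i q)
      calc χ i g / (n + δ) * ‖∫ q, χ i q • (Z g - Z q) ∂(H.meas x)‖ ≤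
            χ i g / (n + δ) * (n * ε) :=
            mul_le_mul_of_nonneg_left h4 (div_nonneg (h0 i g) hpos.le)
        _ = χ i g * ε * (n / (n + δ)) := by ring
        _ ≤ χ i g * ε := mul_le_of_le_one_right (mul_nonneg (h0 i g) hε)
            ((div_le_one hpos).2 (by linarith))
    rw [h1]
    refine (norm_add_le _ _).trans (add_le_add h3 ?_)
    rw [norm_smul, Real.norm_of_nonneg (mul_nonneg (h0 i g) (div_nonneg hδ.le hpos.le))]
    exact mul_le_mul_of_nonneg_right (hη i) (norm_nonneg _)
  calc ‖Z g - ∑ i, (χ i g / (∫ h, χ i h ∂(H.meas x) + δ)) • ∫ q, χ i q • Z q ∂(H.meas x)‖ =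
        ‖∑ i, (χ i g • Z g - (χ i g / (∫ h, χ i h ∂(H.meas x) + δ)) •
          ∫ q, χ i q • Z q ∂(H.meas x))‖ := by rw [Finset.sum_sub_distrib, ← hZ1]
    _ ≤ ∑ i, (χ i g * ε + η * ‖Z g‖) := (norm_sum_le _ _).trans
        (Finset.sum_le_sum fun i _ => hterm i)
    _ = ε + Fintype.card κ * η * ‖Z g‖ := by
      rw [Finset.sum_add_distrib, ← Finset.sum_mul, hg, one_mul, Finset.sum_const,
        Finset.card_univ, nsmul_eq_mul, _root_.mul_assoc]

end HaarSystem

/-! ## Approximate factorisations of convolution operators -/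

namespace FellBundle

open TopGroupoid

variable {G₀ : Type u₀} {G : Type u} [TopologicalSpace G₀] [TopologicalSpace G]
  {𝒢 : TopGroupoid G₀ G} {A : G → Type w} [∀ g, NormedAddCommGroup (A g)]
  [∀ g, NormedSpace ℂ (A g)] [∀ g, CompleteSpace (A g)] [TopologicalSpace (TotalSp A)]
  {𝓐 : FellBundle 𝒢 A}

/-- A section that is dominated by the function `b` is the product of `√b` and a section that is
dominated by `√b`. -/
theorem exists_sqrt_factorisation [T2Space G] (u : 𝓐.Cc) {b : C(G, ℝ)} (hb : HasCompactSupport b)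
    (hub : ∀ g, ‖u.1 g‖ ≤ b g) : ∃ (a : C(G, ℝ)) (v : 𝓐.Cc), HasCompactSupport a ∧
      (∀ g, 0 ≤ a g) ∧ (∀ g, a g ^ 2 = b g) ∧ (∀ g, ‖v.1 g‖ ≤ a g) ∧
      ∀ g, u.1 g = (a g : ℂ) • v.1 g := by
  have hb0 : ∀ g, 0 ≤ b g := fun g => (norm_nonneg _).trans (hub g)
  let a : C(G, ℝ) := ⟨fun g => Real.sqrt (b g), by fun_prop⟩
  have ha : ∀ g, a g = Real.sqrt (b g) := fun g => rfl
  have ha0 : ∀ g, 0 ≤ a g := fun g => Real.sqrt_nonneg _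
  have hab : ∀ g, a g ^ 2 = b g := fun g => Real.sq_sqrt (hb0 g)
  have hac : HasCompactSupport a := HasCompactSupport.intro hb fun g hg => by
    rw [ha, image_eq_zero_of_notMem_tsupport hg, Real.sqrt_zero]
  have hnorm : ∀ g, ‖((a g : ℂ)⁻¹ : ℂ) • u.1 g‖ ≤ a g := fun g => by
    rw [norm_smul, norm_inv, Complex.norm_real, Real.norm_of_nonneg (ha0 g)]
    rcases (ha0 g).eq_or_lt with h | h
    · rw [← h, inv_zero, zero_mul]
    · rw [inv_mul_le_iff₀ h, ← sq, hab]
      exact hub g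
  refine ⟨a, ⟨fun g => ((a g : ℂ)⁻¹ : ℂ) • u.1 g, continuous_iff_continuousAt.2 fun g => ?_,
    tsupport a, hac, fun g hg => ?_⟩, hac, ha0, hab, hnorm, fun g => ?_⟩
  · have hat : Tendsto a (𝓝 g) (𝓝 (a g)) := a.continuous.tendsto g
    -- Where a vanishes, the quotient u/a tends to 0 because its norm is at most a.
    by_cases h : a g = 0
    · have h0 : ((a g : ℂ)⁻¹ : ℂ) • u.1 g = 0 := by simp [h]
      change Tendsto _ _ (𝓝 (⟨g, ((a g : ℂ)⁻¹ : ℂ) • u.1 g⟩ : TotalSp A))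
      rw [h0]
      refine 𝓐.isField.tendsto_zero (p := fun g => g) tendsto_id ?_
      rw [h] at hat
      exact squeeze_zero (fun _ => norm_nonneg _) hnorm hat
    · exact 𝓐.isField.tendsto_smul (((Complex.continuous_ofReal.tendsto _).comp hat).inv₀
        (by exact_mod_cast h)) (u.2.1.tendsto g)
  · change ((a g : ℂ)⁻¹ : ℂ) • u.1 g = 0
    rw [image_eq_zero_of_notMem_tsupport hg]
    simp
  · change _ = (a g : ℂ) • ((a g : ℂ)⁻¹ : ℂ) • u.1 g
    by_cases h : a g = 0
    · have : u.1 g = 0 := norm_le_zero_iff.1 ((hub g).trans_eq (by rw [← hab, h]; norm_num))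
      rw [this, smul_zero, smul_zero]
    · rw [smul_inv_smul₀ (by exact_mod_cast h)]

theorem convIntegrand_inv (v f : 𝓐.Cc) {h m : G} (e : 𝒢.r h = 𝒢.r m) :
    𝓐.convIntegrand v.1 f.1 (𝒢.mul (𝒢.inv h) m) (𝒢.inv h) =
      𝓐.mulTo (𝒢.inv h) m (𝒢.mul (𝒢.inv h) m) (v.1 (𝒢.inv h)) (f.1 m) := by
  have e' : 𝒢.mul (𝒢.inv (𝒢.inv h)) (𝒢.mul (𝒢.inv h) m) = m := by
    rw [𝒢.inv_inv, mul_inv_mul e]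
  rw [convIntegrand_eq _ _ (r_mul _ _).symm, e']

variable [LocallyCompactSpace G] [T2Space G] [MeasurableSpace G] [BorelSpace G]

theorem sum_apply {κ : Type*} (s : Finset κ) (T : κ → 𝓐.Cc →ₗ[ℂ] 𝓐.Cc) (f : 𝓐.Cc) (g : G) :
    ((∑ i ∈ s, T i) f).1 g = ∑ i ∈ s, (T i f).1 g := by
  rw [LinearMap.sum_apply, AddSubmonoidClass.coe_finsetSum, Finset.sum_apply]

theorem norm_convIntegrand_le_supNorm (v f : 𝓐.Cc) (g h : G) :
    ‖𝓐.convIntegrand v.1 f.1 g h‖ ≤ 𝓐.supNorm v * 𝓐.supNorm f :=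
  (norm_convIntegrand_le _ _ _ _).trans (mul_le_mul (norm_le_supNorm v _) (norm_le_supNorm f _)
    (norm_nonneg _) (supNorm_nonneg v))

/-- Since r(h) = r(m) under the integral, the factors α_i(r(m)) can be moved inside. The difference
is then the integral of (a − ∑ α_i(r(h)) φ_i(h)) v(h) f(h⁻¹m), which vanishes for h outside K. -/
theorem exists_norm_conv_sub_sum_le (H : HaarSystem 𝒢) {K : Set G} (hK : IsCompact K) :
    ∃ C, 0 ≤ C ∧ ∀ (κ : Type u) (s : Finset κ) (φ : κ → C(G, ℝ)) (α : κ → C(G₀, ℝ)) (a : C(G, ℝ))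
      (u v f : 𝓐.Cc) (c : ℝ), (∀ g, u.1 g = (a g : ℂ) • v.1 g) → 𝓐.SupportedIn K v → 0 ≤ c →
      (∀ g ∈ K, ‖a g - ∑ i ∈ s, α i (𝒢.r g) * φ i g‖ ≤ c) → ∀ m,
      ‖((𝓐.convL H u - ∑ i ∈ s, 𝓐.mulFun ((α i).comp ⟨𝒢.r, 𝒢.continuous_r⟩) ∘ₗ
        𝓐.convL H (𝓐.mulFun (φ i) v)) f).1 m‖ ≤ C * (c * (𝓐.supNorm v * 𝓐.supNorm f)) := by
  obtain ⟨C, hC0, hC⟩ := H.exists_norm_integral_le.{u₀, u, w} hK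
  refine ⟨C, hC0, fun κ s φ α a u v f c hu hv hc0 hc m => ?_⟩
  have hu' : u = 𝓐.mulFun a v := by
    ext g
    exact hu g
  have hi : ∀ b : C(G, ℝ), Integrable (fun h => (b h : ℂ) • 𝓐.convIntegrand v.1 f.1 m h)
      (H.meas (𝒢.r m)) := fun b => by
    simpa only [← convIntegrand_mulFun_left] using integrable_convIntegrand H (𝓐.mulFun b v) f m
  have h1 : ((𝓐.convL H u - ∑ i ∈ s, 𝓐.mulFun ((α i).comp ⟨𝒢.r, 𝒢.continuous_r⟩) ∘ₗ
        𝓐.convL H (𝓐.mulFun (φ i) v)) f).1 m =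
      ∫ h, ((a h - ∑ i ∈ s, α i (𝒢.r m) * φ i h : ℝ) : ℂ) • 𝓐.convIntegrand v.1 f.1 m h
        ∂(H.meas (𝒢.r m)) := by
    rw [LinearMap.sub_apply]
    change (𝓐.convL H u f).1 m - _ = _
    rw [sum_apply, convL_apply, conv_apply, hu']
    simp only [LinearMap.comp_apply, mulFun_apply, convL_apply, conv_apply,
      convIntegrand_mulFun_left, ContinuousMap.comp_apply, ContinuousMap.coe_mk, ← integral_smul]
    have hi' : ∀ i ∈ s, Integrable (fun h => (α i (𝒢.r m) : ℂ) • (φ i h : ℂ) •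
        𝓐.convIntegrand v.1 f.1 m h) (H.meas (𝒢.r m)) := fun i _ => (hi (φ i)).smul _
    rw [← integral_finsetSum s hi', ← integral_sub (hi a) (integrable_finsetSum _ hi')]
    refine integral_congr_ae (Eventually.of_forall fun h => ?_)
    simp only [Complex.ofReal_sub, Complex.ofReal_sum, Complex.ofReal_mul, sub_smul,
      Finset.sum_smul, mul_smul]
  rw [h1]
  refine hC _ _ _ _ (fun h hh _ => ?_) (fun h hh e => ?_)
    (mul_nonneg hc0 (mul_nonneg (supNorm_nonneg v) (supNorm_nonneg f)))
  · rw [convIntegrand_eq_zero hv _ _ hh, smul_zero]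
  · rw [norm_smul, Complex.norm_real, ← e]
    exact mul_le_mul (hc h hh) (norm_convIntegrand_le_supNorm _ _ _ _) (norm_nonneg _) hc0

/-- With n = h⁻¹m and p = h⁻¹, the sum of the Q_i^*Q_i f at m integrates v^*(h) times ∑ φ_i(p) ∫
φ_i(q) v(q) f(q⁻¹n) dq. The inner expression reconstructs v(p) f(p⁻¹n) = v(h⁻¹) f(m), which turns
the integral into `fibreOp`. The integrand vanishes for h outside K⁻¹. -/
theorem exists_norm_sum_conv_sub_le (H : HaarSystem 𝒢) {K : Set G} (hK : IsCompact K) :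
    ∃ C, 0 ≤ C ∧ ∀ (κ : Type u) (s : Finset κ) (φ : κ → C(G, ℝ)) (v f : 𝓐.Cc) (c : ℝ),
      𝓐.SupportedIn K v → 0 ≤ c →
      (∀ p ∈ K, ∀ n, 𝒢.r p = 𝒢.r n → ‖𝓐.convIntegrand v.1 f.1 n p - ∑ i ∈ s, φ i p •
        ∫ q, φ i q • 𝓐.convIntegrand v.1 f.1 n q ∂(H.meas (𝒢.r p))‖ ≤ c) → ∀ m,
      ‖((∑ i ∈ s, 𝓐.convL H (𝓐.involution (𝓐.mulFun (φ i) v)) ∘ₗ 𝓐.convL H (𝓐.mulFun (φ i) v) -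
        fibreOp H v) f).1 m‖ ≤ C * (𝓐.supNorm v * c) := by
  obtain ⟨C, hC0, hC⟩ := H.exists_norm_integral_le.{u₀, u, w} (isCompact_inv (𝒢 := 𝒢) hK)
  refine ⟨C, hC0, fun κ s φ v f c hv hc0 hc m => ?_⟩
  have hi : ∀ i, Integrable (𝓐.convIntegrand (𝓐.involution (𝓐.mulFun (φ i) v)).1
      (𝓐.conv H (𝓐.mulFun (φ i) v) f).1 m) (H.meas (𝒢.r m)) :=
    fun i => integrable_convIntegrand H _ _ m
  have h1 : ((∑ i ∈ s, 𝓐.convL H (𝓐.involution (𝓐.mulFun (φ i) v)) ∘ₗ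
        𝓐.convL H (𝓐.mulFun (φ i) v) - fibreOp H v) f).1 m =
      ∫ h, 𝓐.mulTo h (𝒢.mul (𝒢.inv h) m) m ((𝓐.involution v).1 h)
        (∑ i ∈ s, (φ i (𝒢.inv h) : ℂ) • (𝓐.conv H (𝓐.mulFun (φ i) v) f).1 (𝒢.mul (𝒢.inv h) m) -
          𝓐.convIntegrand v.1 f.1 (𝒢.mul (𝒢.inv h) m) (𝒢.inv h)) ∂(H.meas (𝒢.r m)) := by
    rw [LinearMap.sub_apply]
    change _ - (fibreOp H v f).1 m = _
    rw [sum_apply]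
    simp only [LinearMap.comp_apply, convL_apply]
    rw [Finset.sum_congr rfl fun i _ => conv_apply (H := H) _ _ m,
      ← integral_finsetSum s fun i _ => hi i, fibreOp_apply,
      ← integral_sub (integrable_finsetSum _ fun i _ => hi i) (integrable_fibreKernel H v f m)]
    refine integral_congr_ae ?_
    filter_upwards [H.ae_r (𝒢.r m)] with h e
    rw [map_sub, map_sum, convIntegrand_inv v f e]
    congr 1
    refine Finset.sum_congr rfl fun i _ => ?_
    rw [convIntegrand_eq _ _ e, involution_mulFun, map_smul, map_smul]
    rfl
  rw [h1]
  refine hC _ _ _ _ (fun h hh _ => ?_) (fun h hh e => ?_) (mul_nonneg (supNorm_nonneg v) hc0)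
  · rw [involution_supportedIn hv h hh, map_zero, zero_apply]
  · refine (norm_mulTo_le _ _ _ _ _).trans (mul_le_mul ?_ ?_ (norm_nonneg _) (supNorm_nonneg v))
    · rw [norm_involution]
      exact norm_le_supNorm v _
    · rw [norm_sub_rev]
      refine le_trans (le_of_eq ?_) (hc _ hh (𝒢.mul (𝒢.inv h) m) (r_mul _ _).symm)
      congr 2
      refine Finset.sum_congr rfl fun i _ => ?_
      rw [conv_apply, r_mul, Complex.coe_smul]
      simp only [convIntegrand_mulFun_left, Complex.coe_smul]

theorem isFibrewiseBounded_sum_mulFun {κ : Type*} (s : Finset κ) (α : κ → C(G₀, ℝ)) {M : ℝ}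
    (hM : ∀ x, ∑ i ∈ s, α i x ^ 2 ≤ M) :
    𝓐.IsFibrewiseBounded (∑ i ∈ s, 𝓐.mulFun ((α i).comp ⟨𝒢.r, 𝒢.continuous_r⟩) ∘ₗ
      𝓐.mulFun ((α i).comp ⟨𝒢.r, 𝒢.continuous_r⟩)) M := by
  intro f g
  have h : ((∑ i ∈ s, 𝓐.mulFun ((α i).comp ⟨𝒢.r, 𝒢.continuous_r⟩) ∘ₗ
      𝓐.mulFun ((α i).comp ⟨𝒢.r, 𝒢.continuous_r⟩)) f).1 g =
      ((∑ i ∈ s, α i (𝒢.r g) ^ 2 : ℝ) : ℂ) • f.1 g := by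
    rw [sum_apply, Complex.ofReal_sum, Finset.sum_smul]
    refine Finset.sum_congr rfl fun i _ => ?_
    rw [LinearMap.comp_apply, mulFun_apply, mulFun_apply, smul_smul, sq, Complex.ofReal_mul]
    rfl
  rw [h, norm_smul, Complex.norm_real,
    Real.norm_of_nonneg (Finset.sum_nonneg fun _ _ => sq_nonneg _)]
  exact mul_le_mul_of_nonneg_right (hM _) (norm_nonneg _)

theorem continuousOn_convIntegrand (v f : 𝓐.Cc) (n : G) :
    ContinuousOn (𝓐.convIntegrand v.1 f.1 n) {h | 𝒢.r h = 𝒢.r n} := by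
  rw [continuousOn_iff_continuous_domRestrict]
  refine 𝓐.isField.continuous_of_mk ?_
  exact (𝓐.continuous_convIntegrand v.2.1 f.2.1).comp
    (f := fun h : {h | 𝒢.r h = 𝒢.r n} => (⟨(n, h.1), h.2⟩ : {z : G × G // 𝒢.r z.2 = 𝒢.r z.1}))
    (by fun_prop)

/-- Here u = a v with a² = b, the P_i multiply by α_i ∘ r with α_i = ∫ a φ_i, and the Q_i convolve
with φ_i v. The bound on ∑ P_i² uses ∫ b dα^x; the bound on R = `fibreOp H v` uses the integrals of
b over inverses. Thus both halves of the I-norm enter. -/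
theorem hasFactorisations_convL (H : HaarSystem 𝒢) (u : 𝓐.Cc) {ε₀ : ℝ} (hε₀ : 0 < ε₀) :
    𝓐.HasFactorisations H (𝓐.convL H u) (𝓐.iNorm H u + ε₀) := by
  classical
  obtain ⟨b, hbc, hub, hb1, hb2⟩ := exists_continuous_dominating H u hε₀
  obtain ⟨a, v, hac, ha0, hab, hva, huv⟩ := exists_sqrt_factorisation u hbc hub
  intro S hS
  choose Kf hKf hfK using fun f : 𝓐.Cc => exists_supportedIn f
  obtain ⟨Kv, hKv, hv⟩ := exists_supportedIn v
  obtain ⟨N', hN'⟩ := (hS.image 𝓐.supNorm).bddAbove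
  obtain ⟨N, hN0, hN⟩ : ∃ N, 0 ≤ N ∧ ∀ f ∈ S, 𝓐.supNorm f ≤ N :=
    ⟨max N' 0, le_max_right _ _, fun f hf => (hN' ⟨f, hf, rfl⟩).trans (le_max_left _ _)⟩
  obtain ⟨Na', hNa'⟩ := hac.exists_bound_of_continuous a.continuous
  obtain ⟨Na, hNa0, hNa⟩ : ∃ N, 0 ≤ N ∧ ∀ g, ‖a g‖ ≤ N :=
    ⟨max Na' 0, le_max_right _ _, fun g => (hNa' g).trans (le_max_left _ _)⟩
  obtain ⟨C₁, hC₁0, hC₁⟩ := exists_norm_conv_sub_sum_le (𝓐 := 𝓐) H hKv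
  obtain ⟨C₂, hC₂0, hC₂⟩ := exists_norm_sum_conv_sub_le (𝓐 := 𝓐) H hKv
  set KS := ⋃ f ∈ S, Kf f with hKS
  have hKSc : IsCompact KS := hS.isCompact_biUnion fun f _ => hKf f
  have hfS : ∀ f ∈ S, 𝓐.SupportedIn KS f := fun f hf =>
    (hfK f).mono (subset_biUnion_of_mem (u := fun f => Kf f) hf)
  have huK : 𝓐.SupportedIn Kv u := fun g hg => by rw [huv, hv g hg, smul_zero]
  set K₁ := 𝒢.mulSet Kv KS
  set K₂ := 𝒢.mulSet (𝒢.inv ⁻¹' Kv) K₁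
  have hK₁ : IsCompact K₁ := isCompact_mulSet hKv hKSc
  have hK₂ : IsCompact K₂ := isCompact_mulSet (isCompact_inv hKv) hK₁
  -- The three sets carry u * f together with the P_i Q_i f, the Q_i^* Q_i f, and `fibreOp H v f`,
  -- independently of ε.
  refine ⟨K₁ ∪ (K₂ ∪ KS), hK₁.union (hK₂.union hKSc), fun ε hε => ?_⟩
  set Nv := 𝓐.supNorm v
  have hNv0 : 0 ≤ Nv := supNorm_nonneg v
  -- The tolerance τ bounds the oscillation of a and of the integrands v(p) f(p⁻¹n) on the cover; it
  -- is small enough that both final errors are at most ε.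
  obtain ⟨τ, hτ, hτ1, hτ2⟩ : ∃ τ > 0, C₁ * (τ * (1 + Na) * (Nv * N)) ≤ ε ∧
      C₂ * (Nv * (τ * (1 + Nv * N))) ≤ ε := by
    have p1 : 0 ≤ C₁ * ((1 + Na) * (Nv * N)) := by positivity
    have p2 : 0 ≤ C₂ * (Nv * (1 + Nv * N)) := by positivity
    set q := 1 + C₁ * ((1 + Na) * (Nv * N)) + C₂ * (Nv * (1 + Nv * N)) with hq
    have hq0 : 0 < q := by positivity
    have hτ : ε / q * q = ε := div_mul_cancel₀ _ hq0.ne'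
    have hτ0 : 0 < ε / q := div_pos hε hq0
    refine ⟨ε / q, hτ0, ?_, ?_⟩
    · calc C₁ * (ε / q * (1 + Na) * (Nv * N)) = ε / q * (C₁ * ((1 + Na) * (Nv * N))) := by ring
        _ ≤ ε / q * q := mul_le_mul_of_nonneg_left (by rw [hq]; linarith) hτ0.le
        _ = ε := hτ
    · calc C₂ * (Nv * (ε / q * (1 + Nv * N))) = ε / q * (C₂ * (Nv * (1 + Nv * N))) := by ring
        _ ≤ ε / q * q := mul_le_mul_of_nonneg_left (by rw [hq]; linarith) hτ0.le
        _ = ε := hτ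
  have hU : ∀ p₀ : G, ∃ U : Set G, IsOpen U ∧ p₀ ∈ U ∧ (∀ p ∈ U, ∀ q ∈ U, ‖a p - a q‖ ≤ τ) ∧
      ∀ f ∈ S, ∀ p ∈ U, ∀ q ∈ U, ∀ n, 𝒢.r p = 𝒢.r n → 𝒢.r q = 𝒢.r n →
        ‖𝓐.convIntegrand v.1 f.1 n p - 𝓐.convIntegrand v.1 f.1 n q‖ ≤ τ := by
    intro p₀
    choose U hUo hpU hU using fun f : 𝓐.Cc => exists_isOpen_norm_convIntegrand_sub_le v f hτ p₀
    refine ⟨(⋂ f ∈ S, U f) ∩ a ⁻¹' Metric.ball (a p₀) (τ / 2),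
      (hS.isOpen_biInter fun f _ => hUo f).inter (Metric.isOpen_ball.preimage a.continuous),
      ⟨mem_iInter₂.2 fun f _ => hpU f, Metric.mem_ball_self (half_pos hτ)⟩,
      fun p hp q hq => ?_, fun f hf p hp q hq => ?_⟩
    · have h1 := Metric.mem_ball.1 hp.2
      have h2 := Metric.mem_ball.1 hq.2
      rw [← dist_eq_norm]
      linarith [dist_triangle_right (a p) (a q) (a p₀)]
    · exact hU f p (mem_iInter₂.1 hp.1 f hf) q (mem_iInter₂.1 hq.1 f hf)
  choose U hUo hpU hUa hUf using hU
  obtain ⟨t, χ, hχU, hχc, hχ0, hχ1, hχK⟩ := exists_partition hKv hUo hpU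
  have hχ1' : ∀ i g, χ i g ≤ 1 := fun i g =>
    (Finset.single_le_sum (fun j _ => hχ0 j g) (Finset.mem_univ i)).trans (hχ1 g)
  have hχU' : ∀ i g, χ i g ≠ 0 → g ∈ U i := fun i g hg => hχU i (subset_tsupport _ hg)
  -- The loss caused by δ is counted once for each member of the partition, so δ has to be chosen
  -- after the cover.
  set η := τ / (Fintype.card t + 1) with hη
  have hη0 : 0 < η := by positivity
  have hcard : Fintype.card t * η ≤ τ := by
    rw [hη, mul_div_assoc', div_le_iff₀ (by positivity)]
    nlinarith
  obtain ⟨δ, hδη, hδ⟩ : ∃ δ, (∀ i g, χ i g * (δ / (∫ h, χ i h ∂(H.meas (𝒢.r g)) + δ)) ≤ η) ∧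
      0 < δ := ((eventually_all.2 fun i => H.eventually_mul_div_le (hχc i) (hχ0 i) (hχ1' i)
        hη0).and self_mem_nhdsWithin).exists
  let φ : t → C(G, ℝ) := fun i => H.normalise (χ i) (hχc i) (hχ0 i) hδ
  let α : t → C(G₀, ℝ) := fun i => H.integralMap (a * φ i) hac.mul_right
  have hα : ∀ i x, α i x = ∫ g, a g * φ i g ∂(H.meas x) := fun i x => rfl
  -- Bessel's inequality: α_i(x)² ≤ ∫ a² χ_i dα^x, and ∑ χ_i ≤ 1.
  have hsq : ∀ x, ∑ i, α i x ^ 2 ≤ 𝓐.iNorm H u + ε₀ := fun x => by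
    have hi : ∀ i, Integrable (fun g => a g ^ 2 * χ i g) (H.meas x) := fun i =>
      H.integrable_of_hasCompactSupport x (by fun_prop) (hχc i).mul_left
    refine (Finset.sum_le_sum fun i _ =>
      H.sq_integral_mul_normalise_le (hχc i) (hχ0 i) hδ a x).trans ?_
    rw [← integral_finsetSum Finset.univ (f := fun i g => a g ^ 2 * χ i g) fun i _ => hi i]
    refine le_trans (integral_mono (integrable_finsetSum _ fun i _ => hi i)
      (H.integrable_of_hasCompactSupport x b.continuous hbc) fun g => ?_) (hb1 x)
    change ∑ i, a g ^ 2 * χ i g ≤ b g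
    rw [← Finset.mul_sum, ← hab]
    exact mul_le_of_le_one_right (sq_nonneg _) (hχ1 g)
  have hrec1 : ∀ g ∈ Kv, ‖a g - ∑ i, α i (𝒢.r g) * φ i g‖ ≤ τ * (1 + Na) := fun g hg => by
    have h := H.norm_sub_sum_normalise_le hχc hχ0 hδ (hχK g hg) (fun i => hδη i g)
      (Z := a) a.continuous.continuousOn hτ.le
      fun i hi q hq _ => hUa i g (hχU' i g hi) q (hχU' i q hq)
    refine le_trans (le_of_eq ?_) (h.trans ?_)
    · congr 2
      refine Finset.sum_congr rfl fun i _ => ?_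
      rw [hα, smul_eq_mul, mul_comm]
      simp only [smul_eq_mul, mul_comm (a _)]
      rfl
    · calc τ + Fintype.card t * η * ‖a g‖ ≤ τ + τ * Na := by
            gcongr
            exact hNa g
        _ = τ * (1 + Na) := by ring
  have hrec2 : ∀ f ∈ S, ∀ p ∈ Kv, ∀ n, 𝒢.r p = 𝒢.r n →
      ‖𝓐.convIntegrand v.1 f.1 n p - ∑ i, φ i p •
        ∫ q, φ i q • 𝓐.convIntegrand v.1 f.1 n q ∂(H.meas (𝒢.r p))‖ ≤ τ * (1 + Nv * N) := by
    intro f hf p hp n e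
    refine (H.norm_sub_sum_normalise_le hχc hχ0 hδ (hχK p hp) (fun i => hδη i p)
      (by rw [e]; exact continuousOn_convIntegrand v f n) hτ.le fun i hi q hq e' =>
        hUf i f hf p (hχU' i p hi) q (hχU' i q hq) n e (e'.trans e)).trans ?_
    calc τ + Fintype.card t * η * ‖𝓐.convIntegrand v.1 f.1 n p‖ ≤ τ + τ * (Nv * N) := by
          gcongr
          exact (norm_convIntegrand_le_supNorm v f n p).trans
            (mul_le_mul_of_nonneg_left (hN f hf) hNv0)
      _ = τ * (1 + Nv * N) := by ring
  refine ⟨t, Finset.univ, fun i => 𝓐.mulFun ((α i).comp ⟨𝒢.r, 𝒢.continuous_r⟩),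
    fun i => 𝓐.convL H (𝓐.mulFun (φ i) v),
    fun i => 𝓐.convL H (𝓐.involution (𝓐.mulFun (φ i) v)), fibreOp H v,
    fun i => isAdjointPair_mulFun _, fun i => isAdjointPair_convL _, isAdjointPair_fibreOp v,
    isFibrewiseBounded_sum_mulFun _ α hsq, isFibrewiseBounded_fibreOp hbc (fun g => ?_) hb2,
    fun f hf => ⟨fun g hg => ?_, supNorm_le hε.le fun m => ?_⟩,
    fun f hf => ⟨fun g hg => ?_, supNorm_le hε.le fun m => ?_⟩⟩
  · rw [← hab]
    exact pow_le_pow_left₀ (norm_nonneg _) (hva g) 2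
  · have hg' : g ∉ K₁ := fun h => hg (Or.inl h)
    rw [LinearMap.sub_apply]
    change (𝓐.conv H u f).1 g - _ = 0
    rw [sum_apply, conv_supportedIn huK (hfS f hf) g hg', Finset.sum_eq_zero, sub_zero]
    intro i _
    exact mulFun_supportedIn _ (conv_supportedIn (mulFun_supportedIn _ hv) (hfS f hf)) g hg'
  · refine (hC₁ _ _ φ α a u v f _ huv hv (by positivity) hrec1 m).trans (le_trans ?_ hτ1)
    gcongr
    exact hN f hf
  · rw [LinearMap.sub_apply]
    change _ - (fibreOp H v f).1 g = 0
    rw [sum_apply, (isFibrewiseBounded_fibreOp hbc (fun g => by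
      rw [← hab]; exact pow_le_pow_left₀ (norm_nonneg _) (hva g) 2) hb2).supportedIn (hfS f hf) g
      fun h => hg (Or.inr (Or.inr h)), Finset.sum_eq_zero, sub_zero]
    intro i _
    exact conv_supportedIn (involution_supportedIn (mulFun_supportedIn _ hv))
      (conv_supportedIn (mulFun_supportedIn _ hv) (hfS f hf)) g fun h => hg (Or.inr (Or.inl h))
  · exact (hC₂ _ _ φ v f _ hv (by positivity) (hrec2 f hf) m).trans hτ2

end FellBundle

/-! ## Integration and boundedness of representations -/

open TensorProduct in
/-- Extension of operators that are bounded along a linear map with dense range on a tensor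
product. -/
theorem TensorProduct.exists_extension_rTensor {V E F : Type*} [AddCommGroup V] [Module ℂ V]
    [AddCommGroup E] [Module ℂ E] [NormedAddCommGroup F] [NormedSpace ℂ F] [CompleteSpace F]
    {L : V →ₗ[ℂ] E →ₗ[ℂ] F} (hL : DenseRange (TensorProduct.lift L)) (m : V →ₗ[ℂ] V →ₗ[ℂ] V)
    {c : V → ℝ} (hc : ∀ f, 0 ≤ c f) (hm : ∀ f x,
      ‖TensorProduct.lift L ((m f).rTensor E x)‖ ≤ c f * ‖TensorProduct.lift L x‖) :
    ∃ L' : V →ₗ[ℂ] (F →L[ℂ] F), (∀ f x, L' f (TensorProduct.lift L x) =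
      TensorProduct.lift L ((m f).rTensor E x)) ∧ ∀ f, ‖L' f‖ ≤ c f := by
  set Λ := TensorProduct.lift L
  have hspec : ∀ f x, (Λ ∘ₗ (m f).rTensor E).extendOfNorm Λ (Λ x) = Λ ((m f).rTensor E x) :=
    fun f x => LinearMap.extendOfNorm_eq hL ⟨_, hm f⟩ x
  have hext : ∀ S S' : F →L[ℂ] F, (∀ x, S (Λ x) = S' (Λ x)) → S = S' := fun S S' h =>
    ContinuousLinearMap.coeFn_injective (hL.equalizer S.continuous S'.continuous (funext h))
  exact ⟨{
      toFun := fun f => (Λ ∘ₗ (m f).rTensor E).extendOfNorm Λ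
      map_add' := fun f₁ f₂ => hext _ _ fun x => by
        rw [_root_.add_apply, hspec, hspec, hspec, map_add, LinearMap.rTensor_add,
          LinearMap.add_apply, map_add]
      map_smul' := fun k f => hext _ _ fun x => by
        rw [RingHom.id_apply, _root_.smul_apply, hspec, hspec, map_smul, LinearMap.rTensor_smul,
          LinearMap.smul_apply, map_smul] },
    hspec, fun f => LinearMap.opNorm_extendOfNorm_le hL (hc f) (hm f)⟩

namespace FellBundle

open TopGroupoid TensorProduct

variable {G₀ : Type u₀} {G : Type u} [TopologicalSpace G₀] [TopologicalSpace G]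
  [LocallyCompactSpace G] [T2Space G] [MeasurableSpace G] [BorelSpace G]
  {𝒢 : TopGroupoid G₀ G} {A : G → Type w} [∀ g, NormedAddCommGroup (A g)]
  [∀ g, NormedSpace ℂ (A g)] [∀ g, CompleteSpace (A g)] [TopologicalSpace (TotalSp A)]
  {𝓐 : FellBundle 𝒢 A} {H : HaarSystem 𝒢}
  {D : Type v} {F : Type v'} [NonUnitalCStarAlgebra D] [NormedAddCommGroup F]
  [NormedSpace ℂ F] [CompleteSpace F] [HilbertModule D F]
  {F₀ : Type v''} [AddCommGroup F₀] [Module ℂ F₀]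
  {ι : F₀ →ₗ[ℂ] F} {L : 𝓐.Cc →ₗ[ℂ] F₀ →ₗ[ℂ] F}

/-- The factorisations give the constant ‖u‖_I + ε for each ε > 0. -/
theorem IsPreRep.norm_rTensor_convL_le (hL : 𝓐.IsPreRep H D ι L) (u : 𝓐.Cc)
    (x : 𝓐.Cc ⊗[ℂ] F₀) : ‖TensorProduct.lift L ((𝓐.convL H u).rTensor F₀ x)‖ ≤
      𝓐.iNorm H u * ‖TensorProduct.lift L x‖ := by
  have hlim : Tendsto (fun ε => (𝓐.iNorm H u + ε) * ‖TensorProduct.lift L x‖) (𝓝[>] (0 : ℝ))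
      (𝓝 (𝓐.iNorm H u * ‖TensorProduct.lift L x‖)) := by
    have h : Continuous fun ε : ℝ => (𝓐.iNorm H u + ε) * ‖TensorProduct.lift L x‖ := by fun_prop
    have h0 := h.tendsto 0
    rw [add_zero] at h0
    exact h0.mono_left nhdsWithin_le_nhds
  refine ge_of_tendsto hlim ?_
  filter_upwards [self_mem_nhdsWithin] with ε hε
  exact hL.norm_le_of_hasFactorisations
    (add_nonneg (iNorm_nonneg H u) (le_of_lt hε)) (hasFactorisations_convL H u hε) x

/-- A pre-representation integrates to a representation. -/
theorem IsPreRep.exists_representation (hL : 𝓐.IsPreRep H D ι L)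
    (hd : Dense (Submodule.span ℂ {y : F | ∃ f ξ, L f ξ = y} : Set F)) :
    ∃ L' : 𝓐.Cc →ₗ[ℂ] (F →L[ℂ] F), 𝓐.IsRepresentation H D L' ∧ 𝓐.INormBounded H L' ∧
      (∀ f ξ, L' f (ι ξ) = L f ξ) ∧ ∀ f f₂ ξ, L' f (L f₂ ξ) = L (𝓐.conv H f f₂) ξ := by
  set Λ := TensorProduct.lift L with hΛ
  have hΛd : DenseRange Λ := by
    refine hd.mono ?_
    change Submodule.span ℂ _ ≤ LinearMap.range Λ
    rw [Submodule.span_le]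
    rintro _ ⟨f, ξ, rfl⟩
    exact ⟨f ⊗ₜ ξ, TensorProduct.lift.tmul _ _⟩
  have hext : ∀ S S' : F →L[ℂ] F, (∀ x, S (Λ x) = S' (Λ x)) → S = S' := fun S S' h =>
    ContinuousLinearMap.coeFn_injective (hΛd.equalizer S.continuous S'.continuous (funext h))
  obtain ⟨L', hL', hnorm⟩ := TensorProduct.exists_extension_rTensor hΛd (𝓐.convL H)
    (iNorm_nonneg H) hL.norm_rTensor_convL_le
  rw [← hΛ] at hL'
  have hconv : ∀ f f₂ ξ, L' f (L f₂ ξ) = L (𝓐.conv H f f₂) ξ := fun f f₂ ξ => by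
    have h := hL' f (f₂ ⊗ₜ ξ)
    rwa [LinearMap.rTensor_tmul, hΛ, TensorProduct.lift.tmul, TensorProduct.lift.tmul] at h
  have hadj : ∀ f x y, HilbertModule.inner (D := D) (L' f x) y =
      HilbertModule.inner x (L' (𝓐.involution f) y) := by
    intro f x y
    refine congrFun (hΛd.equalizer
      ((HilbertModule.continuous_inner_left D y).comp (L' f).continuous)
      (HilbertModule.continuous_inner_left D (L' (𝓐.involution f) y)) (funext fun a => ?_)) x
    refine congrFun (hΛd.equalizer (HilbertModule.continuous_inner_right D (L' f (Λ a)))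
      ((HilbertModule.continuous_inner_right D (Λ a)).comp (L' (𝓐.involution f)).continuous)
      (funext fun b => ?_)) y
    simp only [Function.comp_apply, hL']
    exact hL.inner_rTensor (isAdjointPair_convL f) a b
  refine ⟨L', ⟨hadj, fun f₁ f₂ => hext _ _ fun x => ?_⟩, ⟨1, fun f => ?_⟩, fun f ξ => ?_, hconv⟩
  · have h : 𝓐.convL H (𝓐.conv H f₁ f₂) = 𝓐.convL H f₁ ∘ₗ 𝓐.convL H f₂ :=
      LinearMap.ext fun f => conv_assoc f₁ f₂ f
    rw [ContinuousLinearMap.comp_apply, hL', hL', hL', h, LinearMap.rTensor_comp_apply]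
  · rw [one_mul]
    exact hnorm f
  -- Both vectors are tested against L(f₂)η. Moving L'(f) to the left gives ⟨L(f^* * f₂)η, ι(ξ)⟩,
  -- which is ⟨L(f₂)η, L(f)ξ⟩ by condition (2) after taking adjoints.
  · refine HilbertModule.ext_of_dense (D := D) hΛd ?_
    rintro _ ⟨y, rfl⟩
    have h := hadj (𝓐.involution f) (Λ y) (ι ξ)
    rw [involution_involution] at h
    rw [← h]
    induction y using TensorProduct.induction_on with
    | zero => simp
    | add y₁ y₂ h₁ h₂ =>
      have e : ∀ y, HilbertModule.inner (D := D) (L' (𝓐.involution f) (Λ y)) (ι ξ) =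
          HilbertModule.inner (Λ y) (L' f (ι ξ)) := fun y => by
        rw [hadj, involution_involution]
      simp only [map_add, LinearMap.add_apply, h₁ (e y₁), h₂ (e y₂)]
    | tmul f₂ η =>
      rw [hΛ, TensorProduct.lift.tmul, hconv, ← HilbertModule.star_inner, ← hL.inner_L,
        HilbertModule.star_inner]

/-- Continuity in the inductive limit topology supplies condition (1) and the *-homomorphism
property supplies (2). Nondegeneracy may fail, which is why `IsPreRep` omits the density conditions.
-/
theorem IsRepresentation.isPreRep {L : 𝓐.Cc →ₗ[ℂ] (F →L[ℂ] F)} (hL : 𝓐.IsRepresentation H D L)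
    (hc : Continuous[𝓐.indLimTopology, inferInstance] L) :
    𝓐.IsPreRep H D LinearMap.id (ContinuousLinearMap.coeLM ℂ ∘ₗ L) where
  bounded ξ η K hK := by
    obtain ⟨C, hC⟩ := (continuous_indLim_iff L).1 hc K hK
    refine ⟨‖ξ‖ * C * ‖η‖, fun f hf => ?_⟩
    calc ‖HilbertModule.inner (D := D) ξ (L f η)‖ ≤ ‖ξ‖ * ‖L f η‖ :=
          HilbertModule.norm_inner_le _ _
      _ ≤ ‖ξ‖ * (‖L f‖ * ‖η‖) :=
          mul_le_mul_of_nonneg_left ((L f).le_opNorm η) (norm_nonneg _)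
      _ ≤ ‖ξ‖ * (C * 𝓐.supNorm f * ‖η‖) := mul_le_mul_of_nonneg_left
          (mul_le_mul_of_nonneg_right (hC f hf) (norm_nonneg _)) (norm_nonneg _)
      _ = ‖ξ‖ * C * ‖η‖ * 𝓐.supNorm f := by ring
  inner_L ξ η f₁ f₂ := by
    change HilbertModule.inner (D := D) (L f₁ ξ) (L f₂ η) = HilbertModule.inner ξ (L _ η)
    rw [hL.adjoint, hL.map_conv]
    rfl

/-- A representation that is continuous in the inductive limit topology is contractive for the
`I`-norm. -/
theorem IsRepresentation.norm_le {L : 𝓐.Cc →ₗ[ℂ] (F →L[ℂ] F)} (hL : 𝓐.IsRepresentation H D L)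
    (hc : Continuous[𝓐.indLimTopology, inferInstance] L) (u : 𝓐.Cc) : ‖L u‖ ≤ 𝓐.iNorm H u := by
  have h1 : ∀ u f x, ‖L u (L f x)‖ ≤ 𝓐.iNorm H u * ‖L f x‖ := fun u f x => by
    have h := (hL.isPreRep hc).norm_rTensor_convL_le u (f ⊗ₜ x)
    rw [LinearMap.rTensor_tmul, TensorProduct.lift.tmul, TensorProduct.lift.tmul] at h
    change ‖L (𝓐.conv H u f) x‖ ≤ _ * ‖L f x‖ at h
    rwa [hL.map_conv] at h
  refine (L u).opNorm_le_bound (iNorm_nonneg H u) fun x => ?_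
  -- The estimate `h1` only covers vectors in the range of the representation. For arbitrary x,
  -- ‖L(u)x‖² = ‖⟨x, L(u^*)L(u)x⟩‖, where L(u^*) acts on such a vector.
  have h2 : ‖L u x‖ ^ 2 ≤ 𝓐.iNorm H u * ‖x‖ * ‖L u x‖ := by
    rw [HilbertModule.norm_sq (D := D), hL.adjoint]
    refine (HilbertModule.norm_inner_le _ _).trans ?_
    refine (mul_le_mul_of_nonneg_left (h1 _ _ _) (norm_nonneg _)).trans_eq ?_
    rw [iNorm_involution]
    ring
  rcases (norm_nonneg (L u x)).eq_or_lt with h | h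
  · rw [← h]
    exact mul_nonneg (iNorm_nonneg H u) (norm_nonneg _)
  · rw [sq] at h2
    exact le_of_mul_le_mul_right h2 h

/-- Left multiplication represents D isometrically by adjointable operators on D as a Hilbert module
over itself, so the result for representations applies. -/
theorem IsStarHom.norm_le {φ : 𝓐.Cc →ₗ[ℂ] D} (hφ : 𝓐.IsStarHom H φ)
    (hc : Continuous[𝓐.indLimTopology, inferInstance] φ) (u : 𝓐.Cc) : ‖φ u‖ ≤ 𝓐.iNorm H u := by
  let _ := HilbertModule.self D
  let L : 𝓐.Cc →ₗ[ℂ] (D →L[ℂ] D) := (ContinuousLinearMap.mul ℂ D : D →ₗ[ℂ] D →L[ℂ] D) ∘ₗ φ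
  have hn : ∀ f, ‖L f‖ = ‖φ f‖ := fun f => ContinuousLinearMap.opNorm_mul_apply ℂ D (φ f)
  have hL : 𝓐.IsRepresentation H D L := by
    refine ⟨fun f x y => ?_, fun f₁ f₂ => ?_⟩
    · change star (φ f * x) * y = star x * (φ (𝓐.involution f) * y)
      rw [StarMul.star_mul, hφ.map_involution, _root_.mul_assoc]
    · ext x
      change φ (𝓐.conv H f₁ f₂) * x = φ f₁ * (φ f₂ * x)
      rw [hφ.map_conv, _root_.mul_assoc]
  rw [← hn]
  refine hL.norm_le ?_ u
  rw [continuous_indLim_iff] at hc ⊢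
  simpa only [hn] using hc

end FellBundle

/-! ## Star homomorphisms on the full section algebra -/

/-- Transfer of the structure of a `C^*`-algebra along a bijection. -/
@[reducible]
def Equiv.nonUnitalCStarAlgebra {S : Type*} {B : Type*} [NonUnitalCStarAlgebra B] (e : S ≃ B) :
    NonUnitalCStarAlgebra S :=
  letI := e.nonUnitalRing
  letI := e.module ℂ
  letI : Star S := ⟨fun x => e.symm (star (e x))⟩
  letI := NonUnitalNormedRing.induced S B e.ringEquiv e.injective
  have hadd : ∀ x y, e (x + y) = e x + e y := fun x y => e.apply_symm_apply _
  have hmul : ∀ x y, e (x * y) = e x * e y := fun x y => e.apply_symm_apply _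
  have hsmul : ∀ (c : ℂ) x, e (c • x) = c • e x := fun c x => e.apply_symm_apply _
  have hstar : ∀ x, e (star x) = star (e x) := fun x => e.apply_symm_apply _
  have hnorm : ∀ x, ‖x‖ = ‖e x‖ := fun x => rfl
  { star_involutive := fun x => e.injective (by rw [hstar, hstar, star_star])
    star_mul := fun x y => e.injective (by rw [hstar, hmul, hmul, hstar, hstar, star_mul])
    star_add := fun x y => e.injective (by rw [hstar, hadd, hadd, hstar, hstar, star_add])
    complete := by
      have hu : IsUniformInducing e := ⟨rfl⟩
      have hS : CompleteSpace S := hu.completeSpace_congr e.surjective |>.2 inferInstance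
      exact fun {f} hf => hS.complete hf
    norm_mul_self_le := fun x => by
      simp only [hnorm, hmul, hstar]
      exact CStarRing.norm_mul_self_le _
    norm_smul_le := fun c x => by
      rw [hnorm, hsmul, norm_smul, ← hnorm]
    smul_assoc := fun c x y => e.injective (by
      simp only [smul_eq_mul, hsmul, hmul, smul_mul_assoc])
    smul_comm := fun c x y => e.injective (by
      simp only [smul_eq_mul, hsmul, hmul, mul_smul_comm])
    star_smul := fun c x => e.injective (by rw [hstar, hsmul, hsmul, hstar, star_smul]) }

/-- Each point of the closure is the limit of a sequence φ(x_n), so the closure is a subset of the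
image of the set of sequences in X. -/
theorem small_closure_range {X : Type u} {Y : Type v} [TopologicalSpace Y] [T2Space Y]
    [FirstCountableTopology Y] [Nonempty Y] (φ : X → Y) : Small.{u} (closure (range φ)) := by
  refine small_subset (s := range fun s : ℕ → X => limUnder atTop (φ ∘ s)) ?_
  intro y hy
  obtain ⟨x, hx, hxy⟩ := mem_closure_iff_seq_limit.1 hy
  choose s hs using hx
  have h : φ ∘ s = x := funext hs
  exact ⟨s, (h ▸ hxy).limUnder_eq⟩

/-! ### Universal property of the full section algebra. -/

namespace FellBundle

variable {G₀ : Type u₀} {G : Type u} [TopologicalSpace G₀] [TopologicalSpace G]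
  [LocallyCompactSpace G] [T2Space G] [MeasurableSpace G] [BorelSpace G]
  {𝒢 : TopGroupoid G₀ G} {A : G → Type w} [∀ g, NormedAddCommGroup (A g)]
  [∀ g, NormedSpace ℂ (A g)] [∀ g, CompleteSpace (A g)] [TopologicalSpace (TotalSp A)]
  {𝓐 : FellBundle 𝒢 A} {H : HaarSystem 𝒢} {D : Type v} [NonUnitalCStarAlgebra D]

/-- The image of a *-homomorphism. -/
def IsStarHom.range {φ : 𝓐.Cc →ₗ[ℂ] D} (hφ : 𝓐.IsStarHom H φ) :
    NonUnitalStarSubalgebra ℂ D where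
  carrier := Set.range φ
  add_mem' := by
    rintro _ _ ⟨f, rfl⟩ ⟨g, rfl⟩
    exact ⟨f + g, map_add _ _ _⟩
  zero_mem' := ⟨0, map_zero _⟩
  mul_mem' := by
    rintro _ _ ⟨f, rfl⟩ ⟨g, rfl⟩
    exact ⟨𝓐.conv H f g, hφ.map_conv f g⟩
  smul_mem' := by
    rintro c _ ⟨f, rfl⟩
    exact ⟨c • f, map_smul _ _ _⟩
  star_mem' := by
    rintro _ ⟨f, rfl⟩
    exact ⟨𝓐.involution f, hφ.map_involution f⟩

/-- Every contractive *-homomorphism contributes to the norm of the full section algebra, whatever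
the universe of its codomain. -/
theorem IsStarHom.mem_cstarSeminorms {φ : 𝓐.Cc →ₗ[ℂ] D} (hφ : 𝓐.IsStarHom H φ)
    (hI : ∀ f, ‖φ f‖ ≤ 𝓐.iNorm H f) : (fun f => ‖φ f‖) ∈ 𝓐.cstarSeminorms H := by
  let B := hφ.range.topologicalClosure
  have hB : IsClosed (B : Set D) := isClosed_closure
  let _ : NonUnitalCStarAlgebra B := NonUnitalStarSubalgebra.nonUnitalCStarAlgebra B
  -- The seminorms are indexed by C^*-algebras in one universe, while D may live in another one. The
  -- closure of the image is small enough to be copied into the required universe.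
  have hsmall : Small.{max u w} B := small_closure_range φ
  let e := (equivShrink B).symm
  let _ := e.nonUnitalCStarAlgebra
  let j : 𝓐.Cc → B := fun f => ⟨φ f, subset_closure ⟨f, rfl⟩⟩
  have hj : ∀ f, e (e.symm (j f)) = j f := fun f => e.apply_symm_apply _
  let ψ : 𝓐.Cc →ₗ[ℂ] Shrink.{max u w} B :=
    { toFun := fun f => e.symm (j f)
      map_add' := fun f₁ f₂ => by
        apply e.injective
        refine (hj _).trans (Eq.trans ?_ (e.apply_symm_apply (_ + _)).symm)
        change _ = e (e.symm (j f₁)) + e (e.symm (j f₂))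
        rw [hj, hj]
        exact Subtype.ext (map_add φ _ _)
      map_smul' := fun c f => by
        apply e.injective
        refine (hj _).trans (Eq.trans ?_ (e.apply_symm_apply (_ • _)).symm)
        change _ = c • e (e.symm (j f))
        rw [hj]
        exact Subtype.ext (map_smul φ _ _) }
  have hψ : ∀ f, ‖ψ f‖ = ‖φ f‖ := fun f => congrArg norm (hj f)
  refine ⟨Shrink.{max u w} B, inferInstance, ψ, ⟨fun f₁ f₂ => ?_, fun f => ?_⟩, fun f => ?_,
    fun f => (hψ f).symm⟩
  · apply e.injective
    refine (hj _).trans (Eq.trans ?_ (e.apply_symm_apply (_ * _)).symm)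
    change _ = e (e.symm (j f₁)) * e (e.symm (j f₂))
    rw [hj, hj]
    exact Subtype.ext (hφ.map_conv _ _)
  · apply e.injective
    refine (hj _).trans (Eq.trans ?_ (e.apply_symm_apply (star _)).symm)
    change _ = star (e (e.symm (j f)))
    rw [hj]
    exact Subtype.ext (hφ.map_involution _)
  · rw [hψ]
    exact hI f

/-- The seminorm of φ is one coordinate of the bounded family whose supremum is the norm in
C^*(G,A). -/
theorem IsStarHom.norm_le_norm_toFull {φ : 𝓐.Cc →ₗ[ℂ] D} (hφ : 𝓐.IsStarHom H φ)
    (hI : ∀ f, ‖φ f‖ ≤ 𝓐.iNorm H f) (f : 𝓐.Cc) : ‖φ f‖ ≤ ‖𝓐.toFull H f‖ := by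
  let p : 𝓐.cstarSeminorms H := ⟨_, hφ.mem_cstarSeminorms hI⟩
  have h : ‖𝓐.seminormHom H p f‖ ≤ ‖𝓐.universalHom H f‖ :=
    lp.norm_apply_le_norm ENNReal.top_ne_zero (𝓐.universalHom H f) p
  rwa [norm_seminormHom] at h

theorem denseRange_toFull : DenseRange (𝓐.toFull H) := by
  rw [DenseRange, Subtype.dense_iff]
  intro y hy
  refine closure_mono ?_ hy
  rintro _ ⟨f, rfl⟩
  exact ⟨_, ⟨f, rfl⟩, rfl⟩

theorem toFull_conv (f₁ f₂ : 𝓐.Cc) :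
    𝓐.toFull H (𝓐.conv H f₁ f₂) = 𝓐.toFull H f₁ * 𝓐.toFull H f₂ :=
  Subtype.ext ((𝓐.universalHom_isStarHom H).map_conv f₁ f₂)

theorem toFull_involution (f : 𝓐.Cc) : 𝓐.toFull H (𝓐.involution f) = star (𝓐.toFull H f) :=
  Subtype.ext ((𝓐.universalHom_isStarHom H).map_involution f)

/-- The universal property of the full section algebra. -/
theorem IsStarHom.existsUnique_extension {φ : 𝓐.Cc →ₗ[ℂ] D} (hφ : 𝓐.IsStarHom H φ)
    (hI : ∀ f, ‖φ f‖ ≤ 𝓐.iNorm H f) :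
    ∃! Φ : 𝓐.FullCStar H →⋆ₙₐ[ℂ] D, ∀ f, Φ (𝓐.toFull H f) = φ f := by
  have hd := denseRange_toFull (𝓐 := 𝓐) (H := H)
  let Ψ : 𝓐.FullCStar H →L[ℂ] D := φ.extendOfNorm (𝓐.toFull H)
  have hΨ : ∀ f, Ψ (𝓐.toFull H f) = φ f := LinearMap.extendOfNorm_eq hd
    ⟨1, fun f => by rw [one_mul]; exact hφ.norm_le_norm_toFull hI f⟩
  let Φ : 𝓐.FullCStar H →⋆ₙₐ[ℂ] D :=
    { toFun := Ψ
      map_smul' := map_smul Ψ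
      map_zero' := map_zero Ψ
      map_add' := map_add Ψ
      map_mul' := fun x y => by
        refine hd.induction_on₂ (p := fun x y => Ψ (x * y) = Ψ x * Ψ y) (isClosed_eq ?_ ?_) ?_ x y
        · exact Ψ.continuous.comp _root_.continuous_mul
        · exact (Ψ.continuous.comp continuous_fst).mul (Ψ.continuous.comp continuous_snd)
        · intro f₁ f₂
          rw [← toFull_conv, hΨ, hΨ, hΨ, hφ.map_conv]
      map_star' := fun x => by
        refine hd.induction_on (p := fun x => Ψ (star x) = star (Ψ x)) x (isClosed_eq ?_ ?_) ?_
        · exact Ψ.continuous.comp ContinuousStar.continuous_star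
        · exact ContinuousStar.continuous_star.comp Ψ.continuous
        · intro f
          rw [← toFull_involution, hΨ, hΨ, hφ.map_involution] }
  refine ⟨Φ, hΨ, fun Φ' hΦ' => DFunLike.coe_injective ?_⟩
  -- A *-homomorphism between C^*-algebras is automatically continuous, so it is determined by its
  -- values on the dense image of C_c(G,A).
  open scoped CStarAlgebra in
  exact hd.equalizer (map_continuous Φ') Ψ.continuous
    (funext fun f => (hΦ' f).trans (hΨ f).symm)

end FellBundle

end

/-! ### The main theorem. -/

theorem mainTheorem2 {G₀ : Type u₀} {G : Type u} [TopologicalSpace G₀] [TopologicalSpace G]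
    [LocallyCompactSpace G] [T2Space G] [MeasurableSpace G] [BorelSpace G]
    {𝒢 : TopGroupoid G₀ G} (H : HaarSystem 𝒢)
    {A : G → Type w} [∀ g, NormedAddCommGroup (A g)] [∀ g, NormedSpace ℂ (A g)]
    [∀ g, CompleteSpace (A g)] [TopologicalSpace (TotalSp A)] (𝓐 : FellBundle 𝒢 A)
    (D : Type v) [NonUnitalCStarAlgebra D] :
    (∀ (F : Type v') [NormedAddCommGroup F] [NormedSpace ℂ F] [CompleteSpace F]
        [HilbertModule D F],
      (∀ (F₀ : Type v'') [AddCommGroup F₀] [Module ℂ F₀] (P : 𝓐.PreRepresentation H D F F₀),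
        ∃ L' : 𝓐.Cc →ₗ[ℂ] (F →L[ℂ] F), 𝓐.IsRepresentation H D L' ∧ 𝓐.IsNondegenerate L' ∧
          𝓐.INormBounded H L' ∧ (∀ f ξ, L' f (P.ι ξ) = P.L f ξ) ∧
          ∀ f f₂ ξ, L' f (P.L f₂ ξ) = P.L (𝓐.conv H f f₂) ξ) ∧
      ∀ L : 𝓐.Cc →ₗ[ℂ] (F →L[ℂ] F), 𝓐.IsRepresentation H D L →
        (𝓐.INormBounded H L ↔ Continuous[𝓐.indLimTopology, inferInstance] L)) ∧
    ∀ φ : 𝓐.Cc →ₗ[ℂ] D, 𝓐.IsStarHom H φ →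
      (Continuous[𝓐.indLimTopology, inferInstance] φ ↔ 𝓐.INormBounded H φ) ∧
      (𝓐.INormBounded H φ →
        ∃! Φ : 𝓐.FullCStar H →⋆ₙₐ[ℂ] D, ∀ f, Φ (𝓐.toFull H f) = φ f) := by
  refine ⟨fun F _ _ _ _ => ⟨fun F₀ _ _ P => ?_, fun L hL => ?_⟩, fun φ hφ => ?_⟩
  · obtain ⟨L', hrep, hI, hι, hconv⟩ :=
      FellBundle.IsPreRep.exists_representation ⟨P.bounded, P.inner_L⟩ P.dense_span
    -- Nondegeneracy follows from condition (3), because L(f)ξ = L'(f)(ι(ξ)).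
    refine ⟨L', hrep, P.dense_span.mono (Submodule.span_mono ?_), hI, hι, hconv⟩
    rintro _ ⟨f, ξ, rfl⟩
    exact ⟨f, P.ι ξ, hι f ξ⟩
  · refine ⟨FellBundle.continuous_of_iNormBounded, fun hc => ⟨1, fun f => ?_⟩⟩
    rw [one_mul]
    exact hL.norm_le hc f
  · refine ⟨⟨fun hc => ⟨1, fun f => ?_⟩, FellBundle.continuous_of_iNormBounded⟩, fun hI => ?_⟩
    · rw [one_mul]
      exact hφ.norm_le hc f
    -- Boundedness with any constant gives continuity, and this gives boundedness with constant 1,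
    -- as the seminorms defining C^*(G,A) require.
    · exact hφ.existsUnique_extension (hφ.norm_le (FellBundle.continuous_of_iNormBounded hI))
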